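/- **Setting.** Let $\mathcal X$ be a measurable space and $\mathcal F$ a set of measurable functions $\mathcal X\to[0,1]$ with pseudo dimension $d=\mathrm{Pdim}(\mathcal F)$, $1\le d<\infty$ (the VC dimension of the sets $\{(x,\zeta): f(x)>\zeta\}$, $f\in\mathcal F$), having a countable subset from which every member of $\mathcal F$ is a pointwise limit of a sequence. A *regression oracle* maps a finite list $S$ of weighted examples $(w,x,y)\in\mathbb R_+\times\mathcal X\times\{\pm1\}$ to a minimizer over $f\in\mathcal F$ of $\sum_{(w,x,y)\in S}w(f(x)-y)^2$; in square losses the labels $+1,-1$ are encoded as $1,0$. The oracle's output is jointly measurable in the examples and the point of evaluation. For a joint law $P$ of $(x,y)$ let $\eta$ be the conditional probability of $y=+1$, and let $h^\star(x)=\mathrm{sgn}(2\eta(x)-1)$ (with $\mathrm{sgn}\,0=+1$), $\mathrm{err}(h)=P(h(x)\ne y)$ and, for $\hat h:\mathcal X\to\{+1,-1,\bot\}$, $\mathrm{err}_\gamma(\hat h)=P(\hat h(x)\ne y,\hat h(x)\ne\bot)+(\tfrac12-\gamma)P(\hat h(x)=\bot)$. For $f_0\in\mathcal F$ put $$\theta^{\rm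 val}_{f_0}(\mathcal F,\gamma_0,\epsilon_0)=\sup_{D}\ \sup_{\gamma'>\gamma_0,\,\epsilon'>\epsilon_0}\Big\{\tfrac{\gamma'^2}{\epsilon'^2}\,D\big(x:\exists f\in\mathcal F,\ |f(x)-f_0(x)|>\gamma',\ \|f-f_0\|_{L^2(D)}\le\epsilon'\big)\Big\}\vee1,$$ with $D$ ranging over the probability measures on $\mathcal X$. **Algorithm.** Inputs: $0<\epsilon<\gamma<\tfrac12$, $\delta\in(0,1)$ and $d$. Let $T=\frac{d}{\epsilon\gamma}$, $M=\lceil\log_2T\rceil$, $C_\delta=c\,d\log(T/\delta)$, $\tau_0=0$, $\tau_m=2^m$ for $m\ge1$, $\beta_m=(M-m+1)(2\epsilon^2\tau_{M-1}+2C_\delta)$. In epoch $m=1,\dots,M$ let $\hat R_m(f)$ be the sum of $(f(x_t)-y_t)^2$ over the queried times $t\le\tau_{m-1}$, let $\hat f_m\in\operatorname{argmin}_{\mathcal F}\hat R_m$ be the oracle's output, $\mathcal F_m(\beta)=\{f\in\mathcal F:\hat R_m(f)\le\hat R_m(\hat f_m)+\beta\}$, and let $[l_m(x),u_m(x)]$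 be confidence bounds. Put $\hat h_m(x)=\bot$ if $[l_m(x),u_m(x)]\subseteq[\tfrac12-\gamma,\tfrac12+\gamma]$ and $\hat h_m(x)=\mathrm{sgn}(2\hat f_m(x)-1)$ otherwise. If $m=M$, return $\hat h_M$; otherwise, for $t=\tau_{m-1}+1,\dots,\tau_m$, observe $x_t$ and query $y_t$ if and only if $\tfrac12\in(l_m(x_t),u_m(x_t))$ and $\hat h_m(x_t)\ne\bot$. In the idealized algorithm $l_m(x)=\inf_{f\in\mathcal F_m(\beta_m)}f(x)$ and $u_m(x)=\sup_{f\in\mathcal F_m(\beta_m)}f(x)$. In an *implementation via the regression oracle*, $(l_m(x),u_m(x))$ is the output of a subroutine that adaptively calls the oracle and otherwise knows only $\mathcal X$, the inputs of the algorithm, $m$, $x$ and the examples queried so far (in particular neither $\mathcal F$ nor $P$). **Theorem.** There are universal constants $c,C>0$ such that for every measurable space $\mathcal X$ there is an implementation via the regression oracle for which the following holds for all inputs, all $\mathcal F$ as above with pseudo dimension $d$, and all regression oracles for $\mathcal F$. 1. (Guarantees.) Let $P$ be a joint law and let $\bar f\in\mathcal F$ and $\kappa\le\epsilon$ satisfy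 $\sup_x|\bar f(x)-\eta(x)|\le\kappa$. Put $\bar\theta=\sup_{\iota>0}\theta^{\rm val}_{\bar f}(\mathcal F,\gamma/2,\iota)$. If the examples are i.i.d. from $P$, then with probability at least $1-2\delta$ the returned classifier has Chow's excess error $$\mathrm{err}_\gamma(\hat h_M)-\mathrm{err}(h^\star)\le C\,\epsilon\,\bar\theta\,\log\tfrac{d}{\epsilon\gamma\delta},$$ and the number of queried labels is at most $C\,\frac{\bar\theta d}{\gamma^2}\log^2\!\big(\tfrac{d}{\epsilon\gamma}\big)\log\tfrac{d}{\epsilon\gamma\delta}$. 2. (Confidence bounds.) For all data, all $m\le M$ and all $x$, $$\inf_{f\in\mathcal F_m(2\beta_m)}f(x)-\tfrac\gamma4\le l_m(x)\le\inf_{f\in\mathcal F_m(\beta_m)}f(x)+\tfrac\gamma4,\qquad \sup_{f\in\mathcal F_m(\beta_m)}f(x)-\tfrac\gamma4\le u_m(x)\le\sup_{f\in\mathcal F_m(2\beta_m)}f(x)+\tfrac\gamma4 .$$ 3. (Cost.) For all data the total number of oracle calls is at most $$C\,\tfrac{d}{\epsilon\gamma^3}\log^2\!\big(\tfrac d{\epsilon\gamma}\big)\log\!\Big(\tfrac1\gamma\log\tfrac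 d{\epsilon\gamma}\Big)=\tilde O\big(\tfrac{d}{\epsilon\gamma^3}\big),$$ and evaluating $\hat h_M$ at any point takes at most $C\,\frac1{\gamma^2}\log^2\!\big(\tfrac d\epsilon\big)\log\!\big(\tfrac1\gamma\log\tfrac d{\epsilon\gamma}\big)=\tilde O\big(\frac1{\gamma^2}\log^2\frac d\epsilon\big)$ oracle calls. Moreover there is such an implementation for which, for all $\mathcal F$ as above that are in addition convex and closed under pointwise limits of sequences, items 1 and 2 hold with $2\beta_m$ replaced by $\beta_m$, the total number of oracle calls is at most $C\,\frac{d}{\epsilon\gamma}\log\!\big(\tfrac1\gamma\log\tfrac d{\epsilon\gamma}\big)=\tilde O\big(\frac d{\epsilon\gamma}\big)$, and evaluating $\hat h_M$ at any point takes at most $C\log\!\big(\tfrac1\gamma\log\tfrac d{\epsilon\gamma}\big)=\tilde O(\log\frac1\gamma)$ oracle calls. -/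

import Mathlib

open MeasureTheory Filter Topology
open scoped NNReal ENNReal

universe u

namespace Abstention

noncomputable section

/-! ### Labels, square loss and the regression oracle -/

/-- The label space has two elements; `true` is the label `+1` and `false` is the label `-1`.
In square losses the label is encoded as `1` (positive) or `0` (negative), so that the
conditional mean of the encoded label is the conditional probability of a positive label. -/
def labelVal (y : Bool) : ℝ := if y then 1 else 0

/-- A weighted labelled example `(w, x, y)` with `w ≥ 0`. -/
abbrev WExample (X : Type u) : Type u := ℝ≥0 × X × Bool

/-- Weighted square loss of `f` on a finite collection of weighted examples. -/
def wLoss {X : Type u} (S : List (WExample X)) (f : X → ℝ) : ℝ :=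
  (S.map fun e => (e.1 : ℝ) * (f e.2.1 - labelVal e.2.2) ^ 2).sum

/-- `O` is a regression oracle for `F`: it maps weighted examples to a minimizer over `F` of the
weighted square loss. -/
def IsRegressionOracle {X : Type u} (F : Set (X → ℝ)) (O : List (WExample X) → X → ℝ) : Prop :=
  ∀ S, O S ∈ F ∧ ∀ f ∈ F, wLoss S (O S) ≤ wLoss S f

/-- The selection of minimizers made by the oracle is jointly measurable in the examples and the
point of evaluation. -/
def MeasurableOracle {X : Type u} [MeasurableSpace X] (O : List (WExample X) → X → ℝ) : Prop :=
  ∀ n : ℕ, Measurable fun p : (Fin n → WExample X) × X => O (List.ofFn p.1) p.2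

/-! ### Programs with access to a regression oracle -/

/-- A program that may call a regression oracle: it either stops with an output, or submits
weighted examples to the oracle and continues depending on the function that is returned. -/
inductive OracleProg (X : Type u) (α : Type) : Type u
  | ret (a : α) : OracleProg X α
  | call (S : List (WExample X)) (k : (X → ℝ) → OracleProg X α) : OracleProg X α

/-- The output of a program when it is run with the oracle `O`. -/
def OracleProg.run {X : Type u} {α : Type} (O : List (WExample X) → X → ℝ) :
    OracleProg X α → α
  | .ret a => a
  | .call S k => (k (O S)).run O

/-- The number of oracle calls of a program when it is run with the oracle `O`. -/
def OracleProg.calls {X : Type u} {α : Type} (O : List (WExample X) → X → ℝ) :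
    OracleProg X α → ℕ
  | .ret _ => 0
  | .call S k => (k (O S)).calls O + 1

/-! ### Function classes -/

/-- Pseudo dimension: the VC dimension of the threshold functions `(x, ζ) ↦ 1(f x > ζ)`, `f ∈ F`. -/
def pdim {X : Type u} (F : Set (X → ℝ)) : ℕ∞ :=
  ⨆ (S : Finset (X × ℝ)) (_ : ∀ A ⊆ S, ∃ f ∈ F, ∀ p ∈ S, (p.2 < f p.1 ↔ p ∈ A)), (S.card : ℕ∞)

/-- A set of measurable functions with values in `[0,1]` that has a countable subset from which
every member is a pointwise limit of a sequence (the usual measurability condition under which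
suprema of empirical processes over `F` are measurable). -/
structure IsRegressionClass {X : Type u} [MeasurableSpace X] (F : Set (X → ℝ)) : Prop where
  measurable : ∀ f ∈ F, Measurable f
  range : ∀ f ∈ F, ∀ x, f x ∈ Set.Icc (0 : ℝ) 1
  separable : ∃ G ⊆ F, G.Countable ∧
    ∀ f ∈ F, ∃ v : ℕ → X → ℝ, (∀ n, v n ∈ G) ∧ Tendsto v atTop (𝓝 f)

/-- Value function disagreement coefficient `θ^val_f(F, γ₀, ε₀)`. -/
def disCoeff {X : Type u} [MeasurableSpace X] (F : Set (X → ℝ)) (f₀ : X → ℝ) (γ₀ ε₀ : ℝ) : ℝ≥0∞ :=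
  (⨆ (D : Measure X) (_ : IsProbabilityMeasure D) (γ : ℝ) (_ : γ₀ < γ) (ε : ℝ) (_ : ε₀ < ε),
    ENNReal.ofReal (γ ^ 2 / ε ^ 2) *
      D {x | ∃ f ∈ F, γ < |f x - f₀ x| ∧ √(∫ z, (f z - f₀ z) ^ 2 ∂D) ≤ ε}) ⊔ 1

/-- `sup_{ι > 0} θ^val_f(F, γ₀, ι)`. -/
def disCoeffSup {X : Type u} [MeasurableSpace X] (F : Set (X → ℝ)) (f₀ : X → ℝ) (γ₀ : ℝ) : ℝ≥0∞ :=
  ⨆ (ι : ℝ) (_ : 0 < ι), disCoeff F f₀ γ₀ ι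

/-! ### Classification with abstention -/

/-- `η` is a version of the conditional probability of a positive label under the joint law `P`. -/
structure IsCondProb {X : Type u} [MeasurableSpace X] (P : Measure (X × Bool)) (η : X → ℝ) :
    Prop where
  measurable : Measurable η
  range : ∀ x, η x ∈ Set.Icc (0 : ℝ) 1
  law : ∀ A : Set X, MeasurableSet A →
    P (A ×ˢ {true}) = ∫⁻ x in A, ENNReal.ofReal (η x) ∂P.fst

/-- The classifier `x ↦ sgn (2 f x - 1)`, with `sgn 0 = +1`. -/
def signClassifier {X : Type u} (f : X → ℝ) (x : X) : Bool :=
  open Classical in decide (0 ≤ 2 * f x - 1)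

/-- Standard error of a classifier. -/
def err {X : Type u} [MeasurableSpace X] (P : Measure (X × Bool)) (h : X → Bool) : ℝ :=
  P.real {z | h z.1 ≠ z.2}

/-- Chow's error of a classifier that may abstain; `none` is the action of abstention. -/
def chowErr {X : Type u} [MeasurableSpace X] (P : Measure (X × Bool)) (γ : ℝ)
    (h : X → Option Bool) : ℝ :=
  P.real {z | h z.1 ≠ some z.2 ∧ h z.1 ≠ none} + (1 / 2 - γ) * P.real {z | h z.1 = none}

/-! ### The algorithm -/

/-- Inputs of the algorithm: accuracy, abstention parameter, confidence level, and the pseudo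
dimension of the class. -/
structure Params where
  eps : ℝ
  gam : ℝ
  del : ℝ
  d : ℕ

/-- Admissible inputs. -/
structure Params.Valid (p : Params) : Prop where
  eps_pos : 0 < p.eps
  eps_lt_gam : p.eps < p.gam
  gam_lt : p.gam < 1 / 2
  del_pos : 0 < p.del
  del_lt : p.del < 1
  d_pos : 1 ≤ p.d

/-- `T = Pdim(F) / (ε γ)`. -/
def Params.T (p : Params) : ℝ := p.d / (p.eps * p.gam)

/-- The number of epochs `M = ⌈log₂ T⌉`. -/
def Params.M (p : Params) : ℕ := ⌈Real.logb 2 p.T⌉₊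

/-- End of epoch `m`: `τ_0 = 0` and `τ_m = 2 ^ m` for `m ≥ 1`. -/
def tau (m : ℕ) : ℕ := if m = 0 then 0 else 2 ^ m

/-- `C_δ = c · Pdim(F) · log (T / δ)`. -/
def Params.Cdel (p : Params) (c : ℝ) : ℝ := c * p.d * Real.log (p.T / p.del)

/-- `β_m = (M - m + 1) (2 ε² τ_{M-1} + 2 C_δ)`. -/
def Params.beta (p : Params) (c : ℝ) (m : ℕ) : ℝ :=
  ((p.M : ℝ) - m + 1) * (2 * p.eps ^ 2 * (tau (p.M - 1) : ℝ) + 2 * p.Cdel c)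

/-- Unit weights for labelled examples. -/
def unitWeights {X : Type u} (B : List (X × Bool)) : List (WExample X) :=
  B.map fun z => (1, z.1, z.2)

/-- The empirical minimizer, obtained by one oracle call on the queried examples `B`. -/
def fhat {X : Type u} (O : List (WExample X) → X → ℝ) (B : List (X × Bool)) : X → ℝ :=
  O (unitWeights B)

/-- The active set with radius `β`, given the queried examples `B`. -/
def activeSet {X : Type u} (F : Set (X → ℝ)) (O : List (WExample X) → X → ℝ)
    (B : List (X × Bool)) (β : ℝ) : Set (X → ℝ) :=
  {f ∈ F | wLoss (unitWeights B) f ≤ wLoss (unitWeights B) (fhat O B) + β}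

/-- `lcb(x; G) = inf_{f ∈ G} f x`. -/
def lcb {X : Type u} (x : X) (G : Set (X → ℝ)) : ℝ := sInf ((fun f => f x) '' G)

/-- `ucb(x; G) = sup_{f ∈ G} f x`. -/
def ucb {X : Type u} (x : X) (G : Set (X → ℝ)) : ℝ := sSup ((fun f => f x) '' G)

/-- A subroutine for the computation of confidence bounds: given the inputs of the algorithm, the
epoch, the examples queried before that epoch and a point `x`, it is a program with oracle access
whose output is a pair (lower bound, upper bound). -/
abbrev CISub (X : Type u) : Type u :=
  Params → ℕ → List (X × Bool) → X → OracleProg X (ℝ × ℝ)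

/-- The classifier of an epoch, from the confidence bounds `b` and the empirical minimizer `f`. -/
def classifier {X : Type u} (γ : ℝ) (b : X → ℝ × ℝ) (f : X → ℝ) (x : X) : Option Bool :=
  open Classical in
  if Set.Icc (b x).1 (b x).2 ⊆ Set.Icc (1 / 2 - γ) (1 / 2 + γ) then none
  else some (signClassifier f x)

/-- The query function of an epoch. -/
def queryFn {X : Type u} (γ : ℝ) (b : X → ℝ × ℝ) (f : X → ℝ) (x : X) : Bool :=
  open Classical in
  decide ((1 / 2 : ℝ) ∈ Set.Ioo (b x).1 (b x).2 ∧ classifier γ b f x ≠ none)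

/-- Confidence bounds computed by the subroutine `A` in epoch `m`. -/
def bounds {X : Type u} (O : List (WExample X) → X → ℝ) (A : CISub X) (p : Params) (m : ℕ)
    (B : List (X × Bool)) (x : X) : ℝ × ℝ :=
  (A p m B x).run O

/-- The stream of examples seen in epoch `m ≥ 1`, i.e. at times `τ_{m-1} + 1, …, τ_m`
(`ω t` is the example at time `t + 1`). -/
def epochExamples {X : Type u} (ω : ℕ → X × Bool) (m : ℕ) : List (X × Bool) :=
  (List.range' (tau (m - 1)) (tau m - tau (m - 1))).map ω

/-- The labelled examples that have been queried by the end of epoch `m`. In epoch `m` an example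
`(x, y)` enters if and only if the query function of that epoch is `1` at `x`; otherwise its label
is never used. -/
def queried {X : Type u} (O : List (WExample X) → X → ℝ) (A : CISub X) (p : Params)
    (ω : ℕ → X × Bool) : ℕ → List (X × Bool)
  | 0 => []
  | m + 1 =>
    queried O A p ω m ++ (epochExamples ω (m + 1)).filter fun z =>
      queryFn p.gam (bounds O A p (m + 1) (queried O A p ω m)) (fhat O (queried O A p ω m)) z.1

/-- The classifier returned in the last epoch `M`. -/
def output {X : Type u} (O : List (WExample X) → X → ℝ) (A : CISub X) (p : Params)
    (ω : ℕ → X × Bool) : X → Option Bool :=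
  classifier p.gam (bounds O A p p.M (queried O A p ω (p.M - 1)))
    (fhat O (queried O A p ω (p.M - 1)))

/-- Label complexity of a run: the number of labels queried in epochs `1, …, M - 1`. -/
def labelCount {X : Type u} (O : List (WExample X) → X → ℝ) (A : CISub X) (p : Params)
    (ω : ℕ → X × Bool) : ℕ :=
  (queried O A p ω (p.M - 1)).length

/-- Total number of oracle calls of a run: one call for the empirical minimizer in each of the
epochs `1, …, M`, and the calls of the subroutine at each example of the epochs `1, …, M - 1`. -/
def trainingCalls {X : Type u} (O : List (WExample X) → X → ℝ) (A : CISub X) (p : Params)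
    (ω : ℕ → X × Bool) : ℕ :=
  p.M + ∑ m ∈ Finset.Icc 1 (p.M - 1),
    ((epochExamples ω m).map fun z => (A p m (queried O A p ω (m - 1)) z.1).calls O).sum

/-- Number of oracle calls needed to evaluate the returned classifier at `x`. -/
def inferenceCalls {X : Type u} (O : List (WExample X) → X → ℝ) (A : CISub X) (p : Params)
    (ω : ℕ → X × Bool) (x : X) : ℕ :=
  (A p p.M (queried O A p ω (p.M - 1)) x).calls O

/-- In every epoch `m` and at every point, the computed bounds are within `γ / 4` of the confidence
bounds of the active set, whose radius is `β_m` up to the factor `s`. -/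
def ApproximatesBounds {X : Type u} (c s : ℝ) (F : Set (X → ℝ)) (O : List (WExample X) → X → ℝ)
    (A : CISub X) (p : Params) (ω : ℕ → X × Bool) : Prop :=
  ∀ m ∈ Finset.Icc 1 p.M, ∀ x : X,
    let B := queried O A p ω (m - 1)
    let b := bounds O A p m B x
    let inner := activeSet F O B (p.beta c m)
    let outer := activeSet F O B (s * p.beta c m)
    lcb x outer - p.gam / 4 ≤ b.1 ∧ b.1 ≤ lcb x inner + p.gam / 4 ∧
      ucb x inner - p.gam / 4 ≤ b.2 ∧ b.2 ≤ ucb x outer + p.gam / 4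

/-- The statistical guarantee. For every joint law `P` with conditional probability `η` and every
`f₀ ∈ F` within `κ ≤ ε` of `η`, outside an event of probability at most `2 δ` over i.i.d. examples,
the Chow excess error of the output is at most `C ε θ log (d / (ε γ δ))` and the label complexity is
at most `C (θ d / γ²) log² (d / (ε γ)) log (d / (ε γ δ))`, where `θ = sup_{ι > 0} θ^val_{f₀}(F, γ/2, ι)`. -/
def StatGuarantee {X : Type u} [MeasurableSpace X] (C : ℝ) (F : Set (X → ℝ))
    (O : List (WExample X) → X → ℝ) (A : CISub X) (p : Params) : Prop :=
  ∀ (P : Measure (X × Bool)) [IsProbabilityMeasure P] (η : X → ℝ), IsCondProb P η →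
  ∀ (κ : ℝ), κ ≤ p.eps →
  ∀ f₀ ∈ F, (∀ x, |f₀ x - η x| ≤ κ) →
    Measure.infinitePi (fun _ : ℕ => P)
      {ω | ¬ (ENNReal.ofReal
                (chowErr P p.gam (output O A p ω) - err P (signClassifier η)) ≤
              ENNReal.ofReal (C * p.eps * Real.log (p.d / (p.eps * p.gam * p.del))) *
                disCoeffSup F f₀ (p.gam / 2) ∧
            (labelCount O A p ω : ℝ≥0∞) ≤
              ENNReal.ofReal (C * (p.d / p.gam ^ 2) * Real.log (p.d / (p.eps * p.gam)) ^ 2 *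
                Real.log (p.d / (p.eps * p.gam * p.del))) *
                disCoeffSup F f₀ (p.gam / 2))}
      ≤ ENNReal.ofReal (2 * p.del)

end

end Abstention

namespace Abstention

noncomputable section

/-! ### Combinators for oracle programs -/

/-! The subroutine sees the class only through the oracle, so confidence bounds must come from
weighted regressions. Two extra examples at `x`, one per label, add `w (v - a)²` and a constant to
the empirical loss, where `v` is the value at `x` seen from one of the labels; one call thus
minimizes the loss plus a quadratic pull towards any target `a ∈ [0, 1]`. For a general class,
whether the active set reaches below a level `v` is tested with targets `v - r` and weights `β / r²`
over geometrically growing radii `r`, and bisection over `v` gives the bound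
(`generalSearch_sandwich`). For a convex class the target is `0`; bisection over the weight brackets
the boundary of the active set between two consecutive weights, and interpolating the two minimizers
is accurate by first-order optimality (`convexSearch_sandwich`). Either way the result lies, up to
`ζ`, between the infima over an outer and an inner active set, and the statistical analysis uses
nothing else about the search (`SearchSpec`).

Write `L = d log (T / δ)`. Outside an event of probability `2 δ`, on every time window the excess
loss of every `f` over `f₀` is at least an eighth of its accumulated squared distance to `f₀` on the
query regions, minus `200 L` (`exists_good_event`). Queries are adaptive, so the class is
discretized by a cover that does not depend on the data: it is a grid cover on one fixed ghost
sample, of size bounded through Sauer–Shelah, and a two-sample swapping argument shows that it is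
close in `L¹` both under the law and on the observed examples (`exists_sample_cover`). For each
element of the cover, exponentials of the loss differences have conditional mean at most `1`, also
under misspecification by `ε` (`lintegral_exp_lossDiff_le`), and Markov's inequality for their
product gives the bound (`adaptive_tail`).

On this event `f₀` stays in all active sets, and active sets are nested across epochs up to `400 L`;
the decrease of `β_m` pays for this and for the slack of the search. The affine map `Params.shift`
turns this into nested query regions (`epochQuery_anti`). Hence the squared distance on the current
region, multiplied by the elapsed time, is `O(β)`. Each queried point carries a function of the
outer active set farther than `γ / 2` from `f₀`, so the disagreement coefficient, applied to the law
conditioned on the query region, bounds the probability of that region (`prob_epochQuery_le`).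
Summation over epochs bounds the labels. On the last region `2 |f̂ - f₀| ≤ (f̂ - f₀)² / γ + γ`
bounds the excess error, and elsewhere the output loses at most `2 ε` (`condCost_sub_le`). -/

/-- Sequential composition of oracle programs. -/
def OracleProg.bind {X : Type u} {α β : Type} :
    OracleProg X α → (α → OracleProg X β) → OracleProg X β
  | .ret a, g => g a
  | .call S k, g => .call S fun f => (k f).bind g

theorem OracleProg.run_bind {X : Type u} {α β : Type} (O : List (WExample X) → X → ℝ)
    (p : OracleProg X α) (g : α → OracleProg X β) :
    (p.bind g).run O = (g (p.run O)).run O := by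
  induction p with
  | ret a => rfl
  | call S k ih => exact ih (O S)

theorem OracleProg.calls_bind {X : Type u} {α β : Type} (O : List (WExample X) → X → ℝ)
    (p : OracleProg X α) (g : α → OracleProg X β) :
    (p.bind g).calls O = p.calls O + (g (p.run O)).calls O := by
  induction p with
  | ret a => simp [OracleProg.bind, OracleProg.calls, OracleProg.run]
  | call S k ih =>
    simp only [OracleProg.bind, OracleProg.calls, OracleProg.run, ih (O S)]
    omega

/-- Disjunction of the first `J` programs of a sequence. -/
def anyProg {X : Type u} (p : ℕ → OracleProg X Bool) : ℕ → OracleProg X Bool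
  | 0 => .ret false
  | J + 1 => (anyProg p J).bind fun s => (p J).bind fun t => .ret (s || t)

theorem anyProg_run {X : Type u} (O : List (WExample X) → X → ℝ) (p : ℕ → OracleProg X Bool)
    (J : ℕ) : (anyProg p J).run O = true ↔ ∃ i < J, (p i).run O = true := by
  induction J with
  | zero => simp [anyProg, OracleProg.run]
  | succ J ih =>
    simp only [anyProg, OracleProg.run_bind, OracleProg.run, Bool.or_eq_true, ih]
    constructor
    · rintro (⟨i, hi, h⟩ | h)
      · exact ⟨i, by omega, h⟩
      · exact ⟨J, by omega, h⟩
    · rintro ⟨i, hi, h⟩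
      rcases Nat.lt_succ_iff_lt_or_eq.1 hi with h' | rfl
      · exact Or.inl ⟨i, h', h⟩
      · exact Or.inr h

theorem anyProg_calls {X : Type u} (O : List (WExample X) → X → ℝ) (p : ℕ → OracleProg X Bool)
    (J : ℕ) (hp : ∀ i, (p i).calls O ≤ 1) : (anyProg p J).calls O ≤ J := by
  induction J with
  | zero => simp [anyProg, OracleProg.calls]
  | succ J ih =>
    simp only [anyProg, OracleProg.calls_bind, OracleProg.calls]
    have := hp J
    omega

/-- Bisection of the interval `[lo, lo + 2 ^ n]` with a test that is negative at the left end and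
positive at the right end. -/
def bisect {X : Type u} (test : ℕ → OracleProg X Bool) : ℕ → ℕ → OracleProg X ℕ
  | 0, lo => .ret lo
  | n + 1, lo => (test (lo + 2 ^ n)).bind fun t =>
      bisect test n (if t then lo else lo + 2 ^ n)

/-- The result of a bisection with given answers to the tests. -/
def bisectRun (t : ℕ → Bool) : ℕ → ℕ → ℕ
  | 0, lo => lo
  | n + 1, lo => bisectRun t n (if t (lo + 2 ^ n) then lo else lo + 2 ^ n)

theorem bisect_run {X : Type u} (O : List (WExample X) → X → ℝ) (test : ℕ → OracleProg X Bool)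
    (n lo : ℕ) : (bisect test n lo).run O = bisectRun (fun j => (test j).run O) n lo := by
  induction n generalizing lo with
  | zero => rfl
  | succ n ih => simp only [bisect, bisectRun, OracleProg.run_bind, ih]

theorem bisect_calls {X : Type u} (O : List (WExample X) → X → ℝ) (test : ℕ → OracleProg X Bool)
    (J : ℕ) (ht : ∀ j, (test j).calls O ≤ J) (n lo : ℕ) :
    (bisect test n lo).calls O ≤ n * J := by
  induction n generalizing lo with
  | zero => simp [bisect, OracleProg.calls]
  | succ n ih =>
    simp only [bisect, OracleProg.calls_bind]
    have h1 := ht (lo + 2 ^ n)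
    have h2 := ih (if (test (lo + 2 ^ n)).run O then lo else lo + 2 ^ n)
    rw [add_mul, one_mul]
    omega

/-- The invariant needs no monotonicity of the test: the left end is original or failed the test,
the right end is original or passed it. This matters because the oracle tests below are not shown to
be monotone in the level. -/
theorem bisectRun_spec (t : ℕ → Bool) (n lo : ℕ) :
    (bisectRun t n lo = lo ∨ t (bisectRun t n lo) = false) ∧
      (bisectRun t n lo + 1 = lo + 2 ^ n ∨ t (bisectRun t n lo + 1) = true) := by
  induction n generalizing lo with
  | zero => simp [bisectRun]
  | succ n ih =>
    rw [bisectRun]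
    cases h : t (lo + 2 ^ n)
    · obtain ⟨h1, h2⟩ := ih (lo + 2 ^ n)
      simp only [Bool.false_eq_true, if_false]
      refine ⟨Or.inr ?_, ?_⟩
      · rcases h1 with h1 | h1
        · rw [h1, h]
        · exact h1
      · rcases h2 with h2 | h2
        · left; rw [h2, pow_succ]; ring
        · exact Or.inr h2
    · obtain ⟨h1, h2⟩ := ih lo
      simp only [if_true]
      refine ⟨h1, Or.inr ?_⟩
      rcases h2 with h2 | h2
      · rw [h2, h]
      · exact h2

/-! ### Weighted losses with two additional examples at one point -/

/-- The value `v ∈ [0, 1]` seen from the label `b`: `v` itself for the negative label, and `1 - v`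
for the positive label. -/
def side (b : Bool) (v : ℝ) : ℝ := if b then 1 - v else v

theorem side_mem_Icc {b : Bool} {v : ℝ} (hv : v ∈ Set.Icc (0 : ℝ) 1) :
    side b v ∈ Set.Icc (0 : ℝ) 1 := by
  obtain ⟨h0, h1⟩ := hv
  cases b <;> simp [side] <;> constructor <;> linarith

theorem wLoss_append {X : Type u} (S S' : List (WExample X)) (f : X → ℝ) :
    wLoss (S ++ S') f = wLoss S f + wLoss S' f := by
  simp [wLoss]

/-- The examples `B` together with two weighted examples at `x`, whose square losses add up to
`w (side b (f x) - a)²` and a constant. -/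
def probeList {X : Type u} (B : List (X × Bool)) (x : X) (b : Bool) (w a : ℝ) :
    List (WExample X) :=
  unitWeights B ++ [(Real.toNNReal (w * (1 - a)), x, b), (Real.toNNReal (w * a), x, !b)]

/-- With `s` the side value, the label `b` costs `s²` and the opposite label `(1 - s)²`, and `(1 -
a) s² + a (1 - s)² = (s - a)² + a (1 - a)`. -/
theorem wLoss_probeList {X : Type u} (B : List (X × Bool)) (x : X) (b : Bool) {w a : ℝ}
    (hw : 0 ≤ w) (ha : a ∈ Set.Icc (0 : ℝ) 1) (f : X → ℝ) :
    wLoss (probeList B x b w a) f =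
      wLoss (unitWeights B) f + w * ((side b (f x) - a) ^ 2 + a * (1 - a)) := by
  have h1 : 0 ≤ w * (1 - a) := mul_nonneg hw (by linarith [ha.2])
  have h2 : 0 ≤ w * a := mul_nonneg hw ha.1
  rw [probeList, wLoss_append]
  congr 1
  cases b <;> simp [wLoss, labelVal, side, Real.coe_toNNReal _ h1, Real.coe_toNNReal _ h2] <;> ring

theorem probe_minimizer {X : Type u} {F : Set (X → ℝ)} {O : List (WExample X) → X → ℝ}
    (hO : IsRegressionOracle F O) (B : List (X × Bool)) (x : X) (b : Bool) {w a : ℝ}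
    (hw : 0 ≤ w) (ha : a ∈ Set.Icc (0 : ℝ) 1) {f : X → ℝ} (hf : f ∈ F) :
    wLoss (unitWeights B) (O (probeList B x b w a)) +
        w * (side b (O (probeList B x b w a) x) - a) ^ 2 ≤
      wLoss (unitWeights B) f + w * (side b (f x) - a) ^ 2 := by
  have h := (hO (probeList B x b w a)).2 f hf
  rw [wLoss_probeList B x b hw ha, wLoss_probeList B x b hw ha] at h
  linarith

/-! ### Search over a general class -/

/-- Does the minimizer for the target `a` with weight `w` lie in the active set with radius `β` and
have side value below `v`? -/
def probe {X : Type u} (fh : X → ℝ) (B : List (X × Bool)) (x : X) (b : Bool) (β w a v : ℝ) :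
    OracleProg X Bool :=
  open Classical in
  .call (probeList B x b w a) fun f =>
    .ret (decide (wLoss (unitWeights B) f ≤ wLoss (unitWeights B) fh + β ∧ side b (f x) < v))

/-- Search for the smallest side value over the active set with radius `β`: bisection over the grid
of mesh `2 ^ (-N)`, each test probing targets at the distances `z (1 + σ) ^ i`, `i < J`. -/
def generalSearch {X : Type u} (β z σ : ℝ) (J N : ℕ) (B : List (X × Bool)) (x : X) (b : Bool) :
    OracleProg X ℝ :=
  .call (unitWeights B) fun fh =>
    (bisect (fun j => anyProg (fun i =>
      probe fh B x b β (β / (z * (1 + σ) ^ i) ^ 2) ((j : ℝ) / 2 ^ N - z * (1 + σ) ^ i)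
        ((j : ℝ) / 2 ^ N)) J) N 0).bind fun j => .ret (((j : ℝ) + 1) / 2 ^ N)

theorem generalSearch_calls {X : Type u} (O : List (WExample X) → X → ℝ) (β z σ : ℝ) (J N : ℕ)
    (B : List (X × Bool)) (x : X) (b : Bool) :
    (generalSearch β z σ J N B x b).calls O ≤ N * J + 1 := by
  simp only [generalSearch, OracleProg.calls, OracleProg.calls_bind, add_zero]
  exact Nat.succ_le_succ (bisect_calls O _ J (fun j => anyProg_calls O _ J fun i => le_rfl) N 0)

/-- `s` is sandwiched between the infima of the side values over two active sets, up to `z`. -/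
def Sandwich {X : Type u} (F : Set (X → ℝ)) (O : List (WExample X) → X → ℝ) (B : List (X × Bool))
    (x : X) (b : Bool) (inn out z s : ℝ) : Prop :=
  (∃ f ∈ activeSet F O B out, side b (f x) ≤ s) ∧
    ∀ f ∈ activeSet F O B inn, s ≤ side b (f x) + z

theorem fhat_mem_activeSet {X : Type u} {F : Set (X → ℝ)} {O : List (WExample X) → X → ℝ}
    (hO : IsRegressionOracle F O) (B : List (X × Bool)) {β : ℝ} (hβ : 0 ≤ β) :
    fhat O B ∈ activeSet F O B β :=
  ⟨(hO _).1, by linarith⟩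

theorem exists_scale {z σ t : ℝ} {J : ℕ} (hzt : z ≤ t)
    (hJ : t < z * (1 + σ) ^ J) : ∃ i < J, z * (1 + σ) ^ i ≤ t ∧ t < z * (1 + σ) ^ i * (1 + σ) := by
  induction J with
  | zero => simp at hJ; linarith
  | succ J ih =>
    by_cases h : t < z * (1 + σ) ^ J
    · obtain ⟨i, hi, h'⟩ := ih h
      exact ⟨i, by omega, h'⟩
    · exact ⟨J, by omega, not_lt.1 h, by rw [pow_succ] at hJ; linarith⟩

/-- A positive test exhibits a function of the outer set, which gives the first half. For the second
half, suppose that `f` in the inner set has side value `e < v - z` at a level `v` whose test failed.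
Choose the radius with `r ≤ v - e < (1 + σ) r`: then `f` is within `σ r` of the target `v - r`, and
its penalty `σ² β` fits into the gap between the radii. The minimizer therefore has loss plus
penalty below `β` above the optimum, hence lies in the outer set and has side value below `v`, so
the test should have passed. -/
theorem generalSearch_sandwich {X : Type u} {F : Set (X → ℝ)} {O : List (WExample X) → X → ℝ}
    (hO : IsRegressionOracle F O) (hF : ∀ f ∈ F, ∀ x, f x ∈ Set.Icc (0 : ℝ) 1)
    {β inn z σ : ℝ} {J N : ℕ} (hβ : 0 < β) (hz : 0 < z) (hσ : 0 < σ)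
    (hin : σ ^ 2 * β ≤ β - inn) (hJ : 1 < z * (1 + σ) ^ J)
    (B : List (X × Bool)) (x : X) (b : Bool) :
    Sandwich F O B x b inn β (z + 1 / 2 ^ N) ((generalSearch β z σ J N B x b).run O) := by
  have hN : (0 : ℝ) < 2 ^ N := by positivity
  simp only [generalSearch, OracleProg.run, OracleProg.run_bind, bisect_run]
  set t : ℕ → Bool := fun j => (anyProg (fun i =>
      probe (O (unitWeights B)) B x b β (β / (z * (1 + σ) ^ i) ^ 2)
        ((j : ℝ) / 2 ^ N - z * (1 + σ) ^ i) ((j : ℝ) / 2 ^ N)) J).run O with ht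
  have htj : ∀ j, t j = true ↔ ∃ i < J,
      O (probeList B x b (β / (z * (1 + σ) ^ i) ^ 2) ((j : ℝ) / 2 ^ N - z * (1 + σ) ^ i)) ∈
        activeSet F O B β ∧
      side b (O (probeList B x b (β / (z * (1 + σ) ^ i) ^ 2)
        ((j : ℝ) / 2 ^ N - z * (1 + σ) ^ i)) x) < (j : ℝ) / 2 ^ N := by
    intro j
    rw [ht]
    simp only [anyProg_run, probe, OracleProg.run, decide_eq_true_eq, activeSet, fhat,
      Set.mem_ofPred_eq, (hO _).1, true_and]
  obtain ⟨h1, h2⟩ := bisectRun_spec t N 0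
  set j := bisectRun t N 0
  constructor
  · rcases h2 with h2 | h2
    · refine ⟨fhat O B, fhat_mem_activeSet hO B hβ.le, ?_⟩
      have : ((j : ℝ) + 1) / 2 ^ N = 1 := by
        rw [div_eq_one_iff_eq hN.ne']
        have : ((j + 1 : ℕ) : ℝ) = ((0 + 2 ^ N : ℕ) : ℝ) := by rw [h2]
        push_cast at this
        linarith
      rw [this]
      exact (side_mem_Icc (hF _ (hO _).1 x)).2
    · obtain ⟨i, -, hmem, hlt⟩ := (htj _).1 h2
      push_cast at hlt hmem
      exact ⟨_, hmem, hlt.le⟩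
  · intro f hf
    by_contra! hcon
    have he := side_mem_Icc (b := b) (hF f hf.1 x)
    set e := side b (f x)
    have hjj : ((j : ℝ) + 1) / 2 ^ N = j / 2 ^ N + 1 / 2 ^ N := by rw [add_div]
    have hj : e + z < (j : ℝ) / 2 ^ N := by linarith
    rcases h1 with h1 | h1
    · rw [h1] at hj
      simp at hj
      linarith [he.1]
    -- The target `v - r` must lie in `[0, 1]` for the weights to be nonnegative; bisection never
    -- returns the right end, so `v ≤ 1`.
    · have hj2 : (j : ℝ) / 2 ^ N ≤ 1 := by
        rw [div_le_one hN]
        have hlt : ∀ (n lo : ℕ), bisectRun t n lo < lo + 2 ^ n := by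
          intro n
          induction n with
          | zero => intro lo; simp [bisectRun]
          | succ n ih =>
            intro lo
            rw [bisectRun]
            split_ifs
            · have := ih lo; rw [pow_succ]; omega
            · have := ih (lo + 2 ^ n); rw [pow_succ]; omega
        have := (hlt N 0).le
        rw [zero_add] at this
        exact_mod_cast this
      obtain ⟨i, hi, hr1, hr2⟩ := exists_scale (t := (j : ℝ) / 2 ^ N - e) (by linarith)
        (lt_of_le_of_lt (by linarith [he.1]) hJ)
      set r := z * (1 + σ) ^ i with hr
      have hrpos : 0 < r := by positivity
      set v := (j : ℝ) / 2 ^ N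
      have ha : v - r ∈ Set.Icc (0 : ℝ) 1 := ⟨by linarith [he.1], by linarith⟩
      have hw : 0 ≤ β / r ^ 2 := by positivity
      have key := probe_minimizer hO B x b hw ha hf.1
      have hloss := hf.2
      have hfh := (hO (unitWeights B)).2 _ (hO (probeList B x b (β / r ^ 2) (v - r))).1
      set g := O (probeList B x b (β / r ^ 2) (v - r)) with hg
      have hstrict : β / r ^ 2 * (e - (v - r)) ^ 2 < β - inn := by
        have h3 : (e - (v - r)) ^ 2 < (σ * r) ^ 2 := by
          apply sq_lt_sq'
          · nlinarith
          · nlinarith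
        calc β / r ^ 2 * (e - (v - r)) ^ 2 < β / r ^ 2 * (σ * r) ^ 2 := by
              apply mul_lt_mul_of_pos_left h3; positivity
          _ = σ ^ 2 * β := by field_simp
          _ ≤ β - inn := hin
      have hgR : wLoss (unitWeights B) g + β / r ^ 2 * (side b (g x) - (v - r)) ^ 2 <
          wLoss (unitWeights B) (fhat O B) + β := by
        linarith
      have hsq : 0 ≤ β / r ^ 2 * (side b (g x) - (v - r)) ^ 2 := by positivity
      have hgmem : g ∈ activeSet F O B β := ⟨(hO _).1, by linarith⟩
      -- A side value of at least `v` is at distance at least `r` from the target, so the penalty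
      -- alone would use up the whole budget `β`.
      have hgv : side b (g x) < v := by
        by_contra! hge
        have : β ≤ β / r ^ 2 * (side b (g x) - (v - r)) ^ 2 := by
          calc β = β / r ^ 2 * r ^ 2 := by field_simp
            _ ≤ _ := by
              apply mul_le_mul_of_nonneg_left _ hw
              apply pow_le_pow_left₀ hrpos.le
              linarith
        have hfh' : wLoss (unitWeights B) (fhat O B) ≤ wLoss (unitWeights B) g := hfh
        linarith
      have := (htj j).2 ⟨i, hi, hgmem, hgv⟩
      rw [h1] at this
      exact absurd this (by simp)

/-! ### Search over a convex class -/

/-- Does the minimizer with weight `w` leave the active set with radius `β`? -/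
def leaveTest {X : Type u} (fh : X → ℝ) (B : List (X × Bool)) (x : X) (b : Bool) (β w : ℝ) :
    OracleProg X Bool :=
  open Classical in
  .call (probeList B x b w 0) fun f =>
    .ret (decide (wLoss (unitWeights B) fh + β < wLoss (unitWeights B) f))

/-- Interpolation between the side values of a minimizer `f₁` in the active set and a minimizer `f₂`
outside the active set, linearly in the empirical losses. -/
def interpolate {X : Type u} (fh : X → ℝ) (B : List (X × Bool)) (x : X) (b : Bool) (β : ℝ)
    (f₁ f₂ : X → ℝ) : ℝ :=
  open Classical in
  if wLoss (unitWeights B) fh + β < wLoss (unitWeights B) f₂ then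
    side b (f₁ x) - (wLoss (unitWeights B) fh + β - wLoss (unitWeights B) f₁) /
      (wLoss (unitWeights B) f₂ - wLoss (unitWeights B) f₁) * (side b (f₁ x) - side b (f₂ x))
  else side b (f₂ x)

/-- Search for the smallest side value over the active set with radius `β` of a convex class:
bisection over the exponent of the weight. -/
def convexSearch {X : Type u} (β ρ : ℝ) (N : ℕ) (B : List (X × Bool)) (x : X) (b : Bool) :
    OracleProg X ℝ :=
  .call (unitWeights B) fun fh =>
    (bisect (fun j => leaveTest fh B x b β (β * (1 + ρ) ^ j)) N 0).bind fun j =>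
      .call (probeList B x b (β * (1 + ρ) ^ j) 0) fun f₁ =>
        .call (probeList B x b (β * (1 + ρ) ^ (j + 1)) 0) fun f₂ =>
          .ret (interpolate fh B x b β f₁ f₂)

theorem convexSearch_calls {X : Type u} (O : List (WExample X) → X → ℝ) (β ρ : ℝ) (N : ℕ)
    (B : List (X × Bool)) (x : X) (b : Bool) :
    (convexSearch β ρ N B x b).calls O ≤ N + 3 := by
  simp only [convexSearch, OracleProg.calls, OracleProg.calls_bind]
  have := bisect_calls O (fun j => leaveTest (O (unitWeights B)) B x b β (β * (1 + ρ) ^ j)) 1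
    (fun j => le_rfl) N 0
  omega

theorem wLoss_convex {X : Type u} (S : List (WExample X)) (f g : X → ℝ) {s : ℝ} (hs0 : 0 ≤ s)
    (hs1 : s ≤ 1) :
    wLoss S ((1 - s) • f + s • g) ≤ (1 - s) * wLoss S f + s * wLoss S g := by
  induction S with
  | nil => simp [wLoss]
  | cons e S ih =>
    have h : ∀ h : X → ℝ, wLoss (e :: S) h =
        (e.1 : ℝ) * (h e.2.1 - labelVal e.2.2) ^ 2 + wLoss S h := fun h => by simp [wLoss]
    rw [h, h, h]
    simp only [Pi.add_apply, Pi.smul_apply, smul_eq_mul]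
    set p := f e.2.1
    set q := g e.2.1
    set y := labelVal e.2.2
    have h0 : (0 : ℝ) ≤ e.1 := e.1.2
    have h1 : ((1 - s) * p + s * q - y) ^ 2 ≤ (1 - s) * (p - y) ^ 2 + s * (q - y) ^ 2 := by
      nlinarith [mul_nonneg (mul_nonneg hs0 (sub_nonneg.2 hs1)) (sq_nonneg (p - q))]
    nlinarith [mul_le_mul_of_nonneg_left h1 h0]

theorem side_combo (b : Bool) (s p q : ℝ) :
    side b ((1 - s) * p + s * q) = side b p + s * (side b q - side b p) := by
  cases b <;> simp [side] <;> ring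

/-- Compare `f₁` with the point a fraction `s` along the segment to `f`, divide by `s` and let `s →
0`; the quadratic remainder vanishes. -/
theorem first_order {X : Type u} {F : Set (X → ℝ)} (hF : Convex ℝ F) {S : List (WExample X)}
    {x : X} {b : Bool} {w : ℝ} {f₁ : X → ℝ} (h₁ : f₁ ∈ F)
    (hmin : ∀ f ∈ F, wLoss S f₁ + w * side b (f₁ x) ^ 2 ≤ wLoss S f + w * side b (f x) ^ 2)
    {f : X → ℝ} (hf : f ∈ F) :
    2 * w * side b (f₁ x) * (side b (f₁ x) - side b (f x)) ≤ wLoss S f - wLoss S f₁ := by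
  have key : ∀ s : ℝ, 0 < s → s ≤ 1 →
      2 * w * side b (f₁ x) * (side b (f₁ x) - side b (f x)) ≤ wLoss S f - wLoss S f₁ +
        s * (w * (side b (f₁ x) - side b (f x)) ^ 2) := by
    intro s hs0 hs1
    have h := hmin ((1 - s) • f₁ + s • f) (hF h₁ hf (by linarith) hs0.le (by ring))
    have h2 := wLoss_convex S f₁ f hs0.le hs1
    simp only [Pi.add_apply, Pi.smul_apply, smul_eq_mul, side_combo] at h
    set p := side b (f₁ x)
    set q := side b (f x)
    have h3 : 0 ≤ s * (wLoss S f - wLoss S f₁ + s * (w * (p - q) ^ 2) - 2 * w * p * (p - q)) := by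
      nlinarith
    have := (mul_nonneg_iff_of_pos_left hs0).1 h3
    linarith
  have hlim : Tendsto (fun s : ℝ => wLoss S f - wLoss S f₁ +
      s * (w * (side b (f₁ x) - side b (f x)) ^ 2)) (𝓝[>] 0) (𝓝 (wLoss S f - wLoss S f₁)) := by
    have : Tendsto (fun s : ℝ => wLoss S f - wLoss S f₁ +
      s * (w * (side b (f₁ x) - side b (f x)) ^ 2)) (𝓝 0) (𝓝 (wLoss S f - wLoss S f₁ +
      0 * (w * (side b (f₁ x) - side b (f x)) ^ 2))) :=
      (Continuous.tendsto (by fun_prop) 0)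
    rw [zero_mul, add_zero] at this
    exact this.mono_left nhdsWithin_le_nhds
  refine ge_of_tendsto hlim ?_
  filter_upwards [Ioc_mem_nhdsGT (show (0 : ℝ) < 1 by norm_num)] with s hs
  exact key s hs.1 hs.2

/-- The penalized minimizers trace the lower boundary of the convex region of pairs (side value,
loss). First-order optimality of `f₁` gives a supporting line of slope `2 W v₁` in absolute value,
and the chord from `f₁` to `f₂` is steeper by a factor of at most `1 + ρ`, because the two weights
differ by that factor. So the chord reaches loss level `β` no later than the supporting line reaches
level `β / (1 + ρ)`, which is at least the inner radius. -/
theorem convexSearch_sandwich {X : Type u} {F : Set (X → ℝ)} {O : List (WExample X) → X → ℝ}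
    (hO : IsRegressionOracle F O) (hF : ∀ f ∈ F, ∀ x, f x ∈ Set.Icc (0 : ℝ) 1) (hc : Convex ℝ F)
    {β inn z ρ : ℝ} {N : ℕ} (hβ : 0 < β) (hz : 0 < z) (hρ : 0 < ρ)
    (hin : inn * (1 + ρ) ≤ β) (hinβ : inn ≤ β) (hN : 1 ≤ z ^ 2 * (1 + ρ) ^ (2 ^ N))
    (B : List (X × Bool)) (x : X) (b : Bool) :
    Sandwich F O B x b inn β z ((convexSearch β ρ N B x b).run O) := by
  simp only [convexSearch, OracleProg.run, OracleProg.run_bind, bisect_run]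
  set t : ℕ → Bool := fun j =>
    (leaveTest (O (unitWeights B)) B x b β (β * (1 + ρ) ^ j)).run O with ht
  set R := wLoss (unitWeights B) with hR
  have htj : ∀ j, t j = true ↔ R (fhat O B) + β < R (O (probeList B x b (β * (1 + ρ) ^ j) 0)) := by
    intro j
    rw [ht]
    simp only [leaveTest, OracleProg.run, decide_eq_true_eq, fhat, hR]
  have hw : ∀ j : ℕ, 0 < β * (1 + ρ) ^ j := fun j => by positivity
  have hmin : ∀ j : ℕ, ∀ f ∈ F, R (O (probeList B x b (β * (1 + ρ) ^ j) 0)) +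
      β * (1 + ρ) ^ j * side b (O (probeList B x b (β * (1 + ρ) ^ j) 0) x) ^ 2 ≤
      R f + β * (1 + ρ) ^ j * side b (f x) ^ 2 := by
    intro j f hf
    have := probe_minimizer hO B x b (hw j).le (a := 0) ⟨le_rfl, zero_le_one⟩ hf
    simpa using this
  have hfh : ∀ f ∈ F, R (fhat O B) ≤ R f := (hO (unitWeights B)).2
  obtain ⟨h1, h2⟩ := bisectRun_spec t N 0
  set j := bisectRun t N 0
  have hmem₁ : O (probeList B x b (β * (1 + ρ) ^ j) 0) ∈ F := (hO _).1
  have hmem₂ : O (probeList B x b (β * (1 + ρ) ^ (j + 1)) 0) ∈ F := (hO _).1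
  have hmin₁ := hmin j
  have hmin₂ := hmin (j + 1)
  have hR1 : R (O (probeList B x b (β * (1 + ρ) ^ j) 0)) ≤ R (fhat O B) + β := by
    rcases h1 with h1 | h1
    -- The weights start at `β` so that the left end is in the active set: the penalty of the
    -- empirical minimizer is then at most `β`.
    · have h3 := hmin₁ (fhat O B) (hO _).1
      have h4 := side_mem_Icc (b := b) (hF _ (hO (unitWeights B)).1 x)
      have h5 : side b (fhat O B x) ^ 2 ≤ 1 := pow_le_one₀ h4.1 h4.2
      rw [h1] at h3 ⊢
      simp only [pow_zero, mul_one] at h3 ⊢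
      nlinarith [sq_nonneg (side b (O (probeList B x b β 0) x))]
    · by_contra! h
      have := (htj j).2 h
      rw [h1] at this
      exact absurd this (by simp)
  have hI : interpolate (O (unitWeights B)) B x b β (O (probeList B x b (β * (1 + ρ) ^ j) 0))
      (O (probeList B x b (β * (1 + ρ) ^ (j + 1)) 0)) =
      if R (fhat O B) + β < R (O (probeList B x b (β * (1 + ρ) ^ (j + 1)) 0)) then
      side b (O (probeList B x b (β * (1 + ρ) ^ j) 0) x) -
        (R (fhat O B) + β - R (O (probeList B x b (β * (1 + ρ) ^ j) 0))) /
      (R (O (probeList B x b (β * (1 + ρ) ^ (j + 1)) 0)) -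
        R (O (probeList B x b (β * (1 + ρ) ^ j) 0))) *
      (side b (O (probeList B x b (β * (1 + ρ) ^ j) 0) x) -
        side b (O (probeList B x b (β * (1 + ρ) ^ (j + 1)) 0) x))
      else side b (O (probeList B x b (β * (1 + ρ) ^ (j + 1)) 0) x) := rfl
  rw [hI]
  have hwj := hw j
  have hwj1 : β * (1 + ρ) ^ (j + 1) = β * (1 + ρ) ^ j * (1 + ρ) := by rw [pow_succ]; ring
  have hv1 := side_mem_Icc (b := b) (hF _ hmem₁ x)
  have hv2 := side_mem_Icc (b := b) (hF _ hmem₂ x)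
  have hneg : R (fhat O B) + β < R (O (probeList B x b (β * (1 + ρ) ^ (j + 1)) 0)) ∨
      (R (O (probeList B x b (β * (1 + ρ) ^ (j + 1)) 0)) ≤ R (fhat O B) + β ∧
        1 ≤ z ^ 2 * (1 + ρ) ^ (j + 1)) := by
    rcases h2 with h2 | h2
    · by_cases h : R (fhat O B) + β < R (O (probeList B x b (β * (1 + ρ) ^ (j + 1)) 0))
      · exact Or.inl h
      · right
        refine ⟨not_lt.1 h, ?_⟩
        rw [h2, zero_add]
        exact hN
    · exact Or.inl ((htj _).1 h2)
  generalize O (probeList B x b (β * (1 + ρ) ^ j) 0) = f₁ at *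
  generalize O (probeList B x b (β * (1 + ρ) ^ (j + 1)) 0) = f₂ at *
  rcases hneg with hout | ⟨hin2, hbig⟩
  · rw [if_pos hout]
    have hΔ : 0 < R f₂ - R f₁ := by linarith
    set τ := (R (fhat O B) + β - R f₁) / (R f₂ - R f₁) with hτ
    have hτ0 : 0 ≤ τ := div_nonneg (by linarith) hΔ.le
    have hτ1 : τ ≤ 1 := by rw [hτ, div_le_one hΔ]; linarith
    have hτm : τ * (R f₂ - R f₁) = R (fhat O B) + β - R f₁ := by
      rw [hτ]; field_simp
    constructor
    · refine ⟨(1 - τ) • f₁ + τ • f₂, ⟨hc hmem₁ hmem₂ (by linarith) hτ0 (by ring), ?_⟩, ?_⟩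
      · have := wLoss_convex (unitWeights B) f₁ f₂ hτ0 hτ1
        rw [← hR] at this ⊢
        linarith
      · simp only [Pi.add_apply, Pi.smul_apply, smul_eq_mul, side_combo]
        linarith
    · intro f hf
      have ha := first_order hc hmem₁ hmin₁ hf.1
      have hb := first_order hc hmem₂ hmin₂ hmem₁
      have hc' := hmin₁ f₂ hmem₂
      have hd' := hmin₂ f₁ hmem₁
      have hfR := hf.2
      rw [← hR] at hfR ha hb
      rw [hwj1] at hb hd'
      set v₁ := side b (f₁ x)
      set v₂ := side b (f₂ x)
      set v := side b (f x)
      set W := β * (1 + ρ) ^ j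
      by_contra! hlt
      -- Adding the two optimality inequalities gives `W ρ (v₂² - v₁²) ≤ 0`: a larger weight pulls
      -- closer to `0`.
      have hv12 : v₂ ≤ v₁ := by
        by_contra! h
        have hρW : 0 < W * ρ := by positivity
        nlinarith [mul_pos hρW (show 0 < v₂ ^ 2 - v₁ ^ 2 by nlinarith [hv1.1, hv2.1])]
      -- Optimality of `f₂`, tested against `f₁`, gives this with `v₂` in place of the factor `v₁`.
      have hΔv : R f₂ - R f₁ ≤ 2 * (1 + ρ) * W * v₁ * (v₁ - v₂) := by
        nlinarith [mul_nonneg (mul_nonneg (mul_nonneg (by norm_num : (0:ℝ) ≤ 2) hwj.le)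
          (by positivity : (0:ℝ) ≤ 1 + ρ)) (mul_nonneg (sub_nonneg.2 hv12) (sub_nonneg.2 hv12))]
      have hv1pos : 0 < v₁ := by
        rcases hv1.1.lt_or_eq with h | h
        · exact h
        · rw [← h] at hΔv; simp at hΔv; linarith
      have h6 : τ * (v₁ - v₂) < v₁ - v := by linarith
      have h7 : 2 * W * v₁ * (τ * (v₁ - v₂)) < 2 * W * v₁ * (v₁ - v) := by
        apply mul_lt_mul_of_pos_left h6; positivity
      have h8 : τ * (R f₂ - R f₁) ≤ (1 + ρ) * (2 * W * v₁ * (τ * (v₁ - v₂))) := by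
        nlinarith [mul_le_mul_of_nonneg_left hΔv hτ0]
      have h9 : (1 + ρ) * (2 * W * v₁ * (τ * (v₁ - v₂))) < (1 + ρ) * (R f - R f₁) := by
        apply mul_lt_mul_of_pos_left (by linarith) (by linarith)
      have h10 := hfh f₁ hmem₁
      nlinarith
  -- No tested weight up to the largest one bracketed the boundary. That weight is at least `β /
  -- z²`, so any `f` in the inner set forces `v₂² ≤ v² + z²`.
  · rw [if_neg (not_lt.2 hin2)]
    refine ⟨⟨f₂, ⟨hmem₂, hin2⟩, le_rfl⟩, ?_⟩
    intro f hf
    have ha := hmin₂ f hf.1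
    have hfR := hf.2
    have hfhR := hfh f₂ hmem₂
    have hv := side_mem_Icc (b := b) (hF _ hf.1 x)
    rw [← hR] at hfR
    set v₂ := side b (f₂ x)
    set v := side b (f x)
    set Q := (1 + ρ) ^ (j + 1)
    have hQ : 0 < Q := by positivity
    have h3 : β * (Q * (v₂ ^ 2 - v ^ 2)) ≤ β * (z ^ 2 * Q) := by nlinarith
    have h4 := le_of_mul_le_mul_left h3 hβ
    have h5 : v₂ ^ 2 - v ^ 2 ≤ z ^ 2 := by
      rw [mul_comm (z ^ 2)] at h4
      exact le_of_mul_le_mul_left h4 hQ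
    refine le_of_sq_le_sq ?_ (by linarith [hv.1])
    nlinarith [mul_nonneg hz.le hv.1]

/-! ### Measurability of lists -/

/-- The measurable structure on lists: a set is measurable if its intersection with the lists of
each given length is. -/
instance listMeasurableSpace {Z : Type*} [MeasurableSpace Z] : MeasurableSpace (List Z) :=
  ⨅ n : ℕ, MeasurableSpace.map (fun v : Fin n → Z => List.ofFn v) inferInstance

section Lists

variable {Z Y W Ω : Type*} [MeasurableSpace Z] [MeasurableSpace Y] [MeasurableSpace W]
  [MeasurableSpace Ω]

theorem measurableSet_list {s : Set (List Z)} :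
    MeasurableSet s ↔ ∀ n : ℕ, MeasurableSet ((fun v : Fin n → Z => List.ofFn v) ⁻¹' s) := by
  rw [listMeasurableSpace, MeasurableSpace.measurableSet_iInf]
  rfl

theorem measurable_ofFn (n : ℕ) : Measurable (fun v : Fin n → Z => List.ofFn v) :=
  fun _ hs => measurableSet_list.1 hs n

theorem measurableEmbedding_ofFn (n : ℕ) :
    MeasurableEmbedding (fun v : Fin n → Z => List.ofFn v) where
  injective := List.ofFn_injective
  measurable := measurable_ofFn n
  measurableSet_image' := by
    intro s hs
    rw [measurableSet_list]
    intro k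
    by_cases hk : k = n
    · subst hk
      rwa [Set.preimage_image_eq _ List.ofFn_injective]
    · convert MeasurableSet.empty
      ext v
      simp only [Set.mem_preimage, Set.mem_image, Set.mem_empty_iff_false, iff_false, not_exists,
        not_and]
      intro w _ h
      have := congrArg List.length h
      simp at this
      exact hk this.symm

/-- Lists split into countably many pieces by length, and each piece is a measurably embedded finite
power. All measurability of the adaptive run is reduced to fixed lengths in this way, which is also
the form in which measurability of the oracle is given. -/
theorem measurable_list_prod {f : List Z × Y → W}
    (h : ∀ n : ℕ, Measurable fun p : (Fin n → Z) × Y => f (List.ofFn p.1, p.2)) :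
    Measurable f := by
  intro s hs
  have : f ⁻¹' s = ⋃ n : ℕ, (fun p : (Fin n → Z) × Y => (List.ofFn p.1, p.2)) ''
      ((fun p : (Fin n → Z) × Y => f (List.ofFn p.1, p.2)) ⁻¹' s) := by
    ext ⟨l, y⟩
    simp only [Set.mem_preimage, Set.mem_iUnion, Set.mem_image, Prod.mk.injEq, Prod.exists]
    constructor
    · intro hl
      exact ⟨l.length, l.get, y, by simpa using hl, by simp, rfl⟩
    · rintro ⟨n, v, y', hv, rfl, rfl⟩
      exact hv
  rw [this]
  refine MeasurableSet.iUnion fun n => ?_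
  exact ((measurableEmbedding_ofFn n).prodMap MeasurableEmbedding.id).measurableSet_image' (h n hs)

theorem measurable_list_append {f g : Ω → List Z} (hf : Measurable f) (hg : Measurable g) :
    Measurable fun ω => f ω ++ g ω := by
  have h : Measurable fun p : List Z × List Z => p.1 ++ p.2 := by
    refine measurable_list_prod fun n => ?_
    have h2 : Measurable fun q : List Z × (Fin n → Z) => List.ofFn q.2 ++ q.1 := by
      refine measurable_list_prod fun k => ?_
      have : (fun q : (Fin k → Z) × (Fin n → Z) => List.ofFn q.2 ++ List.ofFn q.1) =
          fun q => List.ofFn (Fin.append q.2 q.1) := by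
        ext1 q
        rw [List.ofFn_fin_append]
      change Measurable (fun q : (Fin k → Z) × (Fin n → Z) => List.ofFn q.2 ++ List.ofFn q.1)
      rw [this]
      refine (measurable_ofFn (n + k)).comp (measurable_pi_lambda _ fun i => ?_)
      refine Fin.addCases (fun j => ?_) (fun j => ?_) i
      · simp only [Fin.append_left]; fun_prop
      · simp only [Fin.append_right]; fun_prop
    exact h2.comp measurable_swap
  exact h.comp (hf.prodMk hg)

theorem measurable_list_singleton {f : Ω → Z} (hf : Measurable f) :
    Measurable fun ω => [f ω] := by
  have : (fun ω => [f ω]) = fun ω => List.ofFn (fun _ : Fin 1 => f ω) := by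
    ext1 ω; simp
  rw [this]
  exact (measurable_ofFn 1).comp (measurable_pi_lambda _ fun _ => hf)

theorem measurable_list_map {g : Z → W} (hg : Measurable g) : Measurable (List.map g) := by
  have h : Measurable fun p : List Z × Unit => p.1.map g := by
    refine measurable_list_prod fun n => ?_
    simp only [List.map_ofFn]
    exact (measurable_ofFn n).comp (measurable_pi_lambda _ fun i => by fun_prop)
  exact h.comp (measurable_id.prodMk (measurable_const (a := ())))

theorem measurable_list_map_sum {L : Ω → List Z} {h : Ω → Z → ℝ} (hL : Measurable L)
    (hh : Measurable (Function.uncurry h)) : Measurable fun ω => ((L ω).map (h ω)).sum := by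
  have : Measurable fun p : List Z × Ω => (p.1.map (h p.2)).sum := by
    refine measurable_list_prod fun n => ?_
    simp only [List.map_ofFn, List.sum_ofFn]
    refine Finset.measurable_sum _ fun i _ => ?_
    exact hh.comp (f := fun p : (Fin n → Z) × Ω => (p.2, p.1 i)) (by fun_prop)
  exact this.comp (hL.prodMk measurable_id)

theorem measurable_list_map_filter (q : Ω → Z → Bool)
    (hq : Measurable (Function.uncurry q)) (l : List ℕ) (g : Ω → ℕ → Z)
    (hg : ∀ t, Measurable fun ω => g ω t) :
    Measurable fun ω => (l.map (g ω)).filter (q ω) := by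
  induction l with
  | nil => exact measurable_const
  | cons t l ih =>
    have : (fun ω => ((t :: l).map (g ω)).filter (q ω)) = fun ω =>
        if q ω (g ω t) = true then [g ω t] ++ (l.map (g ω)).filter (q ω)
        else (l.map (g ω)).filter (q ω) := by
      ext1 ω
      simp [List.filter_cons]
    rw [this]
    refine Measurable.ite ?_ (measurable_list_append (measurable_list_singleton (hg t)) ih) ih
    exact (hq.comp (measurable_id.prodMk (hg t))) (measurableSet_singleton true)

theorem measurable_decide {p : Ω → Prop} [DecidablePred p] (h : MeasurableSet {ω | p ω}) :
    Measurable fun ω => decide (p ω) := by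
  refine measurable_to_bool ?_
  convert h using 1
  ext ω
  simp

end Lists

/-! ### Measurability of the searches -/

theorem measurable_bisectRun {Ω : Type*} [MeasurableSpace Ω] {t : Ω → ℕ → Bool}
    (ht : ∀ j, Measurable fun ω => t ω j) (n lo : ℕ) :
    Measurable fun ω => bisectRun (t ω) n lo := by
  induction n generalizing lo with
  | zero => exact measurable_const
  | succ n ih =>
    have : (fun ω => bisectRun (t ω) (n + 1) lo) = fun ω =>
        if t ω (lo + 2 ^ n) = true then bisectRun (t ω) n lo
        else bisectRun (t ω) n (lo + 2 ^ n) := by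
      ext1 ω
      rw [bisectRun]
      split_ifs <;> rfl
    rw [this]
    exact Measurable.ite (ht _ (measurableSet_singleton true)) (ih _) (ih _)

theorem measurable_nat_index {Ω W : Type*} [MeasurableSpace Ω] [MeasurableSpace W] {j : Ω → ℕ}
    (hj : Measurable j) {f : ℕ → Ω → W} (hf : ∀ k, Measurable (f k)) :
    Measurable fun ω => f (j ω) ω := by
  have : Measurable fun p : ℕ × Ω => f p.1 p.2 := measurable_from_prod_countable_right hf
  exact this.comp (hj.prodMk measurable_id)

section Searches

variable {X : Type u} [MeasurableSpace X] {Ω : Type*} [MeasurableSpace Ω]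
  {O : List (WExample X) → X → ℝ}

theorem MeasurableOracle.comp (hO : MeasurableOracle O) {L : Ω → List (WExample X)} {x : Ω → X}
    (hL : Measurable L) (hx : Measurable x) : Measurable fun ω => O (L ω) (x ω) := by
  have : Measurable fun p : List (WExample X) × X => O p.1 p.2 := measurable_list_prod hO
  exact this.comp (hL.prodMk hx)

theorem measurable_labelVal : Measurable labelVal := measurable_of_countable _

theorem measurable_side (b : Bool) : Measurable (side b) := by
  unfold side
  cases b
  · simp only [Bool.false_eq_true, if_false]; exact measurable_id
  · simp only [if_true]; fun_prop

theorem measurable_unitWeights {B : Ω → List (X × Bool)} (hB : Measurable B) :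
    Measurable fun ω => unitWeights (B ω) :=
  (measurable_list_map (by fun_prop)).comp hB

theorem MeasurableOracle.wLoss (hO : MeasurableOracle O) {S L : Ω → List (WExample X)}
    (hS : Measurable S) (hL : Measurable L) :
    Measurable fun ω => wLoss (S ω) (O (L ω)) := by
  refine measurable_list_map_sum (h := fun ω e => (e.1 : ℝ) * (O (L ω) e.2.1 - labelVal e.2.2) ^ 2)
    hS ?_
  have h1 : Measurable fun p : Ω × WExample X => O (L p.1) p.2.2.1 :=
    hO.comp (hL.comp measurable_fst) (by fun_prop)
  have h2 : Measurable fun p : Ω × WExample X => labelVal p.2.2.2 :=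
    measurable_labelVal.comp (by fun_prop)
  have h3 : Measurable fun p : Ω × WExample X => (p.2.1 : ℝ) :=
    measurable_coe_nnreal_real.comp (by fun_prop)
  exact h3.mul ((h1.sub h2).pow_const 2)

theorem measurable_probeList {B : Ω → List (X × Bool)} {x : Ω → X} (hB : Measurable B)
    (hx : Measurable x) (b : Bool) (w a : ℝ) :
    Measurable fun ω => probeList (B ω) (x ω) b w a := by
  refine measurable_list_append (measurable_unitWeights hB) ?_
  have : (fun ω => [((w * (1 - a)).toNNReal, x ω, b), ((w * a).toNNReal, x ω, !b)]) =
      fun ω => [((w * (1 - a)).toNNReal, x ω, b)] ++ [((w * a).toNNReal, x ω, !b)] := rfl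
  rw [this]
  exact measurable_list_append (measurable_list_singleton (by fun_prop))
    (measurable_list_singleton (by fun_prop))

omit [MeasurableSpace X] in
theorem measurable_anyProg {p : Ω → ℕ → OracleProg X Bool}
    (hp : ∀ i, Measurable fun ω => (p ω i).run O) (J : ℕ) :
    Measurable fun ω => (anyProg (p ω) J).run O := by
  induction J with
  | zero => exact measurable_const
  | succ J ih =>
    simp only [anyProg, OracleProg.run_bind, OracleProg.run]
    exact (measurable_of_countable (fun q : Bool × Bool => (q.1 || q.2))).comp (ih.prodMk (hp J))

theorem measurable_generalSearch (hO : MeasurableOracle O) {B : Ω → List (X × Bool)} {x : Ω → X}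
    (hB : Measurable B) (hx : Measurable x) (β z σ : ℝ) (J N : ℕ) (b : Bool) :
    Measurable fun ω => (generalSearch β z σ J N (B ω) (x ω) b).run O := by
  simp only [generalSearch, OracleProg.run, OracleProg.run_bind, bisect_run]
  have hj : Measurable fun ω => bisectRun (fun j => (anyProg (fun i =>
      probe (O (unitWeights (B ω))) (B ω) (x ω) b β (β / (z * (1 + σ) ^ i) ^ 2)
        ((j : ℝ) / 2 ^ N - z * (1 + σ) ^ i) ((j : ℝ) / 2 ^ N)) J).run O) N 0 := by
    refine measurable_bisectRun (fun j => measurable_anyProg (fun i => ?_) J) N 0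
    simp only [probe, OracleProg.run]
    have hP := measurable_probeList hB hx b (β / (z * (1 + σ) ^ i) ^ 2)
      ((j : ℝ) / 2 ^ N - z * (1 + σ) ^ i)
    have hU := measurable_unitWeights hB
    refine measurable_decide ?_
    refine MeasurableSet.inter (measurableSet_le (hO.wLoss hU hP)
      ((hO.wLoss hU hU).add_const β)) ?_
    exact measurableSet_lt ((measurable_side b).comp (hO.comp hP hx)) measurable_const
  exact (measurable_of_countable (fun j : ℕ => ((j : ℝ) + 1) / 2 ^ N)).comp hj

theorem measurable_convexSearch (hO : MeasurableOracle O) {B : Ω → List (X × Bool)} {x : Ω → X}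
    (hB : Measurable B) (hx : Measurable x) (β ρ : ℝ) (N : ℕ) (b : Bool) :
    Measurable fun ω => (convexSearch β ρ N (B ω) (x ω) b).run O := by
  simp only [convexSearch, OracleProg.run, OracleProg.run_bind, bisect_run]
  have hU := measurable_unitWeights hB
  have hP := fun w => measurable_probeList hB hx b w 0
  have hR := fun w => hO.wLoss hU (hP w)
  have hv := fun w => (measurable_side b).comp (hO.comp (hP w) hx)
  have hj : Measurable fun ω => bisectRun (fun j =>
      (leaveTest (O (unitWeights (B ω))) (B ω) (x ω) b β (β * (1 + ρ) ^ j)).run O) N 0 := by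
    refine measurable_bisectRun (fun j => ?_) N 0
    simp only [leaveTest, OracleProg.run]
    exact measurable_decide (measurableSet_lt ((hO.wLoss hU hU).add_const β) (hR _))
  refine measurable_nat_index hj (f := fun j ω => interpolate (O (unitWeights (B ω))) (B ω) (x ω) b β
    (O (probeList (B ω) (x ω) b (β * (1 + ρ) ^ j) 0))
    (O (probeList (B ω) (x ω) b (β * (1 + ρ) ^ (j + 1)) 0))) fun j => ?_
  simp only [interpolate]
  refine Measurable.ite (measurableSet_lt ((hO.wLoss hU hU).add_const β) (hR _)) ?_ (hv _)
  exact (hv _).sub (((((hO.wLoss hU hU).add_const β).sub (hR _)).div ((hR _).sub (hR _))).mul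
    ((hv _).sub (hv _)))

end Searches

/-! ### The subroutine and the queried examples -/

/-- The slack of the confidence bounds. -/
def Params.zeta (p : Params) : ℝ := p.eps * p.gam / (32 * (p.M + 2))

/-- The affine map that is applied to the result of a search in epoch `m`: it moves bounds away from
`1/2`, by an amount decreasing in `m`, and contracts towards `1/2`. -/
def Params.shift (p : Params) (m : ℕ) (e : ℝ) : ℝ :=
  1 / 2 - ((p.M : ℝ) - m + 2) * p.zeta + (1 - p.eps / 8) * (e - 1 / 2)

/-- The subroutine built on a search procedure. -/
def mkSub {X : Type u} (srch : Params → ℕ → List (X × Bool) → X → Bool → OracleProg X ℝ) :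
    CISub X := fun p m B x =>
  (srch p m B x false).bind fun e₀ => (srch p m B x true).bind fun e₁ =>
    .ret (p.shift m e₀, 1 - p.shift m e₁)

theorem mkSub_bounds {X : Type u}
    (srch : Params → ℕ → List (X × Bool) → X → Bool → OracleProg X ℝ)
    (O : List (WExample X) → X → ℝ) (p : Params) (m : ℕ) (B : List (X × Bool)) (x : X) :
    bounds O (mkSub srch) p m B x =
      (p.shift m ((srch p m B x false).run O), 1 - p.shift m ((srch p m B x true).run O)) := by
  simp [bounds, mkSub, OracleProg.run_bind, OracleProg.run]

theorem mkSub_calls {X : Type u}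
    (srch : Params → ℕ → List (X × Bool) → X → Bool → OracleProg X ℝ)
    (O : List (WExample X) → X → ℝ) (p : Params) (m : ℕ) (B : List (X × Bool)) (x : X) {K : ℕ}
    (hK : ∀ b, (srch p m B x b).calls O ≤ K) :
    (mkSub srch p m B x).calls O ≤ 2 * K := by
  simp only [mkSub, OracleProg.calls_bind, OracleProg.calls]
  have h1 := hK false
  have h2 := hK true
  omega

section Queried

variable {X : Type u} [MeasurableSpace X] {O : List (WExample X) → X → ℝ} {A : CISub X}
  {p : Params}

/-- The confidence bounds are jointly measurable in the queried examples and the point. -/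
def MeasurableBounds (O : List (WExample X) → X → ℝ) (A : CISub X) (p : Params) : Prop :=
  ∀ m, Measurable fun q : List (X × Bool) × X => bounds O A p m q.1 q.2

/-- Crossed bounds give an empty interval, which the classifier treats as abstention; this case has
to be carried along until the good event excludes it. -/
theorem Icc_subset_Icc_iff_or (a b c d : ℝ) :
    Set.Icc a b ⊆ Set.Icc c d ↔ (b < a ∨ (c ≤ a ∧ b ≤ d)) := by
  rcases lt_or_ge b a with h | h
  · simp [h]
  · rw [Set.Icc_subset_Icc_iff h]
    constructor
    · intro h'; exact Or.inr h'
    · rintro (h' | h')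
      · linarith
      · exact h'

theorem measurableSet_classifier {Ω : Type*} [MeasurableSpace Ω] (γ : ℝ) {b : Ω → ℝ × ℝ}
    {f : Ω → ℝ} (hb : Measurable b) (hf : Measurable f) (o : Option Bool) :
    MeasurableSet {ω | classifier γ b f ω = o} := by
  have h1 := hb.fst
  have h2 := hb.snd
  have hN : MeasurableSet {ω | Set.Icc (b ω).1 (b ω).2 ⊆ Set.Icc (1 / 2 - γ) (1 / 2 + γ)} := by
    simp only [Icc_subset_Icc_iff_or]
    exact (measurableSet_lt h2 h1).union ((measurableSet_le measurable_const h1).inter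
      (measurableSet_le h2 measurable_const))
  have hS : Measurable (signClassifier f) := by
    unfold signClassifier
    exact measurable_decide (measurableSet_le measurable_const (by fun_prop))
  cases o with
  | none => simpa [classifier] using hN
  | some y =>
    have : {ω | classifier γ b f ω = some y} =
        {ω | Set.Icc (b ω).1 (b ω).2 ⊆ Set.Icc (1 / 2 - γ) (1 / 2 + γ)}ᶜ ∩
          signClassifier f ⁻¹' {y} := by
      ext ω
      by_cases h : Set.Icc (b ω).1 (b ω).2 ⊆ Set.Icc (1 / 2 - γ) (1 / 2 + γ) <;>
        simp [classifier]
    rw [this]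
    exact hN.compl.inter (hS (measurableSet_singleton y))

theorem measurable_queryFn {Ω : Type*} [MeasurableSpace Ω] (γ : ℝ) {b : Ω → ℝ × ℝ} {f : Ω → ℝ}
    (hb : Measurable b) (hf : Measurable f) : Measurable (queryFn γ b f) := by
  unfold queryFn
  refine measurable_decide ((MeasurableSet.inter (measurableSet_lt hb.fst measurable_const)
    (measurableSet_lt measurable_const hb.snd)).inter ?_)
  exact (measurableSet_classifier γ hb hf none).compl

/-- The query function of epoch `m`. -/
def epochQuery (O : List (WExample X) → X → ℝ) (A : CISub X) (p : Params) (ω : ℕ → X × Bool)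
    (m : ℕ) : X → Bool :=
  queryFn p.gam (bounds O A p m (queried O A p ω (m - 1))) (fhat O (queried O A p ω (m - 1)))

theorem measurable_epochQuery_of (hO : MeasurableOracle O) (hA : MeasurableBounds O A p) {m : ℕ}
    (hq : Measurable fun ω => queried O A p ω (m - 1)) :
    Measurable fun q : (ℕ → X × Bool) × X => epochQuery O A p q.1 m q.2 := by
  have h1 : Measurable fun q : (ℕ → X × Bool) × X =>
      bounds O A p m (queried O A p q.1 (m - 1)) q.2 :=
    (hA m).comp ((hq.comp measurable_fst).prodMk measurable_snd)
  have h2 : Measurable fun q : (ℕ → X × Bool) × X => fhat O (queried O A p q.1 (m - 1)) q.2 :=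
    hO.comp (measurable_unitWeights (hq.comp measurable_fst)) measurable_snd
  exact measurable_queryFn p.gam h1 h2

theorem measurable_queried (hO : MeasurableOracle O) (hA : MeasurableBounds O A p) (m : ℕ) :
    Measurable fun ω => queried O A p ω m := by
  induction m with
  | zero => exact measurable_const
  | succ m ih =>
    refine measurable_list_append ih ?_
    have h := measurable_epochQuery_of hO hA (m := m + 1) ih
    refine measurable_list_map_filter (fun ω z => epochQuery O A p ω (m + 1) z.1) ?_ _
      (fun (ω : ℕ → X × Bool) t => ω t) (fun t => measurable_pi_apply t)
    exact h.comp (f := fun q : (ℕ → X × Bool) × (X × Bool) => (q.1, q.2.1)) (by fun_prop)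

theorem measurable_epochQuery (hO : MeasurableOracle O) (hA : MeasurableBounds O A p) (m : ℕ) :
    Measurable fun q : (ℕ → X × Bool) × X => epochQuery O A p q.1 m q.2 :=
  measurable_epochQuery_of hO hA (measurable_queried hO hA _)

theorem tau_mono : Monotone tau := by
  refine monotone_nat_of_le_succ fun m => ?_
  cases m with
  | zero => simp [tau]
  | succ m =>
    simp only [tau, Nat.succ_ne_zero, if_false]
    exact Nat.pow_le_pow_right (by norm_num) (Nat.le_succ _)

omit [MeasurableSpace X] in
theorem queried_congr {ω ω' : ℕ → X × Bool} {m : ℕ} (h : ∀ t < tau m, ω t = ω' t) :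
    queried O A p ω m = queried O A p ω' m := by
  induction m with
  | zero => rfl
  | succ m ih =>
    have hmono : tau m ≤ tau (m + 1) := tau_mono (Nat.le_succ m)
    have ih' := ih fun t ht => h t (ht.trans_le hmono)
    have he : epochExamples ω (m + 1) = epochExamples ω' (m + 1) := by
      unfold epochExamples
      refine List.map_congr_left fun t ht => h t ?_
      rw [List.mem_range'_1] at ht
      simp only [Nat.add_sub_cancel] at ht
      omega
    rw [queried, queried, ih', he]

/-- The epoch that contains the time `t` (where times start at `0`). -/
def epochOf (t : ℕ) : ℕ := Nat.log 2 t + 1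

theorem tau_epochOf_le (t : ℕ) : tau (epochOf t - 1) ≤ t := by
  unfold tau epochOf
  simp only [Nat.add_sub_cancel]
  split_ifs with h
  · exact Nat.zero_le _
  · have : t ≠ 0 := by rintro rfl; simp at h
    exact Nat.pow_log_le_self 2 this

theorem epochOf_eq {m t : ℕ} (h1 : tau m ≤ t) (h2 : t < tau (m + 1)) : epochOf t = m + 1 := by
  unfold epochOf
  congr 1
  unfold tau at h1 h2
  simp only [Nat.succ_ne_zero, if_false] at h2
  split_ifs at h1 with h
  -- Epoch 1 consists of the times `0` and `1`, and `Nat.log 2` is `0` at both.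
  · subst h
    rw [Nat.log_eq_zero_iff]; left; simpa using h2
  · exact (Nat.log_eq_iff (Or.inl h)).2 ⟨h1, h2⟩

/-- The query function at time `t`. -/
def timeQuery (O : List (WExample X) → X → ℝ) (A : CISub X) (p : Params) (ω : ℕ → X × Bool)
    (t : ℕ) : X → Bool :=
  epochQuery O A p ω (epochOf t)

-- The query rule at time `t` depends only on earlier examples. This is the non-anticipation needed
-- for the adaptive tail bounds.
omit [MeasurableSpace X] in
theorem timeQuery_congr {ω ω' : ℕ → X × Bool} {t : ℕ} (h : ∀ s < t, ω s = ω' s) :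
    timeQuery O A p ω t = timeQuery O A p ω' t := by
  unfold timeQuery epochQuery
  rw [queried_congr fun s hs => h s (hs.trans_le (tau_epochOf_le t))]

omit [MeasurableSpace X] in
theorem sum_queried (g : X × Bool → ℝ) (ω : ℕ → X × Bool) (m : ℕ) :
    ((queried O A p ω m).map g).sum =
      ∑ t ∈ Finset.range (tau m), if timeQuery O A p ω t (ω t).1 then g (ω t) else 0 := by
  induction m with
  | zero => simp [queried, tau]
  | succ m ih =>
    rw [queried, List.map_append, List.sum_append, ih,
      ← Finset.sum_range_add_sum_Ico _ (tau_mono (Nat.le_succ m))]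
    congr 1
    have hfil : ∀ (l : List (X × Bool)) (q : X × Bool → Bool),
        ((l.filter q).map g).sum = (l.map fun z => if q z then g z else 0).sum := by
      intro l q
      induction l with
      | nil => rfl
      | cons z l ih =>
        by_cases hz : q z = true
        · simp [hz, ih]
        · simp [hz, ih]
    rw [hfil, epochExamples, List.map_map]
    have hsum : ∀ (a k : ℕ) (h : ℕ → ℝ), ((List.range' a k).map h).sum =
        ∑ t ∈ Finset.Ico a (a + k), h t := by
      intro a k h
      induction k with
      | zero => simp
      | succ k ih =>
        rw [List.range'_concat, List.map_append, List.sum_append, ih, ← add_assoc,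
          Finset.sum_Ico_succ_top (by omega)]
        simp
    rw [hsum]
    simp only [Nat.add_sub_cancel]
    rw [Nat.add_sub_cancel' (tau_mono (Nat.le_succ m))]
    refine Finset.sum_congr rfl fun t ht => ?_
    rw [Finset.mem_Ico] at ht
    simp only [Function.comp, timeQuery, epochQuery, epochOf_eq ht.1 ht.2, Nat.add_sub_cancel]

end Queried

/-! ### Finite covers from the pseudo dimension -/

theorem sum_choose_le_pow (m d : ℕ) : ∑ i ∈ Finset.Iic d, m.choose i ≤ (m + 1) ^ d := by
  rw [add_pow, ← Nat.range_succ_eq_Iic]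
  refine Finset.sum_le_sum fun i hi => ?_
  rw [Finset.mem_range, Nat.lt_succ_iff] at hi
  rw [one_pow, mul_one]
  calc m.choose i ≤ m ^ i := Nat.choose_le_pow m i
    _ = m ^ i * 1 := (mul_one _).symm
    _ ≤ m ^ i * d.choose i := Nat.mul_le_mul_left _ (Nat.choose_pos hi)

open Classical in
/-- The grid pattern of `f` at the points `pts`: which of the levels `j / n` does `f` exceed? -/
def gridPattern {X : Type u} {ι : Type*} [Fintype ι] (pts : ι → X) (n : ℕ) (f : X → ℝ) :
    Finset (ι × Fin n) :=
  Finset.univ.filter fun a => (a.2 : ℝ) / n < f (pts a.1)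

/-- Otherwise the level obtained by rounding the value of `g` up to the grid is exceeded by `f` but
not by `g`. That level has index below `n` because `f ≤ 1`. -/
theorem le_add_of_gridPattern_subset {X : Type u} {ι : Type*} [Fintype ι] {pts : ι → X} {n : ℕ}
    (hn : 0 < n) {f g : X → ℝ} (hf : ∀ x, f x ≤ 1) (hg : ∀ x, 0 ≤ g x)
    (h : gridPattern pts n f ⊆ gridPattern pts n g) (i : ι) : f (pts i) ≤ g (pts i) + 1 / n := by
  by_contra! hlt
  have hn' : (0 : ℝ) < n := by exact_mod_cast hn
  have h1 : ((⌈g (pts i) * n⌉₊ : ℕ) : ℝ) < g (pts i) * n + 1 :=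
    Nat.ceil_lt_add_one (mul_nonneg (hg _) hn'.le)
  have h2 : g (pts i) * n + 1 < f (pts i) * n := by
    have := mul_lt_mul_of_pos_right hlt hn'
    rwa [add_mul, one_div_mul_cancel hn'.ne'] at this
  have h3 : ⌈g (pts i) * n⌉₊ < n := by
    have : ((⌈g (pts i) * n⌉₊ : ℕ) : ℝ) < n := by nlinarith [hf (pts i)]
    exact_mod_cast this
  have hmem : ((i, ⟨_, h3⟩) : ι × Fin n) ∈ gridPattern pts n f := by
    simp only [gridPattern, Finset.mem_filter, Finset.mem_univ, true_and]
    rw [div_lt_iff₀ hn']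
    linarith
  have := h hmem
  simp only [gridPattern, Finset.mem_filter, Finset.mem_univ, true_and] at this
  rw [div_lt_iff₀ hn'] at this
  linarith [Nat.le_ceil (g (pts i) * n)]

/-- Functions with equal grid patterns are within `1 / n` at all the points, so one representative
per pattern suffices. A shattered set of grid positions is a pseudo-shattered set of pairs, so
Sauer–Shelah counts the patterns. -/
theorem exists_grid_cover {X : Type u} {G : Set (X → ℝ)} {d : ℕ} (hd : pdim G ≤ d)
    (hG : ∀ f ∈ G, ∀ x, f x ∈ Set.Icc (0 : ℝ) 1) {ι : Type*} [Fintype ι] (pts : ι → X) {n : ℕ}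
    (hn : 0 < n) :
    ∃ K : Finset (X → ℝ), ↑K ⊆ G ∧ K.card ≤ (Fintype.card ι * n + 1) ^ d ∧
      ∀ f ∈ G, ∃ k ∈ K, ∀ i, |f (pts i) - k (pts i)| ≤ 1 / n := by
  classical
  set 𝒜 : Finset (Finset (ι × Fin n)) := (Set.toFinite (gridPattern pts n '' G)).toFinset with h𝒜
  have hmem : ∀ s, s ∈ 𝒜 ↔ ∃ f ∈ G, gridPattern pts n f = s := by
    intro s; simp [h𝒜]
  have hrep : ∀ s, ∃ f : X → ℝ, s ∈ 𝒜 → f ∈ G ∧ gridPattern pts n f = s := by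
    intro s
    by_cases hs : s ∈ 𝒜
    · obtain ⟨f, hf⟩ := (hmem s).1 hs
      exact ⟨f, fun _ => hf⟩
    · exact ⟨0, fun h => absurd h hs⟩
  choose rep hrep using hrep
  refine ⟨𝒜.image rep, ?_, ?_, ?_⟩
  · intro f hf
    simp only [Finset.coe_image, Set.mem_image, Finset.mem_coe] at hf
    obtain ⟨s, hs, rfl⟩ := hf
    exact (hrep s hs).1
  · have hvc : 𝒜.vcDim ≤ d := by
      refine Finset.sup_le fun S hS => ?_
      rw [Finset.mem_shatterer] at hS
      set φ : ι × Fin n → X × ℝ := fun a => (pts a.1, (a.2 : ℝ) / n) with hφ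
      have hpat : ∀ (f : X → ℝ) a, a ∈ gridPattern pts n f ↔ (φ a).2 < f (φ a).1 := by
        intro f a; simp [gridPattern, hφ]
      -- Points of the family may coincide, but two indices that give the same pair cannot be
      -- separated and so cannot both lie in a shattered set.
      have hinj : Set.InjOn φ S := by
        intro a ha a' ha' heq
        obtain ⟨u, hu, hu'⟩ := hS (t := {a}) (by simpa using ha)
        obtain ⟨f, -, rfl⟩ := (hmem u).1 hu
        have h1 : a ∈ S ∩ gridPattern pts n f := by rw [hu']; simp
        have h2 : a' ∈ S ∩ gridPattern pts n f := by
          rw [Finset.mem_inter] at h1 ⊢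
          refine ⟨ha', ?_⟩
          rw [hpat, ← heq, ← hpat]
          exact h1.2
        rw [hu', Finset.mem_singleton] at h2
        exact h2.symm
      have hcard : ((S.image φ).card : ℕ∞) ≤ pdim G := by
        refine le_iSup₂_of_le (S.image φ) ?_ le_rfl
        intro A hA
        obtain ⟨u, hu, hu'⟩ := hS (t := S.filter fun a => φ a ∈ A) (Finset.filter_subset _ _)
        obtain ⟨f, hf, rfl⟩ := (hmem u).1 hu
        refine ⟨f, hf, ?_⟩
        intro p hp
        obtain ⟨a, ha, rfl⟩ := Finset.mem_image.1 hp
        rw [← hpat]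
        have := Finset.ext_iff.1 hu' a
        simp only [Finset.mem_inter, Finset.mem_filter, ha, true_and] at this
        exact this
      rw [Finset.card_image_of_injOn hinj] at hcard
      exact_mod_cast hcard.trans hd
    calc (𝒜.image rep).card ≤ 𝒜.card := Finset.card_image_le
      _ ≤ 𝒜.shatterer.card := Finset.card_le_card_shatterer 𝒜
      _ ≤ ∑ k ∈ Finset.Iic 𝒜.vcDim, (Fintype.card (ι × Fin n)).choose k :=
        Finset.card_shatterer_le_sum_vcDim
      _ ≤ ∑ k ∈ Finset.Iic d, (Fintype.card (ι × Fin n)).choose k :=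
        Finset.sum_le_sum_of_subset (Finset.Iic_subset_Iic.2 hvc)
      _ ≤ (Fintype.card (ι × Fin n) + 1) ^ d := sum_choose_le_pow _ _
      _ = _ := by rw [Fintype.card_prod, Fintype.card_fin]
  · intro f hf
    have hs : gridPattern pts n f ∈ 𝒜 := (hmem _).2 ⟨f, hf, rfl⟩
    refine ⟨rep (gridPattern pts n f), Finset.mem_image_of_mem _ hs, fun i => ?_⟩
    obtain ⟨h1, h2⟩ := hrep _ hs
    rw [abs_le]
    constructor
    · have := le_add_of_gridPattern_subset hn (fun x => (hG _ h1 x).2) (fun x => (hG _ hf x).1)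
        h2.subset i
      linarith
    · have := le_add_of_gridPattern_subset hn (fun x => (hG _ hf x).2) (fun x => (hG _ h1 x).1)
        h2.symm.subset i
      linarith

/-! ### Comparison of two samples -/

/-- The doubled weight on the second sample gives a negative drift `-(a + b) / 6`, which dominates
`(a - b)² / 8` from `cosh u ≤ exp (u² / 2)`, since `(a - b)² ≤ a + b` on `[0, 1]`. -/
theorem exp_two_sample {a b : ℝ} (ha : a ∈ Set.Icc (0 : ℝ) 1) (hb : b ∈ Set.Icc (0 : ℝ) 1) :
    Real.exp ((a - 2 * b) / 3) + Real.exp ((b - 2 * a) / 3) ≤ 2 := by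
  have h1 : Real.exp ((a - 2 * b) / 3) + Real.exp ((b - 2 * a) / 3) =
      2 * (Real.exp (-(a + b) / 6) * Real.cosh ((a - b) / 2)) := by
    rw [Real.cosh_eq]
    have e1 : (a - 2 * b) / 3 = -(a + b) / 6 + (a - b) / 2 := by ring
    have e2 : (b - 2 * a) / 3 = -(a + b) / 6 + -((a - b) / 2) := by ring
    rw [e1, e2, Real.exp_add, Real.exp_add]
    ring
  have h2 : Real.exp (-(a + b) / 6) * Real.cosh ((a - b) / 2) ≤ 1 := by
    calc Real.exp (-(a + b) / 6) * Real.cosh ((a - b) / 2)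
        ≤ Real.exp (-(a + b) / 6) * Real.exp (((a - b) / 2) ^ 2 / 2) := by
          gcongr; exact Real.cosh_le_exp_half_sq _
      _ = Real.exp (-(a + b) / 6 + ((a - b) / 2) ^ 2 / 2) := by rw [Real.exp_add]
      _ ≤ 1 := by
          rw [Real.exp_le_one_iff]
          nlinarith [ha.1, ha.2, hb.1, hb.2, mul_nonneg ha.1 hb.1,
            mul_nonneg ha.1 (sub_nonneg.2 ha.2), mul_nonneg hb.1 (sub_nonneg.2 hb.2)]
  linarith

section TwoSample

variable {X : Type u} {n : ℕ}

/-- The exponent of the comparison between two samples. -/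
def pairExponent (f g : X → ℝ) (z : Fin n → X × X) : ℝ :=
  ∑ i, (|f (z i).1 - g (z i).1| - 2 * |f (z i).2 - g (z i).2|) / 3

/-- Swap the pairs that are marked by `s`. -/
def swapPairs (s : Fin n → Bool) (z : Fin n → X × X) (i : Fin n) : X × X :=
  if s i then (z i).swap else z i

theorem abs_sub_mem_Icc {a b : ℝ} (ha : a ∈ Set.Icc (0 : ℝ) 1) (hb : b ∈ Set.Icc (0 : ℝ) 1) :
    |a - b| ∈ Set.Icc (0 : ℝ) 1 :=
  ⟨abs_nonneg _, abs_le.2 ⟨by linarith [ha.1, hb.2], by linarith [ha.2, hb.1]⟩⟩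

/-- The sum over all swaps factorizes over the pairs, and each factor is at most `2`. -/
theorem sum_exp_pairExponent_le {f g : X → ℝ} (hf : ∀ x, f x ∈ Set.Icc (0 : ℝ) 1)
    (hg : ∀ x, g x ∈ Set.Icc (0 : ℝ) 1) (z : Fin n → X × X) :
    ∑ s : Fin n → Bool, Real.exp (pairExponent f g (swapPairs s z)) ≤ 2 ^ n := by
  set e : Fin n → Bool → ℝ := fun i b => Real.exp
    (if b then (|f (z i).2 - g (z i).2| - 2 * |f (z i).1 - g (z i).1|) / 3
    else (|f (z i).1 - g (z i).1| - 2 * |f (z i).2 - g (z i).2|) / 3) with he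
  have h1 : ∀ s : Fin n → Bool, Real.exp (pairExponent f g (swapPairs s z)) = ∏ i, e i (s i) := by
    intro s
    rw [pairExponent, Real.exp_sum]
    refine Finset.prod_congr rfl fun i _ => ?_
    cases h : s i <;> simp [swapPairs, h, he]
  have h2 := Finset.prod_univ_sum (fun _ : Fin n => (Finset.univ : Finset Bool)) e
  rw [Fintype.piFinset_univ] at h2
  simp_rw [h1]
  rw [← h2]
  calc _ ≤ ∏ _i : Fin n, (2 : ℝ) := by
        refine Finset.prod_le_prod (fun i _ => Finset.sum_nonneg fun b _ => (Real.exp_pos _).le)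
          fun i _ => ?_
        rw [Fintype.sum_bool]
        simp only [he, if_true, Bool.false_eq_true, if_false]
        rw [add_comm]
        exact exp_two_sample (abs_sub_mem_Icc (hf _) (hg _)) (abs_sub_mem_Icc (hf _) (hg _))
    _ = 2 ^ n := by simp

/-- Each distance moves by at most `2 / n`, so each summand moves by at most `(2 + 4) / (3 n) = 2 /
n`. -/
theorem pairExponent_le_of_close (hn : 0 < n) {f g f' g' : X → ℝ} (z : Fin n → X × X)
    (hf : ∀ i, |f (z i).1 - f' (z i).1| ≤ 1 / n ∧ |f (z i).2 - f' (z i).2| ≤ 1 / n)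
    (hg : ∀ i, |g (z i).1 - g' (z i).1| ≤ 1 / n ∧ |g (z i).2 - g' (z i).2| ≤ 1 / n) :
    pairExponent f g z ≤ pairExponent f' g' z + 2 := by
  have hn' : (0 : ℝ) < n := by exact_mod_cast hn
  have hab : ∀ a b a' b' r : ℝ, |a - a'| ≤ r → |b - b'| ≤ r → |(|a - b| - |a' - b'|)| ≤ 2 * r := by
    intro a b a' b' r h1 h2
    calc |(|a - b| - |a' - b'|)| ≤ |(a - b) - (a' - b')| := abs_abs_sub_abs_le_abs_sub _ _
      _ = |(a - a') - (b - b')| := by ring_nf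
      _ ≤ |a - a'| + |b - b'| := abs_sub _ _
      _ ≤ 2 * r := by linarith
  have : pairExponent f' g' z + 2 = ∑ i : Fin n,
      ((|f' (z i).1 - g' (z i).1| - 2 * |f' (z i).2 - g' (z i).2|) / 3 + 2 * (1 / n)) := by
    rw [Finset.sum_add_distrib, pairExponent]
    congr 1
    simp
    field_simp
  rw [this, pairExponent]
  refine Finset.sum_le_sum fun i _ => ?_
  have h1 := abs_le.1 (hab _ _ _ _ _ (hf i).1 (hg i).1)
  have h2 := abs_le.1 (hab _ _ _ _ _ (hf i).2 (hg i).2)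
  linarith [h1.2, h2.1]

/-- Swapping does not change the set of `2 n` sample points, so one grid cover serves all swaps. It
turns the supremum into a sum over pairs of cover elements, at the price of the factor `exp 2`. -/
theorem sum_iSup_pairExponent_le {G : Set (X → ℝ)} {d : ℕ} (hd : pdim G ≤ d)
    (hG : ∀ f ∈ G, ∀ x, f x ∈ Set.Icc (0 : ℝ) 1) (hn : 0 < n) (z : Fin n → X × X) :
    ∑ s : Fin n → Bool, ⨆ q : G × G,
        ENNReal.ofReal (Real.exp (pairExponent q.1.1 q.2.1 (swapPairs s z))) ≤
      2 ^ n * ENNReal.ofReal (((2 * n * n + 1 : ℕ) ^ d : ℝ) ^ 2 * Real.exp 2) := by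
  classical
  obtain ⟨K, hKG, hKc, hK⟩ := exists_grid_cover hd hG
    (fun a : Fin n × Bool => if a.2 then (z a.1).1 else (z a.1).2) hn
  have hclose : ∀ f ∈ G, ∃ k ∈ K, ∀ (s : Fin n → Bool) i,
      |f (swapPairs s z i).1 - k (swapPairs s z i).1| ≤ 1 / n ∧
      |f (swapPairs s z i).2 - k (swapPairs s z i).2| ≤ 1 / n := by
    intro f hf
    obtain ⟨k, hk, h⟩ := hK f hf
    refine ⟨k, hk, fun s i => ?_⟩
    have h1 := h (i, true)
    have h2 := h (i, false)
    simp only [if_true, Bool.false_eq_true, if_false] at h1 h2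
    unfold swapPairs
    split_ifs
    · exact ⟨h2, h1⟩
    · exact ⟨h1, h2⟩
  have hsup : ∀ s : Fin n → Bool, ⨆ q : G × G,
        ENNReal.ofReal (Real.exp (pairExponent q.1.1 q.2.1 (swapPairs s z))) ≤
      ENNReal.ofReal (∑ q ∈ K ×ˢ K,
        Real.exp 2 * Real.exp (pairExponent q.1 q.2 (swapPairs s z))) := by
    intro s
    refine iSup_le fun q => ENNReal.ofReal_le_ofReal ?_
    obtain ⟨k, hk, hk'⟩ := hclose q.1.1 q.1.2
    obtain ⟨l, hl, hl'⟩ := hclose q.2.1 q.2.2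
    have h1 : Real.exp (pairExponent q.1.1 q.2.1 (swapPairs s z)) ≤
        Real.exp 2 * Real.exp (pairExponent k l (swapPairs s z)) := by
      rw [← Real.exp_add, Real.exp_le_exp, add_comm]
      exact pairExponent_le_of_close hn _ (hk' s) (hl' s)
    have hmem : (k, l) ∈ K ×ˢ K := by rw [Finset.mem_product]; exact ⟨hk, hl⟩
    refine h1.trans ?_
    have h2 : ∀ T : (X → ℝ) × (X → ℝ) → ℝ, (∀ q, 0 ≤ T q) → T (k, l) ≤ ∑ q ∈ K ×ˢ K, T q :=
      fun T hT => Finset.single_le_sum (fun q _ => hT q) hmem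
    exact h2 (fun q => Real.exp 2 * Real.exp (pairExponent q.1 q.2 (swapPairs s z)))
      fun q => mul_nonneg (Real.exp_pos _).le (Real.exp_pos _).le
  have hKr : (K.card : ℝ) ≤ ((2 * n * n + 1 : ℕ) ^ d : ℝ) := by
    have h : K.card ≤ (2 * n * n + 1) ^ d := by
      simpa [mul_comm, mul_left_comm, mul_assoc] using hKc
    exact_mod_cast h
  refine (Finset.sum_le_sum fun s _ => hsup s).trans ?_
  rw [← ENNReal.ofReal_sum_of_nonneg
    (fun s _ => Finset.sum_nonneg fun q _ => by positivity), Finset.sum_comm]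
  simp_rw [← Finset.mul_sum]
  have h2 : (2 : ℝ≥0∞) ^ n = ENNReal.ofReal (2 ^ n) := by
    rw [ENNReal.ofReal_pow (by norm_num)]; simp
  rw [h2, ← ENNReal.ofReal_mul (by positivity)]
  refine ENNReal.ofReal_le_ofReal ?_
  have h3 : ∑ q ∈ K ×ˢ K, ∑ s : Fin n → Bool, Real.exp (pairExponent q.1 q.2 (swapPairs s z)) ≤
      (K.card : ℝ) ^ 2 * 2 ^ n := by
    calc _ ≤ ∑ _q ∈ K ×ˢ K, (2 : ℝ) ^ n := by
          refine Finset.sum_le_sum fun q hq => ?_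
          rw [Finset.mem_product] at hq
          exact sum_exp_pairExponent_le (hG _ (hKG hq.1)) (hG _ (hKG hq.2)) z
      _ = (K.card : ℝ) ^ 2 * 2 ^ n := by
          rw [Finset.sum_const, Finset.card_product, nsmul_eq_mul]; push_cast; ring
  calc _ ≤ Real.exp 2 * ((K.card : ℝ) ^ 2 * 2 ^ n) := by gcongr
    _ ≤ Real.exp 2 * ((((2 * n * n + 1 : ℕ) ^ d : ℝ)) ^ 2 * 2 ^ n) := by gcongr
    _ = _ := by ring

variable [MeasurableSpace X]

theorem measurable_pairExponent {f g : X → ℝ} (hf : Measurable f) (hg : Measurable g) :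
    Measurable (pairExponent (n := n) f g) := by
  unfold pairExponent
  refine Finset.measurable_sum _ fun i _ => ?_
  have h1 : Measurable fun z : Fin n → X × X => |f (z i).1 - g (z i).1| :=
    ((hf.comp (by fun_prop)).sub (hg.comp (by fun_prop))).abs
  have h2 : Measurable fun z : Fin n → X × X => |f (z i).2 - g (z i).2| :=
    ((hf.comp (by fun_prop)).sub (hg.comp (by fun_prop))).abs
  exact (h1.sub (h2.const_mul 2)).div_const 3

theorem measurePreserving_swapPairs (D : Measure X) [IsProbabilityMeasure D] (s : Fin n → Bool) :
    MeasurePreserving (swapPairs (X := X) s) (Measure.pi fun _ => D.prod D)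
      (Measure.pi fun _ => D.prod D) := by
  refine measurePreserving_pi _ _ (f := fun i (z : X × X) => if s i then z.swap else z) fun i => ?_
  cases s i
  · exact MeasurePreserving.id _
  · exact Measure.measurePreserving_swap

/-- Symmetrization: the law of independent pairs is invariant under every swap, so the integral
equals its average over swaps, which is bounded pointwise. -/
theorem lintegral_iSup_pairExponent_le (D : Measure X) [IsProbabilityMeasure D]
    {G : Set (X → ℝ)} (hc : G.Countable) (hm : ∀ f ∈ G, Measurable f) {d : ℕ} (hd : pdim G ≤ d)
    (hG : ∀ f ∈ G, ∀ x, f x ∈ Set.Icc (0 : ℝ) 1) (hn : 0 < n) :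
    ∫⁻ z, ⨆ q : G × G, ENNReal.ofReal (Real.exp (pairExponent q.1.1 q.2.1 z))
        ∂(Measure.pi fun _ : Fin n => D.prod D) ≤
      ENNReal.ofReal (((2 * n * n + 1 : ℕ) ^ d : ℝ) ^ 2 * Real.exp 2) := by
  have : Countable G := hc
  set μ := Measure.pi fun _ : Fin n => D.prod D
  set Φ : (Fin n → X × X) → ℝ≥0∞ := fun z =>
    ⨆ q : G × G, ENNReal.ofReal (Real.exp (pairExponent q.1.1 q.2.1 z)) with hΦ
  have hΦm : Measurable Φ := Measurable.iSup fun q =>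
    (measurable_pairExponent (hm _ q.1.2) (hm _ q.2.2)).exp.ennreal_ofReal
  have h1 : (2 : ℝ≥0∞) ^ n * ∫⁻ z, Φ z ∂μ = ∫⁻ z, ∑ s : Fin n → Bool, Φ (swapPairs s z) ∂μ := by
    have hcomp : ∀ s : Fin n → Bool, Measurable fun z => Φ (swapPairs s z) := fun s =>
      hΦm.comp (measurePreserving_swapPairs D s).measurable
    rw [lintegral_finsetSum _ (fun s _ => hcomp s)]
    have : ∀ s : Fin n → Bool, ∫⁻ z, Φ (swapPairs s z) ∂μ = ∫⁻ z, Φ z ∂μ := fun s =>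
      (measurePreserving_swapPairs D s).lintegral_comp hΦm
    simp_rw [this]
    simp
  have h2 : (2 : ℝ≥0∞) ^ n * ∫⁻ z, Φ z ∂μ ≤
      2 ^ n * ENNReal.ofReal (((2 * n * n + 1 : ℕ) ^ d : ℝ) ^ 2 * Real.exp 2) := by
    rw [h1]
    calc _ ≤ ∫⁻ _, 2 ^ n * ENNReal.ofReal (((2 * n * n + 1 : ℕ) ^ d : ℝ) ^ 2 * Real.exp 2) ∂μ :=
          lintegral_mono fun z => sum_iSup_pairExponent_le hd hG hn z
      _ = _ := by simp
  exact (ENNReal.mul_le_mul_iff_right (by simp) (by simp)).1 h2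

/-- A finite subset of `G` and a projection onto it that is close in `L¹(D)` and, with high
probability, close in `L¹` of a sample. -/
theorem exists_sample_cover (D : Measure X) [IsProbabilityMeasure D]
    {G : Set (X → ℝ)} (hc : G.Countable) (hm : ∀ f ∈ G, Measurable f) {d : ℕ} (hd : pdim G ≤ d)
    (hG : ∀ f ∈ G, ∀ x, f x ∈ Set.Icc (0 : ℝ) 1) (hn : 0 < n) :
    ∃ (K : Finset (X → ℝ)) (π : (X → ℝ) → X → ℝ), ↑K ⊆ G ∧ K.card ≤ (n * n + 1) ^ d ∧
      (∀ f ∈ G, π f ∈ K ∧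
        n * ∫ x, |f x - π f x| ∂D ≤ 8 + 6 * (d * Real.log (2 * n * n + 1))) ∧
      ∀ δ : ℝ, 0 < δ → (Measure.pi fun _ : Fin n => D)
        {x | ∃ f ∈ G, 8 + 6 * (d * Real.log (2 * n * n + 1)) + 3 * Real.log (1 / δ) <
          ∑ i, |f (x i) - π f (x i)|} ≤ ENNReal.ofReal δ := by
  classical
  have : Countable G := hc
  have hn' : (0 : ℝ) < n := by exact_mod_cast hn
  set ν := Measure.pi fun _ : Fin n => D
  set E : ℝ := ((2 * n * n + 1 : ℕ) ^ d : ℝ) ^ 2 * Real.exp 2 with hE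
  have hEpos : 0 < E := by positivity
  have hlogE : Real.log E = 2 * (d * Real.log (2 * n * n + 1)) + 2 := by
    rw [hE, Real.log_mul (by positivity) (by positivity), Real.log_exp, Real.log_pow, Real.log_pow]
    push_cast; ring
  set Ψ : (Fin n → X) × (Fin n → X) → ℝ≥0∞ := fun w =>
    ⨆ q : G × G, ENNReal.ofReal (Real.exp (pairExponent q.1.1 q.2.1 fun i => (w.2 i, w.1 i))) with hΨ
  have hΨm : Measurable Ψ := Measurable.iSup fun q => by
    have h : Measurable fun w : (Fin n → X) × (Fin n → X) => fun i => (w.2 i, w.1 i) := by fun_prop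
    exact ((measurable_pairExponent (hm _ q.1.2) (hm _ q.2.2)).comp h).exp.ennreal_ofReal
  have hint : ∫⁻ y, ∫⁻ x, Ψ (y, x) ∂ν ∂ν ≤ ENNReal.ofReal E := by
    rw [← lintegral_prod _ hΨm.aemeasurable]
    refine le_trans (le_of_eq ?_) (lintegral_iSup_pairExponent_le D hc hm hd hG hn)
    have hmp := (measurePreserving_arrowProdEquivProdArrow X X (Fin n) (fun _ => D) (fun _ => D))
    rw [← hmp.lintegral_comp (f := fun w => Ψ w) hΨm]
    -- Swapping every pair makes the ghost sample the second coordinate, the one with the doubled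
    -- negative weight.
    rw [← (measurePreserving_swapPairs D (n := n) fun _ => true).lintegral_comp
      (f := fun z => ⨆ q : G × G, ENNReal.ofReal (Real.exp (pairExponent q.1.1 q.2.1 z)))
      (Measurable.iSup fun q =>
        (measurable_pairExponent (hm _ q.1.2) (hm _ q.2.2)).exp.ennreal_ofReal)]
    rfl
  -- Fixing one good ghost sample makes the cover deterministic, which permits a union bound in the
  -- adaptive setting.
  obtain ⟨y, hy⟩ : ∃ y, ∫⁻ x, Ψ (y, x) ∂ν ≤ ENNReal.ofReal E := by
    obtain ⟨y, hy⟩ := exists_le_lintegral (μ := ν) (f := fun y => ∫⁻ x, Ψ (y, x) ∂ν)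
      (hΨm.lintegral_prod_right').aemeasurable
    exact ⟨y, hy.trans hint⟩
  obtain ⟨K, hKG, hKc, hK⟩ := exists_grid_cover hd hG y hn
  choose! π hπK hπ using hK
  have hsum : ∀ f ∈ G, ∑ i, |f (y i) - π f (y i)| ≤ 1 := by
    intro f hf
    calc ∑ i, |f (y i) - π f (y i)| ≤ ∑ _i : Fin n, 1 / (n : ℝ) :=
          Finset.sum_le_sum fun i _ => hπ f hf i
      _ = 1 := by simp; field_simp
  have hexp : ∀ f ∈ G, ∀ x : Fin n → X,
      ENNReal.ofReal (Real.exp ((∑ i, |f (x i) - π f (x i)| - 2) / 3)) ≤ Ψ (y, x) := by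
    intro f hf x
    refine le_trans (ENNReal.ofReal_le_ofReal (Real.exp_le_exp.2 ?_))
      (le_iSup (fun q : G × G => ENNReal.ofReal
        (Real.exp (pairExponent q.1.1 q.2.1 fun i => (x i, y i))))
        (⟨f, hf⟩, ⟨π f, hKG (hπK f hf)⟩))
    have : pairExponent f (π f) (fun i => (x i, y i)) =
        (∑ i, |f (x i) - π f (x i)| - 2 * ∑ i, |f (y i) - π f (y i)|) / 3 := by
      rw [pairExponent, ← Finset.sum_div, Finset.sum_sub_distrib, Finset.mul_sum]
    rw [this]
    linarith [hsum f hf]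
  refine ⟨K, π, hKG, by simpa using hKc, fun f hf => ⟨hπK f hf, ?_⟩, fun δ hδ => ?_⟩
  · have hmeas : Measurable fun x => |f x - π f x| := ((hm f hf).sub (hm _ (hKG (hπK f hf)))).abs
    have hb : ∀ x, |f x - π f x| ∈ Set.Icc (0 : ℝ) 1 := fun x =>
      abs_sub_mem_Icc (hG f hf x) (hG _ (hKG (hπK f hf)) x)
    have hmi : ∀ i : Fin n, Measurable fun x : Fin n → X => |f (x i) - π f (x i)| := fun i =>
      hmeas.comp (measurable_pi_apply i)
    have hIi : ∀ i : Fin n, Integrable (fun x : Fin n → X => |f (x i) - π f (x i)|) ν := fun i =>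
      Integrable.of_bound (hmi i).aestronglyMeasurable 1 (ae_of_all _ fun x => by
        rw [Real.norm_eq_abs, abs_abs]; exact (hb _).2)
    set Y : (Fin n → X) → ℝ := fun x => (∑ i, |f (x i) - π f (x i)| - 2) / 3 with hY
    have hYm : Measurable Y := ((Finset.measurable_sum _ fun i _ => hmi i).sub_const 2).div_const 3
    have hYb : ∀ x, Y x ≤ n := by
      intro x
      have : ∑ i, |f (x i) - π f (x i)| ≤ ∑ _i : Fin n, (1 : ℝ) :=
        Finset.sum_le_sum fun i _ => (hb _).2
      simp only [Finset.sum_const, Finset.card_univ, Fintype.card_fin, nsmul_eq_mul, mul_one] at this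
      rw [hY]
      simp only
      linarith
    have hYI : Integrable Y ν := ((integrable_finsetSum _ fun i _ => hIi i).sub
      (integrable_const 2)).div_const 3
    have hexpI : Integrable (fun x => Real.exp (Y x)) ν :=
      Integrable.of_bound hYm.exp.aestronglyMeasurable (Real.exp n) (ae_of_all _ fun x => by
        rw [Real.norm_eq_abs, Real.abs_exp, Real.exp_le_exp]; exact hYb x)
    -- By Jensen's inequality the exponential moment that controls the sample distance also controls
    -- the distance in `L¹(D)`.
    have hJ : Real.exp (∫ x, Y x ∂ν) ≤ ∫ x, Real.exp (Y x) ∂ν :=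
      convexOn_exp.map_integral_le Real.continuous_exp.continuousOn isClosed_univ
        (ae_of_all _ fun _ => Set.mem_univ _) hYI hexpI
    have hYint : ∫ x, Y x ∂ν = (n * ∫ x, |f x - π f x| ∂D - 2) / 3 := by
      rw [hY, integral_div, integral_sub (integrable_finsetSum _ fun i _ => hIi i)
        (integrable_const 2), integral_finsetSum _ fun i _ => hIi i]
      have : ∀ i : Fin n, ∫ x : Fin n → X, |f (x i) - π f (x i)| ∂ν = ∫ x, |f x - π f x| ∂D := by
        intro i
        exact integral_comp_eval (μ := fun _ : Fin n => D) (i := i)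
          hmeas.aestronglyMeasurable
      simp [this]
    have hle : ∫ x, Real.exp (Y x) ∂ν ≤ E := by
      rw [← ENNReal.ofReal_le_ofReal_iff hEpos.le,
        ofReal_integral_eq_lintegral_ofReal hexpI (ae_of_all _ fun _ => (Real.exp_pos _).le)]
      exact (lintegral_mono fun x => hexp f hf x).trans hy
    have h3 := (Real.le_log_iff_exp_le hEpos).2 (hJ.trans hle)
    rw [hYint, hlogE] at h3
    linarith
  · have hsub : {x | ∃ f ∈ G, 8 + 6 * (d * Real.log (2 * n * n + 1)) + 3 * Real.log (1 / δ) <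
          ∑ i, |f (x i) - π f (x i)|} ⊆ {x | ENNReal.ofReal (E / δ) ≤ Ψ (y, x)} := by
      rintro x ⟨f, hf, hlt⟩
      refine le_trans (ENNReal.ofReal_le_ofReal ?_) (hexp f hf x)
      rw [← Real.log_le_iff_le_exp (by positivity), Real.log_div hEpos.ne' hδ.ne', hlogE]
      rw [one_div, Real.log_inv] at hlt
      linarith
    refine (measure_mono hsub).trans ?_
    refine (meas_ge_le_lintegral_div (hΨm.comp measurable_prodMk_left).aemeasurable
      (by simpa using div_pos hEpos hδ) ENNReal.ofReal_ne_top).trans ?_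
    rw [ENNReal.ofReal_div_of_pos hδ]
    refine ENNReal.div_le_of_le_mul ?_
    refine hy.trans (le_of_eq ?_)
    rw [ENNReal.mul_div_cancel (by simpa using hδ) ENNReal.ofReal_ne_top]

end TwoSample

/-! ### Adaptive exponential tail bounds -/

section Adaptive

variable {Z : Type*} [MeasurableSpace Z] (P : Measure Z) [IsProbabilityMeasure P]

/-- Resampling one coordinate preserves the product law; this replaces conditional expectation given
the past. -/
theorem measurePreserving_update (t : ℕ) :
    MeasurePreserving (fun q : (ℕ → Z) × Z => Function.update q.1 t q.2)
      ((Measure.infinitePi fun _ : ℕ => P).prod P) (Measure.infinitePi fun _ : ℕ => P) := by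
  have hm : Measurable fun q : (ℕ → Z) × Z => Function.update q.1 t q.2 := by
    refine measurable_pi_lambda _ fun i => ?_
    by_cases h : i = t
    · subst h; simpa using measurable_snd
    · simp only [Function.update_of_ne h]; fun_prop
  refine ⟨hm, Measure.eq_infinitePi _ fun s A hA => ?_⟩
  rw [Measure.map_apply hm (MeasurableSet.pi s.countable_toSet fun i _ => hA i)]
  have : (fun q : (ℕ → Z) × Z => Function.update q.1 t q.2) ⁻¹' (Set.pi ↑s A) =
      (Set.pi ↑(s.erase t) A) ×ˢ (if t ∈ s then A t else Set.univ) := by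
    ext ⟨ω, z⟩
    simp only [Set.mem_preimage, Set.mem_pi, Finset.mem_coe, Set.mem_prod, Finset.mem_erase]
    constructor
    · intro h
      refine ⟨fun i hi => by simpa [Function.update_of_ne hi.1] using h i hi.2, ?_⟩
      split_ifs with ht
      · simpa using h t ht
      · trivial
    · rintro ⟨h1, h2⟩ i hi
      by_cases hit : i = t
      · subst hit
        rw [if_pos hi] at h2
        simpa using h2
      · simpa [Function.update_of_ne hit] using h1 i ⟨hit, hi⟩
  rw [this, Measure.prod_prod, Measure.infinitePi_pi _ fun i _ => hA i]
  split_ifs with ht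
  · rw [mul_comm, Finset.mul_prod_erase s (fun i => P (A i)) ht]
  · rw [measure_univ, mul_one, Finset.erase_eq_of_notMem ht]

/-- Resample the last coordinate: earlier factors do not see it, and by non-anticipation the last
factor is integrated over a fresh point with its past fixed, which contributes at most `1`. -/
theorem lintegral_adaptive_prod_le {g : ℕ → (ℕ → Z) → Z → ℝ≥0∞}
    (hm : ∀ t, Measurable (Function.uncurry (g t)))
    (hdep : ∀ t ω ω', (∀ s < t, ω s = ω' s) → g t ω = g t ω')
    (hle : ∀ t ω, ∫⁻ z, g t ω z ∂P ≤ 1) (a e : ℕ) :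
    ∫⁻ ω, ∏ t ∈ Finset.Ico a e, g t ω (ω t) ∂(Measure.infinitePi fun _ : ℕ => P) ≤ 1 := by
  set μ := Measure.infinitePi fun _ : ℕ => P
  have hg : ∀ t, Measurable fun ω : ℕ → Z => g t ω (ω t) := fun t =>
    (hm t).comp (measurable_id.prodMk (measurable_pi_apply t))
  induction e with
  | zero => simp
  | succ e ih =>
    by_cases hae : a ≤ e
    · simp_rw [Finset.prod_Ico_succ_top hae]
      have hmeas : Measurable fun ω : ℕ → Z =>
          (∏ t ∈ Finset.Ico a e, g t ω (ω t)) * g e ω (ω e) :=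
        (Finset.measurable_prod _ fun t _ => hg t).mul (hg e)
      have hmeas' : Measurable fun q : (ℕ → Z) × Z =>
          (∏ t ∈ Finset.Ico a e, g t (Function.update q.1 e q.2) (Function.update q.1 e q.2 t)) *
            g e (Function.update q.1 e q.2) (Function.update q.1 e q.2 e) :=
        hmeas.comp (measurePreserving_update P e).measurable
      rw [← (measurePreserving_update P e).lintegral_comp hmeas,
        lintegral_prod _ hmeas'.aemeasurable]
      refine le_trans (lintegral_mono fun ω => ?_) ih
      have h1 : ∀ z, (∏ t ∈ Finset.Ico a e, g t (Function.update ω e z) (Function.update ω e z t)) *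
          g e (Function.update ω e z) (Function.update ω e z e) =
          (∏ t ∈ Finset.Ico a e, g t ω (ω t)) * g e ω z := by
        intro z
        rw [Function.update_self, hdep e (Function.update ω e z) ω fun s hs =>
          Function.update_of_ne hs.ne _ _]
        congr 1
        refine Finset.prod_congr rfl fun t ht => ?_
        have hte := (Finset.mem_Ico.1 ht).2
        rw [Function.update_of_ne hte.ne, hdep t (Function.update ω e z) ω fun s hs =>
          Function.update_of_ne (hs.trans hte).ne _ _]
      simp_rw [h1]
      have hge : Measurable (g e ω) := (hm e).comp measurable_prodMk_left
      rw [lintegral_const_mul _ hge]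
      calc _ ≤ (∏ t ∈ Finset.Ico a e, g t ω (ω t)) * 1 := by gcongr; exact hle e ω
        _ = _ := mul_one _
    · rw [Finset.Ico_eq_empty (by omega)]
      simp

/-- Markov's inequality for the product of the exponentials. -/
theorem adaptive_tail {h : ℕ → (ℕ → Z) → Z → ℝ} (hm : ∀ t, Measurable (Function.uncurry (h t)))
    (hdep : ∀ t ω ω', (∀ s < t, ω s = ω' s) → h t ω = h t ω')
    (hle : ∀ t ω, ∫⁻ z, ENNReal.ofReal (Real.exp (h t ω z)) ∂P ≤ 1) (a e : ℕ) {δ : ℝ} (hδ : 0 < δ) :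
    (Measure.infinitePi fun _ : ℕ => P)
      {ω | Real.log (1 / δ) < ∑ t ∈ Finset.Ico a e, h t ω (ω t)} ≤ ENNReal.ofReal δ := by
  have h1 := lintegral_adaptive_prod_le P (g := fun t ω z => ENNReal.ofReal (Real.exp (h t ω z)))
    (fun t => (hm t).exp.ennreal_ofReal)
    (fun t ω ω' hω => by simp only [hdep t ω ω' hω]) hle a e
  have hmeas : Measurable fun ω : ℕ → Z =>
      ∏ t ∈ Finset.Ico a e, ENNReal.ofReal (Real.exp (h t ω (ω t))) :=
    Finset.measurable_prod _ fun t _ =>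
      ((hm t).comp (measurable_id.prodMk (measurable_pi_apply t))).exp.ennreal_ofReal
  have hsub : {ω | Real.log (1 / δ) < ∑ t ∈ Finset.Ico a e, h t ω (ω t)} ⊆
      {ω | ENNReal.ofReal (1 / δ) ≤
        ∏ t ∈ Finset.Ico a e, ENNReal.ofReal (Real.exp (h t ω (ω t)))} := by
    intro ω hω
    rw [Set.mem_ofPred_eq] at hω ⊢
    rw [← ENNReal.ofReal_prod_of_nonneg fun t _ => (Real.exp_pos _).le, ← Real.exp_sum]
    exact ENNReal.ofReal_le_ofReal ((Real.log_le_iff_le_exp (by positivity)).1 hω.le)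
  refine (measure_mono hsub).trans ((meas_ge_le_lintegral_div hmeas.aemeasurable
    (by simpa using hδ) ENNReal.ofReal_ne_top).trans ?_)
  calc _ ≤ 1 / ENNReal.ofReal (1 / δ) := by gcongr
    _ = ENNReal.ofReal δ := by
      rw [one_div, one_div, ENNReal.ofReal_inv_of_pos hδ, inv_inv]

end Adaptive

/-! ### Expectations under a joint law -/

/-- The indicator of a Boolean. -/
def ind (b : Bool) : ℝ := if b then 1 else 0

theorem ind_mem_Icc (b : Bool) : ind b ∈ Set.Icc (0 : ℝ) 1 := by
  cases b <;> simp [ind]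

theorem measurable_ind : Measurable ind := measurable_of_countable _

theorem labelVal_mem (y : Bool) : labelVal y = 0 ∨ labelVal y = 1 := by
  cases y <;> simp [labelVal]

theorem integrable_of_mem_Icc {Ω : Type*} [MeasurableSpace Ω] (D : Measure Ω) [IsFiniteMeasure D]
    {h : Ω → ℝ} (hm : Measurable h) {c : ℝ} (hb : ∀ x, |h x| ≤ c) : Integrable h D :=
  Integrable.of_bound hm.aestronglyMeasurable c (ae_of_all _ hb)

section Law

variable {X : Type u} [MeasurableSpace X] {P : Measure (X × Bool)} [IsProbabilityMeasure P]
  {η : X → ℝ}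

omit [IsProbabilityMeasure P] in
theorem integral_mul_labelVal (hη : IsCondProb P η) {h : X → ℝ} (hm : Measurable h) :
    ∫ z, h z.1 * labelVal z.2 ∂P = ∫ x, h x * η x ∂P.fst := by
  have hA : MeasurableSet {z : X × Bool | z.2 = true} :=
    measurable_snd (measurableSet_singleton true)
  have h1 : (fun z : X × Bool => h z.1 * labelVal z.2) =
      {z : X × Bool | z.2 = true}.indicator fun z => h z.1 := by
    ext1 ⟨x, y⟩
    cases y <;> simp [labelVal]
  rw [h1, integral_indicator hA]
  have hmap : (P.restrict {z : X × Bool | z.2 = true}).map Prod.fst =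
      P.fst.withDensity fun x => ENNReal.ofReal (η x) := by
    ext B hB
    rw [Measure.map_apply measurable_fst hB, Measure.restrict_apply (measurable_fst hB),
      withDensity_apply _ hB, ← hη.law B hB]
    rfl
  have h2 : ∫ z in {z : X × Bool | z.2 = true}, h z.1 ∂P =
      ∫ x, h x ∂((P.restrict {z : X × Bool | z.2 = true}).map Prod.fst) :=
    (integral_map measurable_fst.aemeasurable hm.aestronglyMeasurable).symm
  rw [h2, hmap, integral_withDensity_eq_integral_toReal_smul hη.measurable.ennreal_ofReal
    (ae_of_all _ fun _ => ENNReal.ofReal_lt_top)]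
  refine integral_congr_ae (ae_of_all _ fun x => ?_)
  simp only [ENNReal.toReal_ofReal (hη.range x).1, smul_eq_mul]
  ring

omit [IsProbabilityMeasure P] in
theorem integral_comp_fst {h : X → ℝ} (hm : Measurable h) :
    ∫ z, h z.1 ∂P = ∫ x, h x ∂P.fst :=
  (integral_map measurable_fst.aemeasurable hm.aestronglyMeasurable).symm

/-- Excess square loss of `f` over `f₀` on a queried example. -/
def lossDiff (q : X → Bool) (f f₀ : X → ℝ) (z : X × Bool) : ℝ :=
  ind (q z.1) * ((f z.1 - labelVal z.2) ^ 2 - (f₀ z.1 - labelVal z.2) ^ 2)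

/-- Squared distance of `f` and `f₀` on the queried region. -/
def regionDist (D : Measure X) (q : X → Bool) (f f₀ : X → ℝ) : ℝ :=
  ∫ x, ind (q x) * (f x - f₀ x) ^ 2 ∂D

theorem exp_neg_le {u : ℝ} (hu : |u| ≤ 1) : Real.exp (-u) ≤ 1 - u + u ^ 2 := by
  have h := Real.abs_exp_sub_one_sub_id_le (x := -u) (by rwa [abs_neg])
  have := (abs_le.1 h).2
  nlinarith

/-- The square of the loss difference is at most four times the squared distance of `f` and `f₀`, so
at scale `1 / 16` the second-order term of the exponential is absorbed by the mean. The mean is the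
squared distance up to a cross term in `f₀ - η`, which costs `2 ε²`. -/
theorem lintegral_exp_lossDiff_le (hη : IsCondProb P η) {q : X → Bool} (hq : Measurable q)
    {f f₀ : X → ℝ} (hf : Measurable f) (hf₀ : Measurable f₀)
    (hfr : ∀ x, f x ∈ Set.Icc (0 : ℝ) 1) (hf₀r : ∀ x, f₀ x ∈ Set.Icc (0 : ℝ) 1) {ε : ℝ}
    (hε : ∀ x, |f₀ x - η x| ≤ ε) :
    ∫⁻ z, ENNReal.ofReal (Real.exp
      ((regionDist P.fst q f f₀ / 4 - 2 * ε ^ 2 - lossDiff q f f₀ z) / 16)) ∂P ≤ 1 := by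
  set D := P.fst
  have hqm : Measurable fun x => ind (q x) := measurable_ind.comp hq
  have hM : Measurable (lossDiff q f f₀) := by
    have h1 : Measurable fun z : X × Bool => labelVal z.2 := measurable_labelVal.comp measurable_snd
    exact (hqm.comp measurable_fst).mul (((((hf.comp measurable_fst).sub h1).pow_const 2)).sub
      (((hf₀.comp measurable_fst).sub h1).pow_const 2))
  have hind : ∀ x, ind (q x) = 0 ∨ ind (q x) = 1 := fun x => by
    cases q x <;> simp [ind]
  have hMb : ∀ z, |lossDiff q f f₀ z| ≤ 1 := by
    intro z
    have h1 := hfr z.1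
    have h2 := hf₀r z.1
    unfold lossDiff
    rw [abs_le]
    rcases hind z.1 with h | h <;> rcases labelVal_mem z.2 with h' | h' <;> rw [h, h'] <;>
      constructor <;> nlinarith [h1.1, h1.2, h2.1, h2.2]
  -- This majorant is affine in the label, so its mean is computable. The factor `3 / 4` is `1` from
  -- the loss difference less `4 / 16` from its square.
  set G : X × Bool → ℝ := fun z => 1 + ((-(ind (q z.1) * (f z.1 - f₀ z.1) ^ 2) * (3 / 4)
    - 2 * (ind (q z.1) * (f z.1 - f₀ z.1)) * f₀ z.1) +
    (2 * (ind (q z.1) * (f z.1 - f₀ z.1))) * labelVal z.2) / 16 with hG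
  have hpt : ∀ z, Real.exp (-(lossDiff q f f₀ z / 16)) ≤ G z := by
    intro z
    have h1 := exp_neg_le (u := lossDiff q f f₀ z / 16) (by
      have := abs_le.1 (hMb z); rw [abs_le]; constructor <;> linarith [this.1, this.2])
    refine h1.trans ?_
    have h1 := hfr z.1
    have h2 := hf₀r z.1
    have hkey : (lossDiff q f f₀ z) ^ 2 ≤ 4 * (ind (q z.1) * (f z.1 - f₀ z.1) ^ 2) := by
      have e1 : lossDiff q f f₀ z = ind (q z.1) * ((f z.1 - f₀ z.1) *
        (f z.1 + f₀ z.1 - 2 * labelVal z.2)) := by unfold lossDiff; ring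
      have e2 : (f z.1 + f₀ z.1 - 2 * labelVal z.2) ^ 2 ≤ 4 := by
        have : |f z.1 + f₀ z.1 - 2 * labelVal z.2| ≤ 2 := by
          rw [abs_le]
          rcases labelVal_mem z.2 with h' | h' <;> rw [h'] <;> constructor <;>
            linarith [h1.1, h1.2, h2.1, h2.2]
        calc _ = |f z.1 + f₀ z.1 - 2 * labelVal z.2| ^ 2 := (sq_abs _).symm
          _ ≤ 2 ^ 2 := pow_le_pow_left₀ (abs_nonneg _) this 2
          _ = 4 := by norm_num
      rw [e1]
      rcases hind z.1 with h | h <;> rw [h]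
      · simp
      · simp only [one_mul]
        rw [mul_pow]
        nlinarith [sq_nonneg (f z.1 - f₀ z.1)]
    have e3 : lossDiff q f f₀ z = ind (q z.1) * (f z.1 - f₀ z.1) ^ 2 +
      2 * (ind (q z.1) * (f z.1 - f₀ z.1)) * f₀ z.1 -
      (2 * (ind (q z.1) * (f z.1 - f₀ z.1))) * labelVal z.2 := by unfold lossDiff; ring
    rw [hG]
    simp only
    linarith
  have hm1 : Measurable fun x => -(ind (q x) * (f x - f₀ x) ^ 2) * (3 / 4)
    - 2 * (ind (q x) * (f x - f₀ x)) * f₀ x :=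
    ((hqm.mul ((hf.sub hf₀).pow_const 2)).neg.mul_const _).sub
      (((hqm.mul (hf.sub hf₀)).const_mul 2).mul hf₀)
  have hm2 : Measurable fun x => 2 * (ind (q x) * (f x - f₀ x)) :=
    (hqm.mul (hf.sub hf₀)).const_mul 2
  have habs : ∀ x, |f x - f₀ x| ≤ 1 := fun x => (abs_sub_mem_Icc (hfr x) (hf₀r x)).2
  have hsq : ∀ x, (f x - f₀ x) ^ 2 ≤ 1 := fun x => by
    rw [← sq_abs]; exact pow_le_one₀ (abs_nonneg _) (habs x)
  have hb2 : ∀ x, |2 * (ind (q x) * (f x - f₀ x))| ≤ 2 := fun x => by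
    rw [abs_mul, abs_mul]
    rcases hind x with h | h <;> rw [h] <;> simp
    linarith [habs x]
  have hb1 : ∀ x, |-(ind (q x) * (f x - f₀ x) ^ 2) * (3 / 4)
    - 2 * (ind (q x) * (f x - f₀ x)) * f₀ x| ≤ 3 := fun x => by
    have h3 : |2 * (ind (q x) * (f x - f₀ x)) * f₀ x| ≤ 2 := by
      rw [abs_mul, abs_of_nonneg (hf₀r x).1]
      nlinarith [hb2 x, (hf₀r x).1, (hf₀r x).2, abs_nonneg (2 * (ind (q x) * (f x - f₀ x)))]
    have h4 := abs_le.1 h3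
    rw [abs_le]
    rcases hind x with h | h <;> rw [h] at h4 ⊢ <;> constructor <;>
      nlinarith [hsq x, sq_nonneg (f x - f₀ x), h4.1, h4.2]
  have hb3 : ∀ z : X × Bool, |2 * (ind (q z.1) * (f z.1 - f₀ z.1)) * labelVal z.2| ≤ 2 := fun z => by
    rcases labelVal_mem z.2 with h' | h' <;> rw [h'] <;> simp
    simpa using hb2 z.1
  have hi1 : Integrable (fun z : X × Bool => -(ind (q z.1) * (f z.1 - f₀ z.1) ^ 2) * (3 / 4)
    - 2 * (ind (q z.1) * (f z.1 - f₀ z.1)) * f₀ z.1) P :=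
    integrable_of_mem_Icc P (hm1.comp measurable_fst) fun z => hb1 z.1
  have hi2 : Integrable (fun z : X × Bool =>
      2 * (ind (q z.1) * (f z.1 - f₀ z.1)) * labelVal z.2) P :=
    integrable_of_mem_Icc P ((hm2.comp measurable_fst).mul
      (measurable_labelVal.comp measurable_snd)) hb3
  have hGint : Integrable G P := (integrable_const 1).add ((hi1.add hi2).div_const 16)
  have hηb : ∀ x, |η x| ≤ 1 := fun x => by
    rw [abs_of_nonneg (hη.range x).1]; exact (hη.range x).2
  have hGle : ∫ z, G z ∂P ≤ 1 - (regionDist D q f f₀ / 4 - 2 * ε ^ 2) / 16 := by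
    have hsplit : ∫ z, G z ∂P = ∫ _, (1 : ℝ) ∂P + ∫ z, ((-(ind (q z.1) * (f z.1 - f₀ z.1) ^ 2) *
        (3 / 4) - 2 * (ind (q z.1) * (f z.1 - f₀ z.1)) * f₀ z.1) +
        (2 * (ind (q z.1) * (f z.1 - f₀ z.1))) * labelVal z.2) / 16 ∂P :=
      integral_add (integrable_const 1) ((hi1.add hi2).div_const 16)
    have hfst := integral_comp_fst (P := P) hm1
    rw [hsplit, integral_div, integral_add hi1 hi2, integral_mul_labelVal hη hm2, hfst]
    have hI1 : Integrable (fun x => -(ind (q x) * (f x - f₀ x) ^ 2) * (3 / 4)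
      - 2 * (ind (q x) * (f x - f₀ x)) * f₀ x) D := integrable_of_mem_Icc _ hm1 hb1
    have hI2 : Integrable (fun x => 2 * (ind (q x) * (f x - f₀ x)) * η x) D :=
      integrable_of_mem_Icc (c := 2) _ (hm2.mul hη.measurable) fun x => by
        rw [abs_mul]
        nlinarith [hb2 x, hηb x, abs_nonneg (η x), abs_nonneg (2 * (ind (q x) * (f x - f₀ x)))]
    have hI3 : Integrable (fun x => ind (q x) * (f x - f₀ x) ^ 2) D :=
      integrable_of_mem_Icc (c := 1) _ (hqm.mul ((hf.sub hf₀).pow_const 2)) fun x => by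
        rw [abs_le]
        rcases hind x with h | h <;> rw [h] <;> constructor <;>
          nlinarith [hsq x, sq_nonneg (f x - f₀ x)]
    rw [← integral_add hI1 hI2]
    have hle : ∫ x, (-(ind (q x) * (f x - f₀ x) ^ 2) * (3 / 4)
        - 2 * (ind (q x) * (f x - f₀ x)) * f₀ x) + 2 * (ind (q x) * (f x - f₀ x)) * η x ∂D ≤
        ∫ x, -(1 / 4) * (ind (q x) * (f x - f₀ x) ^ 2) + 2 * ε ^ 2 ∂D := by
      refine integral_mono (hI1.add hI2) ((hI3.const_mul _).add (integrable_const _)) fun x => ?_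
      have h1 : (f₀ x - η x) ^ 2 ≤ ε ^ 2 := by
        rw [← sq_abs]; exact pow_le_pow_left₀ (abs_nonneg _) (hε x) 2
      simp only
      rcases hind x with h | h <;> rw [h]
      · simp; positivity
      -- Half of the squared distance pays for the cross term, leaving `3 / 4 - 1 / 2 = 1 / 4`.
      · nlinarith [sq_nonneg ((f x - f₀ x) + 2 * (f₀ x - η x))]
    rw [integral_add (hI3.const_mul _) (integrable_const _), integral_const_mul] at hle
    simp only [integral_const, probReal_univ, smul_eq_mul, one_mul] at hle ⊢
    unfold regionDist
    linarith
  set e := regionDist D q f f₀ / 4 - 2 * ε ^ 2 with he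
  have hexpint : Integrable (fun z => Real.exp ((e - lossDiff q f f₀ z) / 16)) P :=
    integrable_of_mem_Icc (c := Real.exp ((e + 1) / 16)) P
      ((measurable_const.sub hM).div_const 16).exp fun z => by
        rw [Real.abs_exp, Real.exp_le_exp]
        linarith [(abs_le.1 (hMb z)).1]
  rw [← ofReal_integral_eq_lintegral_ofReal hexpint (ae_of_all _ fun _ => (Real.exp_pos _).le)]
  rw [← ENNReal.ofReal_one]
  refine ENNReal.ofReal_le_ofReal ?_
  have hsplit : ∀ z, Real.exp ((e - lossDiff q f f₀ z) / 16) =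
      Real.exp (e / 16) * Real.exp (-(lossDiff q f f₀ z / 16)) := fun z => by
    rw [← Real.exp_add]; ring_nf
  calc ∫ z, Real.exp ((e - lossDiff q f f₀ z) / 16) ∂P ≤ ∫ z, Real.exp (e / 16) * G z ∂P := by
        refine integral_mono hexpint (hGint.const_mul _) fun z => ?_
        simp only
        rw [hsplit]
        exact mul_le_mul_of_nonneg_left (hpt z) (Real.exp_pos _).le
    _ = Real.exp (e / 16) * ∫ z, G z ∂P := integral_const_mul _ _
    _ ≤ Real.exp (e / 16) * Real.exp (-(e / 16)) := by
        gcongr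
        linarith [Real.add_one_le_exp (-(e / 16))]
    _ = 1 := by rw [← Real.exp_add]; simp

/-- For an indicator `i`, `exp i ≤ 1 + 2 i` because `e ≤ 3`, and `1 + 2 r ≤ exp (2 r)`. -/
theorem lintegral_exp_ind_le {q : X → Bool} (hq : Measurable q) :
    ∫⁻ z, ENNReal.ofReal (Real.exp (ind (q z.1) - 2 * ∫ x, ind (q x) ∂P.fst)) ∂P ≤ 1 := by
  have hqm : Measurable fun x => ind (q x) := measurable_ind.comp hq
  have hqi : Integrable (fun z : X × Bool => ind (q z.1)) P :=
    integrable_of_mem_Icc (c := 1) _ (hqm.comp measurable_fst) fun z => by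
      rw [abs_of_nonneg (ind_mem_Icc _).1]; exact (ind_mem_Icc _).2
  set r := ∫ x, ind (q x) ∂P.fst
  have hr : ∫ z, ind (q z.1) ∂P = r := integral_comp_fst hqm
  have hexpint : Integrable (fun z : X × Bool => Real.exp (ind (q z.1) - 2 * r)) P :=
    integrable_of_mem_Icc (c := Real.exp (1 - 2 * r)) P
      ((hqm.comp measurable_fst).sub_const _).exp fun z => by
        rw [Real.abs_exp, Real.exp_le_exp]
        linarith [(ind_mem_Icc (q z.1)).2]
  rw [← ofReal_integral_eq_lintegral_ofReal hexpint (ae_of_all _ fun _ => (Real.exp_pos _).le),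
    ← ENNReal.ofReal_one]
  refine ENNReal.ofReal_le_ofReal ?_
  calc ∫ z, Real.exp (ind (q z.1) - 2 * r) ∂P
      ≤ ∫ z, Real.exp (-(2 * r)) * (1 + 2 * ind (q z.1)) ∂P := by
        refine integral_mono hexpint (((integrable_const 1).add (hqi.const_mul 2)).const_mul _)
          fun z => ?_
        simp only
        rw [sub_eq_neg_add, Real.exp_add]
        refine mul_le_mul_of_nonneg_left ?_ (Real.exp_pos _).le
        cases q z.1
        · simp [ind]
        · simp only [ind, if_true]
          linarith [Real.exp_one_lt_d9]
    _ = Real.exp (-(2 * r)) * (1 + 2 * r) := by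
        rw [integral_const_mul, integral_add (integrable_const 1) (hqi.const_mul 2),
          integral_const_mul, hr]
        simp
    _ ≤ Real.exp (-(2 * r)) * Real.exp (2 * r) := by
        gcongr
        linarith [Real.add_one_le_exp (2 * r)]
    _ = 1 := by rw [← Real.exp_add]; simp

end Law

/-! ### The good event -/

section GoodEvent

variable {X : Type u} [MeasurableSpace X]

omit [MeasurableSpace X] in
theorem lossDiff_sub_abs_le {f k f₀ : X → ℝ} (hf : ∀ x, f x ∈ Set.Icc (0 : ℝ) 1)
    (hk : ∀ x, k x ∈ Set.Icc (0 : ℝ) 1) (q : X → Bool) (z : X × Bool) :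
    lossDiff q k f₀ z - 2 * |f z.1 - k z.1| ≤ lossDiff q f f₀ z := by
  have h1 := hf z.1
  have h2 := hk z.1
  have e : lossDiff q f f₀ z - lossDiff q k f₀ z =
      ind (q z.1) * ((f z.1 - k z.1) * (f z.1 + k z.1 - 2 * labelVal z.2)) := by
    unfold lossDiff; ring
  have hb : |ind (q z.1) * ((f z.1 - k z.1) * (f z.1 + k z.1 - 2 * labelVal z.2))| ≤
      2 * |f z.1 - k z.1| := by
    rw [abs_mul, abs_mul, abs_of_nonneg (ind_mem_Icc _).1]
    have h3 : |f z.1 + k z.1 - 2 * labelVal z.2| ≤ 2 := by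
      rw [abs_le]
      rcases labelVal_mem z.2 with h' | h' <;> rw [h'] <;> constructor <;>
        linarith [h1.1, h1.2, h2.1, h2.2]
    have h4 := (ind_mem_Icc (q z.1)).2
    calc _ ≤ 1 * (|f z.1 - k z.1| * 2) := by gcongr
      _ = _ := by ring
  linarith [(abs_le.1 hb).1]

theorem integrable_region (D : Measure X) [IsProbabilityMeasure D] {q : X → Bool}
    (hq : Measurable q) {f f₀ : X → ℝ} (hf : Measurable f) (hf₀ : Measurable f₀)
    (hfr : ∀ x, f x ∈ Set.Icc (0 : ℝ) 1) (hf₀r : ∀ x, f₀ x ∈ Set.Icc (0 : ℝ) 1) :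
    Integrable (fun x => ind (q x) * (f x - f₀ x) ^ 2) D := by
  refine integrable_of_mem_Icc (c := 1) _
    ((measurable_ind.comp hq).mul ((hf.sub hf₀).pow_const 2)) fun x => ?_
  have h1 := ind_mem_Icc (q x)
  have h2 : (f x - f₀ x) ^ 2 ≤ 1 := by
    rw [← sq_abs]; exact pow_le_one₀ (abs_nonneg _) (abs_sub_mem_Icc (hfr x) (hf₀r x)).2
  rw [abs_of_nonneg (mul_nonneg h1.1 (sq_nonneg _))]
  nlinarith [h1.1, h1.2, sq_nonneg (f x - f₀ x)]

theorem regionDist_nonneg (D : Measure X) (q : X → Bool) (f f₀ : X → ℝ) :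
    0 ≤ regionDist D q f f₀ :=
  integral_nonneg fun _ => mul_nonneg (ind_mem_Icc _).1 (sq_nonneg _)

theorem regionDist_le (D : Measure X) [IsProbabilityMeasure D] {q : X → Bool} (hq : Measurable q)
    {f k f₀ : X → ℝ} (hf : Measurable f) (hk : Measurable k) (hf₀ : Measurable f₀)
    (hfr : ∀ x, f x ∈ Set.Icc (0 : ℝ) 1) (hkr : ∀ x, k x ∈ Set.Icc (0 : ℝ) 1)
    (hf₀r : ∀ x, f₀ x ∈ Set.Icc (0 : ℝ) 1) :
    regionDist D q f f₀ ≤ 2 * regionDist D q k f₀ + 2 * ∫ x, |f x - k x| ∂D := by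
  have hI1 := integrable_region D hq hk hf₀ hkr hf₀r
  have hI2 : Integrable (fun x => |f x - k x|) D :=
    integrable_of_mem_Icc (c := 1) _ (hf.sub hk).abs fun x => by
      rw [abs_abs]; exact (abs_sub_mem_Icc (hfr x) (hkr x)).2
  unfold regionDist
  rw [← integral_const_mul, ← integral_const_mul, ← integral_add (hI1.const_mul 2) (hI2.const_mul 2)]
  refine integral_mono (integrable_region D hq hf hf₀ hfr hf₀r)
    ((hI1.const_mul 2).add (hI2.const_mul 2)) fun x => ?_
  simp only
  have h1 := ind_mem_Icc (q x)
  have h2 := abs_sub_mem_Icc (hfr x) (hkr x)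
  have h3 : (f x - k x) ^ 2 ≤ |f x - k x| := by
    rw [← sq_abs]; nlinarith [h2.1, h2.2]
  have h4 : (f x - f₀ x) ^ 2 ≤ 2 * (k x - f₀ x) ^ 2 + 2 * |f x - k x| := by
    nlinarith [sq_nonneg ((f x - k x) - (k x - f₀ x))]
  calc ind (q x) * (f x - f₀ x) ^ 2 ≤ ind (q x) * (2 * (k x - f₀ x) ^ 2 + 2 * |f x - k x|) :=
        mul_le_mul_of_nonneg_left h4 h1.1
    _ ≤ _ := by nlinarith [h1.1, h1.2, h2.1]

theorem measurable_regionDist {Ω : Type*} [MeasurableSpace Ω] (D : Measure X)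
    [IsProbabilityMeasure D] {Q : Ω → X → Bool}
    (hQ : Measurable fun q : Ω × X => Q q.1 q.2) {f f₀ : X → ℝ} (hf : Measurable f)
    (hf₀ : Measurable f₀) : Measurable fun ω => regionDist D (Q ω) f f₀ := by
  unfold regionDist
  refine StronglyMeasurable.measurable (StronglyMeasurable.integral_prod_right
    (f := fun ω x => ind (Q ω x) * (f x - f₀ x) ^ 2) (Measurable.stronglyMeasurable ?_))
  exact (measurable_ind.comp hQ).mul
    (((hf.comp measurable_snd).sub (hf₀.comp measurable_snd)).pow_const 2)

theorem map_sample (P : Measure (X × Bool)) [IsProbabilityMeasure P] (n : ℕ) :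
    (Measure.infinitePi fun _ : ℕ => P).map (fun ω (i : Fin n) => (ω i).1) =
      Measure.pi fun _ : Fin n => P.fst := by
  have hm : Measurable fun (ω : ℕ → X × Bool) (i : Fin n) => (ω i).1 := by fun_prop
  refine (Measure.pi_eq fun s hs => ?_).symm
  rw [Measure.map_apply hm (MeasurableSet.univ_pi hs)]
  classical
  set A : ℕ → Set (X × Bool) := fun t =>
    if h : t < n then Prod.fst ⁻¹' s ⟨t, h⟩ else Set.univ with hA
  have hAm : ∀ t, MeasurableSet (A t) := by
    intro t
    rw [hA]
    simp only
    split_ifs with h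
    · exact measurable_fst (hs _)
    · exact MeasurableSet.univ
  have : (fun (ω : ℕ → X × Bool) (i : Fin n) => (ω i).1) ⁻¹' (Set.univ.pi s) =
      Set.pi (Finset.range n) A := by
    ext ω
    simp only [Set.mem_preimage, Set.mem_pi, Set.mem_univ, true_imp_iff, Finset.coe_range,
      Set.mem_Iio]
    constructor
    · intro h t ht
      simpa [hA, ht] using h ⟨t, ht⟩
    · intro h i
      simpa [hA] using h i i.2
  rw [this, Measure.infinitePi_pi _ fun i _ => hAm i, ← Fin.prod_univ_eq_prod_range (fun t => P (A t))]
  refine Finset.prod_congr rfl fun i _ => ?_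
  simp only [hA, i.2, dif_pos]
  rw [Measure.fst_apply (hs i)]

/-- Uniform lower bounds for the excess losses of all functions of the class over all time windows,
and an upper bound for the number of queries, outside an event of probability at most `2 δ`. -/
theorem exists_good_event {P : Measure (X × Bool)} [IsProbabilityMeasure P] {η : X → ℝ}
    (hη : IsCondProb P η) {F : Set (X → ℝ)} (hF : IsRegressionClass F) {d : ℕ} (hd : pdim F ≤ d)
    {f₀ : X → ℝ} (hf₀ : f₀ ∈ F) {ε : ℝ} (hε : ∀ x, |f₀ x - η x| ≤ ε)
    {Q : ℕ → (ℕ → X × Bool) → X → Bool}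
    (hQm : ∀ t, Measurable fun q : (ℕ → X × Bool) × X => Q t q.1 q.2)
    (hQdep : ∀ t ω ω', (∀ s < t, ω s = ω' s) → Q t ω = Q t ω')
    {n : ℕ} (hn : 0 < n) {δ : ℝ} (hδ : 0 < δ) {L : ℝ} (hL1 : 1 ≤ L)
    (hLd : d * Real.log (2 * n * n + 1) ≤ 3 * L) (hLδ : Real.log (1 / δ) ≤ L)
    (hLn : Real.log (2 * ((n : ℝ) + 1) ^ 2 / δ) ≤ 3 * L) (hLε : n * ε ^ 2 ≤ L) :
    ∃ S : Set (ℕ → X × Bool), (Measure.infinitePi fun _ : ℕ => P) S ≤ ENNReal.ofReal (2 * δ) ∧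
      ∀ ω ∉ S, (∀ f ∈ F, ∀ a e, a ≤ e → e ≤ n →
        (∑ t ∈ Finset.Ico a e, regionDist P.fst (Q t ω) f f₀) / 8 - 200 * L ≤
          ∑ t ∈ Finset.Ico a e, lossDiff (Q t ω) f f₀ (ω t)) ∧
        ∑ t ∈ Finset.range n, ind (Q t ω (ω t).1) ≤
          2 * (∑ t ∈ Finset.range n, ∫ x, ind (Q t ω x) ∂P.fst) + 3 * L := by
  obtain ⟨G, hGF, hGc, hGd⟩ := hF.separable
  set μ := Measure.infinitePi fun _ : ℕ => P
  set D := P.fst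
  have hn' : (0 : ℝ) < n := by exact_mod_cast hn
  have hpdG : pdim G ≤ d := by
    refine le_trans ?_ hd
    refine iSup_mono fun S => iSup_mono' fun h => ⟨fun A hA => ?_, le_rfl⟩
    obtain ⟨f, hf, h'⟩ := h A hA
    exact ⟨f, hGF hf, h'⟩
  have hGm : ∀ f ∈ G, Measurable f := fun f hf => hF.measurable f (hGF hf)
  have hGr : ∀ f ∈ G, ∀ x, f x ∈ Set.Icc (0 : ℝ) 1 := fun f hf => hF.range f (hGF hf)
  have hf₀m := hF.measurable f₀ hf₀
  have hf₀r := hF.range f₀ hf₀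
  obtain ⟨K, π, hKG, hKc, hπ, hS1⟩ := exists_sample_cover D hGc hGm hpdG hGr hn
  have hQω : ∀ t ω, Measurable (Q t ω) := fun t ω => (hQm t).comp measurable_prodMk_left
  set N : ℝ := (2 * n * n + 1 : ℝ) ^ d with hN
  have hNpos : 0 < N := by positivity
  have hKN : (K.card : ℝ) ≤ N := by
    calc (K.card : ℝ) ≤ ((n * n + 1 : ℕ) : ℝ) ^ d := by exact_mod_cast hKc
      _ ≤ N := by rw [hN]; push_cast; gcongr; nlinarith
  -- Union bound over at most `N` cover elements and `(n + 1)²` time windows, with total failure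
  -- probability `δ / 2`.
  set δ' : ℝ := δ / (2 * N * ((n : ℝ) + 1) ^ 2) with hδ'
  have hδ'pos : 0 < δ' := by positivity
  have hlogδ' : Real.log (1 / δ') ≤ 6 * L := by
    have : 1 / δ' = N * (2 * ((n : ℝ) + 1) ^ 2 / δ) := by rw [hδ']; field_simp
    rw [this, Real.log_mul hNpos.ne' (by positivity), hN, Real.log_pow]
    linarith
  set S₁ : Set (ℕ → X × Bool) := (fun ω (i : Fin n) => (ω i).1) ⁻¹'
    {x | ∃ f ∈ G, 8 + 6 * (d * Real.log (2 * n * n + 1)) + 3 * Real.log (1 / δ) <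
      ∑ i, |f (x i) - π f (x i)|} with hS₁
  set h₂ : (X → ℝ) → ℕ → (ℕ → X × Bool) → X × Bool → ℝ := fun k t ω z =>
    (regionDist D (Q t ω) k f₀ / 4 - 2 * ε ^ 2 - lossDiff (Q t ω) k f₀ z) / 16 with hh₂
  set S₂ : Set (ℕ → X × Bool) := ⋃ k ∈ K, ⋃ a ∈ Finset.range (n + 1), ⋃ e ∈ Finset.range (n + 1),
    {ω | Real.log (1 / δ') < ∑ t ∈ Finset.Ico a e, h₂ k t ω (ω t)} with hS₂
  set h₃ : ℕ → (ℕ → X × Bool) → X × Bool → ℝ := fun t ω z =>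
    ind (Q t ω z.1) - 2 * ∫ x, ind (Q t ω x) ∂D with hh₃
  set S₃ : Set (ℕ → X × Bool) :=
    {ω | Real.log (1 / (δ / 2)) < ∑ t ∈ Finset.Ico 0 n, h₃ t ω (ω t)} with hS₃
  have hb₁ : μ S₁ ≤ ENNReal.ofReal δ := by
    refine (Measure.le_map_apply (Measurable.aemeasurable (by fun_prop)) _).trans ?_
    rw [map_sample P n]
    exact hS1 δ hδ
  have hQz : ∀ t, Measurable fun q : (ℕ → X × Bool) × (X × Bool) => ind (Q t q.1 q.2.1) := fun t =>
    measurable_ind.comp ((hQm t).comp (f := fun q : (ℕ → X × Bool) × (X × Bool) => (q.1, q.2.1))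
      (by fun_prop))
  have hb₂ : μ S₂ ≤ ENNReal.ofReal (δ / 2) := by
    have hone : ∀ k ∈ K, ∀ a e, μ {ω | Real.log (1 / δ') < ∑ t ∈ Finset.Ico a e, h₂ k t ω (ω t)} ≤
        ENNReal.ofReal δ' := by
      intro k hk a e
      have hkm := hGm k (hKG hk)
      refine adaptive_tail P (fun t => ?_) (fun t ω ω' hω => ?_) (fun t ω => ?_) a e hδ'pos
      · have hM : Measurable fun q : (ℕ → X × Bool) × (X × Bool) =>
            lossDiff (Q t q.1) k f₀ q.2 := by
          have h1 : Measurable fun q : (ℕ → X × Bool) × (X × Bool) => labelVal q.2.2 :=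
            measurable_labelVal.comp (by fun_prop)
          have h3 : Measurable fun q : (ℕ → X × Bool) × (X × Bool) => k q.2.1 :=
            hkm.comp (by fun_prop)
          have h4 : Measurable fun q : (ℕ → X × Bool) × (X × Bool) => f₀ q.2.1 :=
            hf₀m.comp (by fun_prop)
          exact (hQz t).mul (((h3.sub h1).pow_const 2).sub ((h4.sub h1).pow_const 2))
        exact (((((measurable_regionDist D (hQm t) hkm hf₀m).comp measurable_fst).div_const 4).sub_const
          _).sub hM).div_const 16
      · rw [hh₂]
        simp only [hQdep t ω ω' hω]
      · exact lintegral_exp_lossDiff_le hη (hQω t ω) hkm hf₀m (hGr k (hKG hk)) hf₀r hε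
    calc μ S₂ ≤ ∑ k ∈ K, ∑ a ∈ Finset.range (n + 1), ∑ e ∈ Finset.range (n + 1),
          ENNReal.ofReal δ' := by
          refine (measure_biUnion_finset_le _ _).trans (Finset.sum_le_sum fun k hk => ?_)
          refine (measure_biUnion_finset_le _ _).trans (Finset.sum_le_sum fun a _ => ?_)
          exact (measure_biUnion_finset_le _ _).trans (Finset.sum_le_sum fun e _ => hone k hk a e)
      _ = ENNReal.ofReal (K.card * (((n : ℝ) + 1) * (((n : ℝ) + 1) * δ'))) := by
          simp only [Finset.sum_const, Finset.card_range, nsmul_eq_mul]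
          rw [ENNReal.ofReal_mul (by positivity), ENNReal.ofReal_mul (by positivity),
            ENNReal.ofReal_mul (by positivity), ENNReal.ofReal_natCast]
          have : ENNReal.ofReal ((n : ℝ) + 1) = ((n + 1 : ℕ) : ℝ≥0∞) := by
            rw [← ENNReal.ofReal_natCast]; push_cast; rfl
          rw [this]
      _ ≤ ENNReal.ofReal (δ / 2) := by
          refine ENNReal.ofReal_le_ofReal ?_
          calc _ ≤ N * (((n : ℝ) + 1) * (((n : ℝ) + 1) * δ')) := by gcongr
            _ = δ / 2 := by rw [hδ']; field_simp
  have hb₃ : μ S₃ ≤ ENNReal.ofReal (δ / 2) := by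
    refine adaptive_tail P (fun t => ?_) (fun t ω ω' hω => ?_) (fun t ω => ?_) 0 n (by positivity)
    · have : Measurable fun ω => ∫ x, ind (Q t ω x) ∂D :=
        StronglyMeasurable.measurable (StronglyMeasurable.integral_prod_right
          (f := fun ω x => ind (Q t ω x)) (measurable_ind.comp (hQm t)).stronglyMeasurable)
      exact (hQz t).sub ((this.comp measurable_fst).const_mul 2)
    · rw [hh₃]
      simp only [hQdep t ω ω' hω]
    · exact lintegral_exp_ind_le (hQω t ω)
  refine ⟨S₁ ∪ S₂ ∪ S₃, ?_, ?_⟩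
  · calc μ (S₁ ∪ S₂ ∪ S₃) ≤ μ S₁ + μ S₂ + μ S₃ :=
          (measure_union_le _ _).trans (by gcongr; exact measure_union_le _ _)
      _ ≤ ENNReal.ofReal δ + ENNReal.ofReal (δ / 2) + ENNReal.ofReal (δ / 2) := by gcongr
      _ = ENNReal.ofReal (2 * δ) := by
          rw [← ENNReal.ofReal_add (by positivity) (by positivity),
            ← ENNReal.ofReal_add (by positivity) (by positivity)]
          congr 1; ring
  intro ω hω
  rw [Set.mem_union, Set.mem_union, not_or, not_or] at hω
  obtain ⟨⟨hω1, hω2⟩, hω3⟩ := hω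
  refine ⟨?_, ?_⟩
  · -- first for the countable dense subset
    have hGcase : ∀ f ∈ G, ∀ a e, a ≤ e → e ≤ n →
        (∑ t ∈ Finset.Ico a e, regionDist D (Q t ω) f f₀) / 8 - 200 * L ≤
          ∑ t ∈ Finset.Ico a e, lossDiff (Q t ω) f f₀ (ω t) := by
      intro f hf a e hae hen
      obtain ⟨hk, hk1⟩ := hπ f hf
      set k := π f
      have hkG := hKG hk
      have hA1 : ∑ t ∈ Finset.range n, |f (ω t).1 - k (ω t).1| ≤ 29 * L := by
        rw [hS₁] at hω1
        simp only [Set.mem_preimage, Set.mem_ofPred_eq, not_exists, not_and, not_lt] at hω1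
        have := hω1 f hf
        rw [Finset.sum_range]
        linarith
      have hA2 : n * ∫ x, |f x - k x| ∂D ≤ 26 * L := by linarith
      have hA3 : ∑ t ∈ Finset.Ico a e, h₂ k t ω (ω t) ≤ 6 * L := by
        rw [hS₂] at hω2
        simp only [Set.mem_iUnion, Set.mem_ofPred_eq, not_exists, not_lt, Finset.mem_range] at hω2
        exact (hω2 k hk a (by omega) e (by omega)).trans hlogδ'
      have hcard : ((Finset.Ico a e).card : ℝ) ≤ n := by
        rw [Nat.card_Ico]; exact_mod_cast (by omega : e - a ≤ n)
      have hsubset : Finset.Ico a e ⊆ Finset.range n := by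
        intro t ht; rw [Finset.mem_Ico] at ht; rw [Finset.mem_range]; omega
      have hB1 : ∑ t ∈ Finset.Ico a e, |f (ω t).1 - k (ω t).1| ≤ 29 * L :=
        (Finset.sum_le_sum_of_subset_of_nonneg hsubset fun _ _ _ => abs_nonneg _).trans hA1
      have hI0 : 0 ≤ ∫ x, |f x - k x| ∂D := integral_nonneg fun x => abs_nonneg _
      have hB2 : ∑ t ∈ Finset.Ico a e, regionDist D (Q t ω) f f₀ ≤
          2 * ∑ t ∈ Finset.Ico a e, regionDist D (Q t ω) k f₀ + 52 * L := by
        calc _ ≤ ∑ t ∈ Finset.Ico a e, (2 * regionDist D (Q t ω) k f₀ + 2 * ∫ x, |f x - k x| ∂D) :=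
              Finset.sum_le_sum fun t _ => regionDist_le D (hQω t ω) (hGm f hf) (hGm k hkG) hf₀m
                (hGr f hf) (hGr k hkG) hf₀r
          _ = 2 * ∑ t ∈ Finset.Ico a e, regionDist D (Q t ω) k f₀ +
                (Finset.Ico a e).card * (2 * ∫ x, |f x - k x| ∂D) := by
              rw [Finset.sum_add_distrib, ← Finset.mul_sum, Finset.sum_const, nsmul_eq_mul]
          _ ≤ 2 * ∑ t ∈ Finset.Ico a e, regionDist D (Q t ω) k f₀ + n * (2 * ∫ x, |f x - k x| ∂D) := by
              gcongr
          _ ≤ _ := by linarith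
      have hB3 : ∑ t ∈ Finset.Ico a e, h₂ k t ω (ω t) =
          ((∑ t ∈ Finset.Ico a e, regionDist D (Q t ω) k f₀) / 4 -
            (Finset.Ico a e).card * (2 * ε ^ 2) -
            ∑ t ∈ Finset.Ico a e, lossDiff (Q t ω) k f₀ (ω t)) / 16 := by
        rw [hh₂]
        simp only
        rw [← Finset.sum_div, Finset.sum_sub_distrib, Finset.sum_sub_distrib, ← Finset.sum_div,
          Finset.sum_const, nsmul_eq_mul]
      have hB4 : ((Finset.Ico a e).card : ℝ) * (2 * ε ^ 2) ≤ 2 * L := by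
        calc _ ≤ (n : ℝ) * (2 * ε ^ 2) := by gcongr
          _ ≤ 2 * L := by linarith
      have hB5 : ∑ t ∈ Finset.Ico a e, lossDiff (Q t ω) k f₀ (ω t) -
          2 * ∑ t ∈ Finset.Ico a e, |f (ω t).1 - k (ω t).1| ≤
          ∑ t ∈ Finset.Ico a e, lossDiff (Q t ω) f f₀ (ω t) := by
        rw [Finset.mul_sum, ← Finset.sum_sub_distrib]
        exact Finset.sum_le_sum fun t _ => lossDiff_sub_abs_le (hGr f hf) (hGr k hkG) _ _
      -- The losses add up to `96 L` (tail bound times `16`), `2 L` (misspecification), `58 L`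
      -- (sample distance to the cover) and `6.5 L` (distance to the cover under the law), below
      -- `200 L`.
      linarith
    -- Both sides pass to pointwise limits of sequences in the countable subset, the region
    -- distances by dominated convergence.
    intro f hf a e hae hen
    obtain ⟨v, hvG, hv⟩ := hGd f hf
    rw [tendsto_pi_nhds] at hv
    have hl1 : Tendsto (fun j => (∑ t ∈ Finset.Ico a e, regionDist D (Q t ω) (v j) f₀) / 8 - 200 * L)
        atTop (𝓝 ((∑ t ∈ Finset.Ico a e, regionDist D (Q t ω) f f₀) / 8 - 200 * L)) := by
      refine ((tendsto_finsetSum _ fun t _ => ?_).div_const 8).sub_const _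
      refine tendsto_integral_of_dominated_convergence (fun _ => 1) (fun j => ?_)
        (integrable_const 1) (fun j => ae_of_all _ fun x => ?_) (ae_of_all _ fun x => ?_)
      · exact (integrable_region D (hQω t ω) (hGm _ (hvG j)) hf₀m (hGr _ (hvG j))
          hf₀r).aestronglyMeasurable
      · have h1 := ind_mem_Icc (Q t ω x)
        have h2 : (v j x - f₀ x) ^ 2 ≤ 1 := by
          rw [← sq_abs]
          exact pow_le_one₀ (abs_nonneg _) (abs_sub_mem_Icc (hGr _ (hvG j) x) (hf₀r x)).2
        rw [Real.norm_eq_abs, abs_of_nonneg (mul_nonneg h1.1 (sq_nonneg _))]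
        nlinarith [h1.1, h1.2, sq_nonneg (v j x - f₀ x)]
      · exact (((hv x).sub_const _).pow 2).const_mul _
    have hl2 : Tendsto (fun j => ∑ t ∈ Finset.Ico a e, lossDiff (Q t ω) (v j) f₀ (ω t))
        atTop (𝓝 (∑ t ∈ Finset.Ico a e, lossDiff (Q t ω) f f₀ (ω t))) := by
      refine tendsto_finsetSum _ fun t _ => ?_
      exact (((((hv (ω t).1).sub_const _).pow 2).sub_const _)).const_mul _
    exact le_of_tendsto_of_tendsto' hl1 hl2 fun j => hGcase _ (hvG j) a e hae hen
  · rw [hS₃] at hω3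
    simp only [Set.mem_ofPred_eq, not_lt] at hω3
    rw [hh₃] at hω3
    simp only at hω3
    rw [Finset.sum_sub_distrib, ← Finset.mul_sum, ← Finset.range_eq_Ico] at hω3
    have h2 : Real.log (1 / (δ / 2)) ≤ 3 * L := by
      refine le_trans (Real.log_le_log (by positivity) ?_) hLn
      rw [one_div_div]
      gcongr
      nlinarith
    linarith

end GoodEvent

/-! ### Numerical facts about the inputs -/

/-- The complexity term `d log (T / δ)`. -/
def Params.L (p : Params) : ℝ := p.d * Real.log (p.T / p.del)

theorem Params.M_mul_zeta (p : Params) : ((p.M : ℝ) + 2) * p.zeta = p.eps * p.gam / 32 := by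
  unfold Params.zeta
  field_simp

namespace Params.Valid

variable {p : Params} (hp : p.Valid)

include hp

theorem gam_pos : 0 < p.gam := hp.eps_pos.trans hp.eps_lt_gam

theorem one_le_d : (1 : ℝ) ≤ p.d := by exact_mod_cast hp.d_pos

theorem mul_T : p.eps * p.gam * p.T = p.d := by
  have h1 := hp.eps_pos
  have h2 := hp.gam_pos
  unfold Params.T
  field_simp

theorem four_lt_T : 4 < p.T := by
  have h1 := hp.eps_pos
  have h2 := hp.gam_pos
  unfold Params.T
  rw [lt_div_iff₀ (by positivity)]
  have h3 : p.eps * p.gam < 1 / 2 * (1 / 2) :=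
    mul_lt_mul'' (hp.eps_lt_gam.trans hp.gam_lt) hp.gam_lt h1.le h2.le
  linarith [hp.one_le_d]

theorem log_T : 1.386 < Real.log p.T := by
  have h := Real.log_lt_log (by norm_num) hp.four_lt_T
  have h4 : Real.log 4 = 2 * Real.log 2 := by
    rw [show (4 : ℝ) = 2 ^ 2 by norm_num, Real.log_pow]; norm_num
  rw [h4] at h
  linarith [Real.log_two_gt_d9]

theorem three_le_M : 3 ≤ p.M := by
  have h : (2 : ℝ) < Real.logb 2 p.T := by
    rw [Real.lt_logb_iff_rpow_lt (by norm_num) (by linarith [hp.four_lt_T])]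
    norm_num
    exact hp.four_lt_T
  have : (2 : ℝ) < p.M := h.trans_le (Nat.le_ceil _)
  exact_mod_cast this

theorem M_lt : (p.M : ℝ) < Real.logb 2 p.T + 1 := by
  refine Nat.ceil_lt_add_one ?_
  exact Real.logb_nonneg (by norm_num) (by linarith [hp.four_lt_T])

theorem T_le_two_pow : p.T ≤ 2 ^ p.M := by
  have h : Real.logb 2 p.T ≤ p.M := Nat.le_ceil _
  rw [Real.logb_le_iff_le_rpow (by norm_num) (by linarith [hp.four_lt_T]), Real.rpow_natCast] at h
  exact h

theorem two_pow_lt : (2 : ℝ) ^ p.M < 2 * p.T := by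
  have h := hp.M_lt
  have h1 : (p.M : ℝ) - 1 < Real.logb 2 p.T := by linarith
  rw [Real.lt_logb_iff_rpow_lt (by norm_num) (by linarith [hp.four_lt_T]),
    Real.rpow_sub (by norm_num), Real.rpow_natCast, Real.rpow_one] at h1
  linarith

theorem tau_pred : (tau (p.M - 1) : ℝ) = 2 ^ p.M / 2 := by
  have h3 := hp.three_le_M
  obtain ⟨k, hk⟩ : ∃ k, p.M = k + 1 := ⟨p.M - 1, by omega⟩
  unfold tau
  rw [if_neg (by omega), hk, Nat.add_sub_cancel, pow_succ]
  push_cast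
  ring

theorem tau_lt : (tau (p.M - 1) : ℝ) < p.T := by
  rw [hp.tau_pred]; linarith [hp.two_pow_lt]

theorem le_tau : p.T / 2 ≤ tau (p.M - 1) := by
  rw [hp.tau_pred]; linarith [hp.T_le_two_pow]

theorem M_le_log : (p.M : ℝ) ≤ 3 * Real.log p.T := by
  have h := hp.M_lt
  have h1 := hp.log_T
  have h2 : Real.logb 2 p.T ≤ 2 * Real.log p.T := by
    unfold Real.logb
    rw [div_le_iff₀ (Real.log_pos (by norm_num))]
    nlinarith [Real.log_two_gt_d9]
  linarith

theorem log_T_le : Real.log p.T ≤ Real.log (p.T / p.del) := by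
  have hT : 0 < p.T := by linarith [hp.four_lt_T]
  refine Real.log_le_log hT ?_
  rw [le_div_iff₀ hp.del_pos]
  nlinarith [hp.del_lt]

theorem one_lt_log : 1 < Real.log (p.T / p.del) := by linarith [hp.log_T_le, hp.log_T]

theorem log_le_L : Real.log (p.T / p.del) ≤ p.L := by
  unfold Params.L
  nlinarith [hp.one_le_d, hp.one_lt_log]

theorem one_le_L : 1 ≤ p.L := hp.one_lt_log.le.trans hp.log_le_L

theorem d_le_L : (p.d : ℝ) ≤ p.L := by
  unfold Params.L
  nlinarith [hp.one_le_d, hp.one_lt_log]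

theorem d_log_le : p.d * Real.log (2 * (tau (p.M - 1) : ℕ) * (tau (p.M - 1) : ℕ) + 1) ≤ 3 * p.L := by
  have hT := hp.four_lt_T
  have hn := hp.tau_lt
  set n := tau (p.M - 1)
  have h0 : (0 : ℝ) ≤ n := Nat.cast_nonneg n
  have h1 : Real.log (2 * n * n + 1) ≤ 3 * Real.log p.T := by
    rw [← Real.log_rpow (by linarith)]
    refine Real.log_le_log (by positivity) ?_
    rw [show (3 : ℝ) = ((3 : ℕ) : ℝ) by norm_num, Real.rpow_natCast]
    nlinarith [mul_self_le_mul_self h0 hn.le, mul_pos (show 0 < p.T by linarith) (show 0 < p.T by linarith)]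
  unfold Params.L
  have := hp.log_T_le
  calc _ ≤ p.d * (3 * Real.log (p.T / p.del)) := by gcongr; linarith
    _ = _ := by ring

theorem log_inv_del_le : Real.log (1 / p.del) ≤ p.L := by
  refine le_trans (Real.log_le_log (by have := hp.del_pos; positivity) ?_) hp.log_le_L
  have := hp.del_pos
  gcongr
  linarith [hp.four_lt_T]

theorem log_window_le : Real.log (2 * (((tau (p.M - 1) : ℕ) : ℝ) + 1) ^ 2 / p.del) ≤ 3 * p.L := by
  have hT := hp.four_lt_T
  have hn := hp.tau_lt
  have hδ := hp.del_pos
  set n := tau (p.M - 1)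
  have h0 : (0 : ℝ) ≤ n := Nat.cast_nonneg n
  have h1 : Real.log (2 * ((n : ℝ) + 1) ^ 2 / p.del) ≤ 3 * Real.log (p.T / p.del) := by
    rw [← Real.log_rpow (by positivity)]
    refine Real.log_le_log (by positivity) ?_
    rw [show (3 : ℝ) = ((3 : ℕ) : ℝ) by norm_num, Real.rpow_natCast, div_pow]
    have h2 : 2 * ((n : ℝ) + 1) ^ 2 ≤ p.T ^ 3 := by
      have h3 : ((n : ℝ) + 1) ^ 2 ≤ (p.T + 1) ^ 2 := by gcongr
      nlinarith [mul_pos (show 0 < p.T by linarith) (show 0 < p.T by linarith),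
        mul_pos (mul_pos (show 0 < p.T by linarith) (show 0 < p.T by linarith)) (show 0 < p.T - 4 by linarith)]
    have h4 : p.del ^ 3 ≤ p.del := by
      have := hp.del_lt
      nlinarith [mul_pos hδ hδ]
    exact div_le_div₀ (by positivity) h2 (by positivity) h4
  linarith [hp.log_le_L]

theorem tau_mul_sq_le : ((tau (p.M - 1) : ℕ) : ℝ) * p.eps ^ 2 ≤ p.L := by
  refine le_trans ?_ hp.d_le_L
  have h1 := hp.eps_pos
  calc _ ≤ p.T * p.eps ^ 2 := by gcongr; exact hp.tau_lt.le
    _ ≤ p.eps * p.gam * p.T := by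
      nlinarith [hp.eps_lt_gam, mul_pos h1 (show 0 < p.T by linarith [hp.four_lt_T])]
    _ = p.d := hp.mul_T

/-- The misspecification term is only `2 ε² τ_{M-1} ≤ 2 L`, since `ε² T ≤ ε γ T = d ≤ L`. -/
theorem beta_bounds {m : ℕ} (hm : m ≤ p.M) :
    800 * ((p.M : ℝ) - m + 1) * p.L ≤ p.beta 400 m ∧
      p.beta 400 m ≤ 802 * ((p.M : ℝ) - m + 1) * p.L := by
  have h1 : p.Cdel 400 = 400 * p.L := by unfold Params.Cdel Params.L; ring
  have h2 := hp.tau_mul_sq_le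
  have h3 : (0 : ℝ) ≤ (p.M : ℝ) - m := by
    have : (m : ℝ) ≤ p.M := by exact_mod_cast hm
    linarith
  have h4 : (0 : ℝ) ≤ ((tau (p.M - 1) : ℕ) : ℝ) * p.eps ^ 2 := by positivity
  unfold Params.beta
  rw [h1]
  constructor <;> nlinarith

/-- Of this drop, `400 L` pays for the nesting of active sets and the rest for the slack of the
search. -/
theorem beta_step {k m : ℕ} (hkm : k < m) :
    p.beta 400 m + 800 * p.L ≤ p.beta 400 k := by
  have h1 : p.Cdel 400 = 400 * p.L := by unfold Params.Cdel Params.L; ring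
  have h3 : (1 : ℝ) ≤ (m : ℝ) - k := by
    have : (k : ℝ) + 1 ≤ m := by exact_mod_cast hkm
    linarith
  have h4 : (0 : ℝ) ≤ 2 * p.eps ^ 2 * ((tau (p.M - 1) : ℕ) : ℝ) := by positivity
  have h5 := hp.one_le_L
  unfold Params.beta
  rw [h1]
  nlinarith [mul_nonneg (show (0 : ℝ) ≤ m - k - 1 by linarith)
    (show 0 ≤ 2 * p.eps ^ 2 * ((tau (p.M - 1) : ℕ) : ℝ) + 2 * (400 * p.L) by linarith)]

theorem zeta_pos : 0 < p.zeta := by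
  have h1 := hp.eps_pos
  have h2 := hp.gam_pos
  unfold Params.zeta
  positivity

theorem zeta_le : p.zeta ≤ p.eps * p.gam / 160 := by
  have h := p.M_mul_zeta
  have h3 : (3 : ℝ) ≤ p.M := by exact_mod_cast hp.three_le_M
  nlinarith [hp.zeta_pos]

end Params.Valid

/-! ### Confidence bounds from sandwiched side values -/

section Shift

variable {p : Params} (hp : p.Valid)

include hp

/-- The offset is at most `γ / 64` and the contraction moves by at most `ε / 8 ≤ γ / 8`. -/
theorem shift_close {m : ℕ} (hm : m ∈ Finset.Icc 1 p.M) {e : ℝ} (he : |e - 1 / 2| ≤ 1) :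
    |p.shift m e - e| ≤ p.gam / 6 := by
  rw [Finset.mem_Icc] at hm
  have h1 : (m : ℝ) ≤ p.M := by exact_mod_cast hm.2
  have h1' : (1 : ℝ) ≤ m := by exact_mod_cast hm.1
  have h2 := p.M_mul_zeta
  have h3 := hp.zeta_pos
  have h4 := hp.eps_lt_gam
  have h5 := hp.gam_lt
  have h6 := hp.eps_pos
  have h7 := abs_le.1 he
  have h8 : p.eps * p.gam ≤ p.gam / 2 := by nlinarith
  have h9 : ((p.M : ℝ) - m + 2) * p.zeta ≤ p.gam / 64 := by nlinarith
  have h10 : 0 ≤ ((p.M : ℝ) - m + 2) * p.zeta := mul_nonneg (by linarith) h3.le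
  have h11 : |p.eps / 8 * (e - 1 / 2)| ≤ p.eps / 8 * 1 := by
    rw [abs_mul, abs_of_pos (by positivity)]; gcongr
  have h12 := abs_le.1 h11
  unfold Params.shift
  rw [abs_le]
  constructor <;> linarith [h12.1, h12.2]

/-- Offsets of consecutive epochs differ by `ζ`, the accuracy of the search, so approximate
monotonicity of search values becomes exact monotonicity of the bounds. -/
theorem shift_mono {k m : ℕ} (hkm : k < m) {e e' : ℝ} (h : e ≤ e' + p.zeta) :
    p.shift k e ≤ p.shift m e' := by
  have h1 : (k : ℝ) + 1 ≤ m := by exact_mod_cast hkm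
  have h3 := hp.zeta_pos
  have h4 := hp.eps_lt_gam
  have h5 := hp.gam_lt
  have h6 := hp.eps_pos
  unfold Params.shift
  nlinarith [mul_le_mul_of_nonneg_left h (show 0 ≤ 1 - p.eps / 8 by linarith)]

theorem shift_lt_half {m : ℕ} (hm : m ≤ p.M) {e : ℝ} (h : e ≤ 1 / 2 + p.zeta) :
    p.shift m e < 1 / 2 := by
  have h1 : (m : ℝ) ≤ p.M := by exact_mod_cast hm
  have h3 := hp.zeta_pos
  have h4 := hp.eps_lt_gam
  have h5 := hp.gam_lt
  have h6 := hp.eps_pos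
  unfold Params.shift
  nlinarith [mul_le_mul_of_nonneg_left h (show 0 ≤ 1 - p.eps / 8 by linarith)]

theorem shift_add_le_one {m : ℕ} (hm : m ≤ p.M) {e e' v : ℝ} (h : e ≤ v + p.zeta)
    (h' : e' ≤ 1 - v + p.zeta) : p.shift m e ≤ 1 - p.shift m e' := by
  have h1 : (m : ℝ) ≤ p.M := by exact_mod_cast hm
  have h3 := hp.zeta_pos
  have h4 := hp.eps_lt_gam
  have h5 := hp.gam_lt
  have h6 := hp.eps_pos
  unfold Params.shift
  nlinarith [mul_le_mul_of_nonneg_left (show e + e' ≤ 1 + 2 * p.zeta by linarith)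
    (show 0 ≤ 1 - p.eps / 8 by linarith)]

theorem value_ge_of_shift_ge {m : ℕ} (hm : m ≤ p.M) {e v : ℝ} (h : e ≤ v + p.zeta)
    (hs : 1 / 2 - p.gam ≤ p.shift m e) : 1 / 2 - p.gam - p.eps ≤ v := by
  have h1 : (m : ℝ) ≤ p.M := by exact_mod_cast hm
  have h3 := hp.zeta_pos
  have h4 := hp.eps_lt_gam
  have h5 := hp.gam_lt
  have h6 := hp.eps_pos
  have h7 := hp.zeta_le
  unfold Params.shift at hs
  have h8 : -p.gam ≤ (1 - p.eps / 8) * (v + p.zeta - 1 / 2) := by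
    nlinarith [mul_le_mul_of_nonneg_left h (show 0 ≤ 1 - p.eps / 8 by linarith)]
  by_contra! hcon
  have h9 : v + p.zeta - 1 / 2 < -(p.gam + p.eps * (159 / 160)) := by nlinarith
  nlinarith [mul_lt_mul_of_pos_left h9 (show 0 < 1 - p.eps / 8 by linarith)]

/-- The outward offsets could make a short interval look longer than `γ`; the contraction by `ε / 8`
outweighs them. The strict surplus `ζ` is needed because the disagreement coefficient at `γ / 2`
only concerns larger deviations. -/
theorem gap_of_shift {m : ℕ} (hm : m ∈ Finset.Icc 1 p.M) {e e' : ℝ}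
    (h : p.shift m e < 1 / 2 - p.gam) (h' : p.shift m e' < 1 / 2) :
    p.gam + p.zeta < 1 - e - e' := by
  rw [Finset.mem_Icc] at hm
  have h1 : (m : ℝ) ≤ p.M := by exact_mod_cast hm.2
  have h1' : (1 : ℝ) ≤ m := by exact_mod_cast hm.1
  have hM : (3 : ℝ) ≤ p.M := by exact_mod_cast hp.three_le_M
  have h2 := p.M_mul_zeta
  have h3 := hp.zeta_pos
  have h4 := hp.eps_lt_gam
  have h5 := hp.gam_lt
  have h6 := hp.eps_pos
  unfold Params.shift at h h'
  set s := ((p.M : ℝ) - m + 2) * p.zeta with hs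
  have hs1 : s ≤ (p.M + 1) * p.zeta := by rw [hs]; exact mul_le_mul_of_nonneg_right (by linarith) h3.le
  have h7 : p.gam - 2 * s < (1 - p.eps / 8) * (1 - e - e') := by linarith
  by_contra! hcon
  have h8 := mul_le_mul_of_nonneg_left hcon (show 0 ≤ 1 - p.eps / 8 by linarith)
  nlinarith

end Shift

/-- The result of the search procedure in epoch `m`. -/
def searchValue {X : Type u} (srch : Params → ℕ → List (X × Bool) → X → Bool → OracleProg X ℝ)
    (O : List (WExample X) → X → ℝ) (p : Params) (m : ℕ) (B : List (X × Bool)) (x : X) (b : Bool) :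
    ℝ :=
  (srch p m B x b).run O

section Bounds

variable {X : Type u} {srch : Params → ℕ → List (X × Bool) → X → Bool → OracleProg X ℝ}
  {O : List (WExample X) → X → ℝ} {p : Params} {F : Set (X → ℝ)}

theorem classifier_eq_none_iff {γ : ℝ} {b : X → ℝ × ℝ} {f : X → ℝ} {x : X} :
    classifier γ b f x = none ↔ (b x).2 < (b x).1 ∨ (1 / 2 - γ ≤ (b x).1 ∧ (b x).2 ≤ 1 / 2 + γ) := by
  rw [← Icc_subset_Icc_iff_or]
  unfold classifier
  split_ifs with h
  · exact iff_of_true rfl h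
  · exact iff_of_false (by simp) h

theorem queryFn_iff {m : ℕ} {B : List (X × Bool)} {x : X} :
    queryFn p.gam (bounds O (mkSub srch) p m B) (fhat O B) x = true ↔
      (∀ b, p.shift m (searchValue srch O p m B x b) < 1 / 2) ∧
        ∃ b, p.shift m (searchValue srch O p m B x b) < 1 / 2 - p.gam := by
  unfold queryFn
  rw [decide_eq_true_eq, ne_eq, classifier_eq_none_iff, mkSub_bounds, Set.mem_Ioo]
  simp only [Bool.forall_bool, Bool.exists_bool, searchValue]
  constructor
  · rintro ⟨⟨h1, h2⟩, h3⟩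
    rw [not_or, not_and_or, not_le, not_le] at h3
    refine ⟨⟨h1, by linarith⟩, ?_⟩
    rcases h3.2 with h | h
    · exact Or.inl h
    · right; linarith
  · rintro ⟨⟨h1, h2⟩, h3⟩
    refine ⟨⟨h1, by linarith⟩, ?_⟩
    rw [not_or, not_and_or, not_le, not_le, not_lt]
    refine ⟨by linarith, ?_⟩
    rcases h3 with h | h
    · exact Or.inl h
    · right; linarith

/-- The tolerance splits as `γ / 4 = γ / 12 + γ / 6`, for the search and for the affine map. -/
theorem approximatesBounds_of_search (hp : p.Valid) (hO : IsRegressionOracle F O)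
    (hF : ∀ f ∈ F, ∀ x, f x ∈ Set.Icc (0 : ℝ) 1) {s : ℝ}
    (hs : ∀ m ∈ Finset.Icc 1 p.M, ∀ B x b,
      (∃ f ∈ activeSet F O B (s * p.beta 400 m), side b (f x) ≤ searchValue srch O p m B x b) ∧
        ∀ f ∈ activeSet F O B (p.beta 400 m),
          searchValue srch O p m B x b ≤ side b (f x) + p.gam / 12) (ω : ℕ → X × Bool) :
    ApproximatesBounds 400 s F O (mkSub srch) p ω := by
  intro m hm x
  simp only
  set B := queried O (mkSub srch) p ω (m - 1)
  have hβ : 0 ≤ p.beta 400 m := by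
    have h1 := (hp.beta_bounds (Finset.mem_Icc.1 hm).2).1
    have h2 : (m : ℝ) ≤ p.M := by exact_mod_cast (Finset.mem_Icc.1 hm).2
    have h3 := hp.one_le_L
    refine le_trans ?_ h1
    have : (0 : ℝ) ≤ (p.M : ℝ) - m + 1 := by linarith
    positivity
  have hfh := fhat_mem_activeSet hO B hβ
  have hclose : ∀ b, |p.shift m (searchValue srch O p m B x b) - searchValue srch O p m B x b| ≤
      p.gam / 6 := by
    intro b
    refine shift_close hp hm ?_
    obtain ⟨⟨f, hf, hfe⟩, h2⟩ := hs m hm B x b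
    have h3 := side_mem_Icc (b := b) (hF f hf.1 x)
    have h4 := side_mem_Icc (b := b) (hF _ hfh.1 x)
    have h5 := h2 _ hfh
    have h6 := hp.gam_lt
    rw [abs_le]
    constructor <;> linarith [h3.1, h4.2]
  have hbdd : ∀ β, BddBelow ((fun f : X → ℝ => f x) '' activeSet F O B β) := fun β =>
    ⟨0, by rintro _ ⟨f, hf, rfl⟩; exact (hF f hf.1 x).1⟩
  have hbdd' : ∀ β, BddAbove ((fun f : X → ℝ => f x) '' activeSet F O B β) := fun β =>
    ⟨1, by rintro _ ⟨f, hf, rfl⟩; exact (hF f hf.1 x).2⟩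
  have hne : ((fun f : X → ℝ => f x) '' activeSet F O B (p.beta 400 m)).Nonempty := ⟨_, _, hfh, rfl⟩
  obtain ⟨⟨f, hf, hfe⟩, h2⟩ := hs m hm B x false
  obtain ⟨⟨g, hg, hge⟩, h4⟩ := hs m hm B x true
  have hc0 := abs_le.1 (hclose false)
  have hc1 := abs_le.1 (hclose true)
  rw [mkSub_bounds]
  simp only [side, Bool.false_eq_true, if_false, if_true] at hfe h2 hge h4
  change _ ≤ p.shift m (searchValue srch O p m B x false) ∧
    p.shift m (searchValue srch O p m B x false) ≤ _ ∧
    _ ≤ 1 - p.shift m (searchValue srch O p m B x true) ∧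
    1 - p.shift m (searchValue srch O p m B x true) ≤ _
  have hγ := hp.gam_pos
  refine ⟨?_, ?_, ?_, ?_⟩
  · have : lcb x (activeSet F O B (s * p.beta 400 m)) ≤ f x := csInf_le (hbdd _) ⟨f, hf, rfl⟩
    linarith [hc0.1]
  · have : searchValue srch O p m B x false - p.gam / 12 ≤
        lcb x (activeSet F O B (p.beta 400 m)) := by
      refine le_csInf hne ?_
      rintro _ ⟨f', hf', rfl⟩
      linarith [h2 f' hf']
    linarith [hc0.2]
  · have : ucb x (activeSet F O B (p.beta 400 m)) ≤
        1 - searchValue srch O p m B x true + p.gam / 12 := by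
      refine csSup_le hne ?_
      rintro _ ⟨f', hf', rfl⟩
      linarith [h4 f' hf']
    linarith [hc1.2]
  · have : g x ≤ ucb x (activeSet F O B (s * p.beta 400 m)) := le_csSup (hbdd' _) ⟨g, hg, rfl⟩
    linarith [hc1.1]

end Bounds

/-! ### Disagreement regions -/

section Region

variable {X : Type u} [MeasurableSpace X]

theorem one_le_disCoeffSup (F : Set (X → ℝ)) (f₀ : X → ℝ) (γ₀ : ℝ) : 1 ≤ disCoeffSup F f₀ γ₀ :=
  le_trans le_sup_right (le_iSup₂_of_le (1 : ℝ) one_pos le_rfl)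

theorem le_disCoeffSup (F : Set (X → ℝ)) (f₀ : X → ℝ) {γ₀ γ ε : ℝ} (hγ : γ₀ < γ) (hε : 0 < ε)
    (D : Measure X) [IsProbabilityMeasure D] :
    ENNReal.ofReal (γ ^ 2 / ε ^ 2) *
      D {x | ∃ f ∈ F, γ < |f x - f₀ x| ∧ √(∫ z, (f z - f₀ z) ^ 2 ∂D) ≤ ε} ≤
      disCoeffSup F f₀ γ₀ := by
  refine le_iSup₂_of_le (ε / 2) (by positivity) (le_sup_of_le_left ?_)
  refine le_iSup₂_of_le D ‹_› (le_iSup₂_of_le γ hγ (le_iSup₂_of_le ε (by linarith) le_rfl))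

theorem integral_ind (D : Measure X) {q : X → Bool} (hq : Measurable q) :
    ∫ x, ind (q x) ∂D = D.real {x | q x = true} := by
  have hs : MeasurableSet {x | q x = true} := hq (measurableSet_singleton true)
  rw [← integral_indicator_one hs]
  refine integral_congr_ae (ae_of_all _ fun x => ?_)
  by_cases h : q x = true <;> simp [ind, h]

/-- If on the region `q` some function of `F` is farther than `γ₀` from `f₀` while its squared
distance to `f₀` on the region is at most `r`, the region has small probability. -/
theorem region_prob_le {F : Set (X → ℝ)} {f₀ : X → ℝ} {D : Measure X} [IsProbabilityMeasure D]
    {q : X → Bool} (hq : Measurable q) {γ₀ γ r : ℝ} (hγ₀ : 0 < γ₀) (hγ : γ₀ < γ) (hr : 0 < r)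
    (h : ∀ x, q x = true → ∃ f ∈ F, γ < |f x - f₀ x| ∧ regionDist D q f f₀ ≤ r)
    (hθ : disCoeffSup F f₀ γ₀ ≠ ⊤) :
    ∫ x, ind (q x) ∂D ≤ (disCoeffSup F f₀ γ₀).toReal * r / γ₀ ^ 2 := by
  have hs : MeasurableSet {x | q x = true} := hq (measurableSet_singleton true)
  rw [integral_ind D hq]
  set s := {x | q x = true} with hsdef
  set θ := disCoeffSup F f₀ γ₀
  rcases eq_or_ne (D s) 0 with h0 | h0
  · rw [measureReal_def, h0, ENNReal.toReal_zero]
    have : 0 ≤ θ.toReal := ENNReal.toReal_nonneg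
    positivity
  have hp : 0 < D.real s := ENNReal.toReal_pos h0 (measure_ne_top _ _)
  -- The supremum over all laws is used at the law conditioned on the region: the disagreement set
  -- then has probability `1`, and only distances on the region enter the norm. The scale is chosen
  -- as `√(r / D s)`.
  have : IsProbabilityMeasure (ProbabilityTheory.cond D s) :=
    ProbabilityTheory.cond_isProbabilityMeasure h0
  have hε : 0 < √(r / D.real s) := Real.sqrt_pos.2 (by positivity)
  have h1 := le_disCoeffSup F f₀ hγ hε (ProbabilityTheory.cond D s)
  have h2 : ProbabilityTheory.cond D s {x | ∃ f ∈ F, γ < |f x - f₀ x| ∧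
      √(∫ z, (f z - f₀ z) ^ 2 ∂(ProbabilityTheory.cond D s)) ≤ √(r / D.real s)} = 1 := by
    refine le_antisymm prob_le_one ?_
    rw [← ProbabilityTheory.cond_apply_self h0 (measure_ne_top _ _)]
    refine measure_mono fun x hx => ?_
    obtain ⟨f, hf, hfx, hd⟩ := h x hx
    refine ⟨f, hf, hfx, Real.sqrt_le_sqrt ?_⟩
    have h3 : ∫ z, (f z - f₀ z) ^ 2 ∂(ProbabilityTheory.cond D s) =
        (D.real s)⁻¹ * regionDist D q f f₀ := by
      rw [ProbabilityTheory.cond, integral_smul_measure, ENNReal.toReal_inv, smul_eq_mul]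
      congr 1
      rw [← integral_indicator hs]
      refine integral_congr_ae (ae_of_all _ fun z => ?_)
      by_cases hz : q z = true <;> simp [ind, hz, hsdef]
    rw [h3, div_eq_inv_mul]
    gcongr
  rw [h2, mul_one, Real.sq_sqrt (by positivity), ENNReal.ofReal_le_iff_le_toReal hθ] at h1
  rw [div_div_eq_mul_div, div_le_iff₀ hr] at h1
  rw [le_div_iff₀ (by positivity)]
  have : γ₀ ^ 2 ≤ γ ^ 2 := by gcongr
  nlinarith

end Region

/-! ### Runs on the good event -/

/-- What the analysis needs to know about the search procedure. -/
structure SearchSpec {X : Type u} (F : Set (X → ℝ)) (O : List (WExample X) → X → ℝ) (p : Params)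
    (srch : Params → ℕ → List (X × Bool) → X → Bool → OracleProg X ℝ) (inn out : ℕ → ℝ) : Prop where
  sandwich : ∀ m ∈ Finset.Icc 1 p.M, ∀ B x b,
    Sandwich F O B x b (inn m) (out m) p.zeta (searchValue srch O p m B x b)
  le_inn : ∀ m ∈ Finset.Icc 1 p.M, 200 * p.L ≤ inn m
  step : ∀ k m, 1 ≤ k → k < m → m ≤ p.M → out m + 400 * p.L ≤ inn k
  out_le : ∀ m ∈ Finset.Icc 1 p.M, out m ≤ 1604 * ((p.M : ℝ) - m + 1) * p.L

/-- The lower bound for excess losses that holds on the good event. -/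
def GoodRun {X : Type u} [MeasurableSpace X] (D : Measure X) (F : Set (X → ℝ))
    (O : List (WExample X) → X → ℝ) (A : CISub X) (p : Params) (f₀ : X → ℝ) (ω : ℕ → X × Bool) :
    Prop :=
  ∀ f ∈ F, ∀ a e, a ≤ e → e ≤ tau (p.M - 1) →
    (∑ t ∈ Finset.Ico a e, regionDist D (timeQuery O A p ω t) f f₀) / 8 - 200 * p.L ≤
      ∑ t ∈ Finset.Ico a e, lossDiff (timeQuery O A p ω t) f f₀ (ω t)

section Runs

variable {X : Type u} [MeasurableSpace X] {D : Measure X} {F : Set (X → ℝ)}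
  {O : List (WExample X) → X → ℝ} {p : Params} {f₀ : X → ℝ} {ω : ℕ → X × Bool}

omit [MeasurableSpace X] in
theorem wLoss_queried (A : CISub X) (f : X → ℝ) (m : ℕ) :
    wLoss (unitWeights (queried O A p ω m)) f =
      ∑ t ∈ Finset.range (tau m),
        if timeQuery O A p ω t (ω t).1 then (f (ω t).1 - labelVal (ω t).2) ^ 2 else 0 := by
  rw [← sum_queried (fun z => (f z.1 - labelVal z.2) ^ 2)]
  simp [wLoss, unitWeights, Function.comp_def]

omit [MeasurableSpace X] in
theorem wLoss_queried_sub (A : CISub X) (f g : X → ℝ) (m : ℕ) :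
    wLoss (unitWeights (queried O A p ω m)) f - wLoss (unitWeights (queried O A p ω m)) g =
      ∑ t ∈ Finset.range (tau m), lossDiff (timeQuery O A p ω t) f g (ω t) := by
  rw [wLoss_queried, wLoss_queried, ← Finset.sum_sub_distrib]
  refine Finset.sum_congr rfl fun t _ => ?_
  unfold lossDiff ind
  split_ifs <;> ring

section Good

variable {A : CISub X}

theorem GoodRun.wLoss_le (h : GoodRun D F O A p f₀ ω) {f : X → ℝ} (hf : f ∈ F)
    {m : ℕ} (hm : m ≤ p.M - 1) :
    wLoss (unitWeights (queried O A p ω m)) f₀ ≤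
      wLoss (unitWeights (queried O A p ω m)) f + 200 * p.L := by
  have h1 := h f hf 0 (tau m) (Nat.zero_le _) (tau_mono hm)
  have h2 : 0 ≤ ∑ t ∈ Finset.Ico 0 (tau m), regionDist D (timeQuery O A p ω t) f f₀ :=
    Finset.sum_nonneg fun t _ => regionDist_nonneg _ _ _ _
  rw [← Finset.range_eq_Ico, ← wLoss_queried_sub] at h1
  rw [← Finset.range_eq_Ico] at h2
  linarith

theorem GoodRun.center_mem (hO : IsRegressionOracle F O) (h : GoodRun D F O A p f₀ ω)
    (hf₀ : f₀ ∈ F) {m : ℕ} (hm : m ≤ p.M - 1) {β : ℝ} (hβ : 200 * p.L ≤ β) :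
    f₀ ∈ activeSet F O (queried O A p ω m) β := by
  refine ⟨hf₀, ?_⟩
  have := h.wLoss_le (hO (unitWeights (queried O A p ω m))).1 hm
  unfold fhat
  linarith

/-- On the window between the two epochs `f` cannot beat `f₀` by more than `200 L`, so a small
excess over `f₀` in epoch `m` was small in epoch `k`. Passing from `f₀` to the earlier empirical
minimizer costs another `200 L`. -/
theorem GoodRun.activeSet_subset (hO : IsRegressionOracle F O) (h : GoodRun D F O A p f₀ ω)
    (hf₀ : f₀ ∈ F) {k m : ℕ} (hkm : k ≤ m) (hm : m ≤ p.M - 1) {β β' : ℝ}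
    (hβ : β + 400 * p.L ≤ β') :
    activeSet F O (queried O A p ω m) β ⊆ activeSet F O (queried O A p ω k) β' := by
  rintro f ⟨hf, hfm⟩
  refine ⟨hf, ?_⟩
  have h1 := h f hf (tau k) (tau m) (tau_mono hkm) (tau_mono hm)
  have h2 : 0 ≤ ∑ t ∈ Finset.Ico (tau k) (tau m), regionDist D (timeQuery O A p ω t) f f₀ :=
    Finset.sum_nonneg fun t _ => regionDist_nonneg _ _ _ _
  rw [Finset.sum_Ico_eq_sub (fun t => lossDiff (timeQuery O A p ω t) f f₀ (ω t)) (tau_mono hkm),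
    ← wLoss_queried_sub, ← wLoss_queried_sub] at h1
  have h3 := (hO (unitWeights (queried O A p ω m))).2 f₀ hf₀
  have h4 := h.wLoss_le (hO (unitWeights (queried O A p ω k))).1 (hkm.trans hm)
  unfold fhat at hfm ⊢
  linarith

theorem GoodRun.sum_regionDist_le (hO : IsRegressionOracle F O) (h : GoodRun D F O A p f₀ ω)
    (hf₀ : f₀ ∈ F) {m : ℕ} (hm : m ≤ p.M - 1) {β : ℝ} {f : X → ℝ}
    (hf : f ∈ activeSet F O (queried O A p ω m) β) :
    ∑ t ∈ Finset.range (tau m), regionDist D (timeQuery O A p ω t) f f₀ ≤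
      8 * (β + 200 * p.L) := by
  have h1 := h f hf.1 0 (tau m) (Nat.zero_le _) (tau_mono hm)
  rw [← Finset.range_eq_Ico, ← wLoss_queried_sub] at h1
  have h3 := (hO (unitWeights (queried O A p ω m))).2 f₀ hf₀
  have h4 := hf.2
  unfold fhat at h4
  linarith

end Good

variable {srch : Params → ℕ → List (X × Bool) → X → Bool → OracleProg X ℝ} {inn out : ℕ → ℝ}

omit [MeasurableSpace X] in
theorem epochQuery_iff {m : ℕ} {x : X} :
    epochQuery O (mkSub srch) p ω m x = true ↔
      (∀ b, p.shift m (searchValue srch O p m (queried O (mkSub srch) p ω (m - 1)) x b) < 1 / 2) ∧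
        ∃ b, p.shift m (searchValue srch O p m (queried O (mkSub srch) p ω (m - 1)) x b) <
          1 / 2 - p.gam :=
  queryFn_iff

/-- The outer active set of a later epoch lies in the inner active set of an earlier one, so search
values can decrease from the later to the earlier epoch except for `ζ`, which the offsets absorb.
Being queried is a pair of upper bounds on the shifted values. -/
theorem epochQuery_anti (hp : p.Valid) (hO : IsRegressionOracle F O)
    (hS : SearchSpec F O p srch inn out) (h : GoodRun D F O (mkSub srch) p f₀ ω) (hf₀ : f₀ ∈ F)
    {k m : ℕ} (hk : 1 ≤ k) (hkm : k ≤ m) (hm : m ≤ p.M) {x : X}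
    (hx : epochQuery O (mkSub srch) p ω m x = true) :
    epochQuery O (mkSub srch) p ω k x = true := by
  rcases hkm.eq_or_lt with rfl | hlt
  · exact hx
  have key : ∀ b, p.shift k (searchValue srch O p k (queried O (mkSub srch) p ω (k - 1)) x b) ≤
      p.shift m (searchValue srch O p m (queried O (mkSub srch) p ω (m - 1)) x b) := by
    intro b
    obtain ⟨f, hf, hfe⟩ := (hS.sandwich m (Finset.mem_Icc.2 ⟨hk.trans hkm, hm⟩)
      (queried O (mkSub srch) p ω (m - 1)) x b).1
    have hf' := h.activeSet_subset hO hf₀ (Nat.sub_le_sub_right hkm 1)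
      (Nat.sub_le_sub_right hm 1) (hS.step k m hk hlt hm) hf
    have := (hS.sandwich k (Finset.mem_Icc.2 ⟨hk, hkm.trans hm⟩)
      (queried O (mkSub srch) p ω (k - 1)) x b).2 f hf'
    exact shift_mono hp hlt (by linarith)
  rw [epochQuery_iff] at hx ⊢
  exact ⟨fun b => (key b).trans_lt (hx.1 b), hx.2.imp fun b hb => (key b).trans_lt hb⟩

-- The two one-sided searches exhibit functions whose values at `x` differ by more than `γ + ζ`, so
-- one of them is farther than half of that from `f₀`.
omit [MeasurableSpace X] in
theorem exists_far_of_epochQuery (hp : p.Valid) (hS : SearchSpec F O p srch inn out)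
    {m : ℕ} (hm : m ∈ Finset.Icc 1 p.M) {x : X}
    (hx : epochQuery O (mkSub srch) p ω m x = true) :
    ∃ f ∈ activeSet F O (queried O (mkSub srch) p ω (m - 1)) (out m),
      p.gam / 2 + p.zeta / 2 < |f x - f₀ x| := by
  obtain ⟨h1, b, hb⟩ := epochQuery_iff.1 hx
  have hgap := gap_of_shift hp hm hb (h1 (!b))
  obtain ⟨f, hf, hfe⟩ := (hS.sandwich m hm (queried O (mkSub srch) p ω (m - 1)) x b).1
  obtain ⟨g, hg, hge⟩ := (hS.sandwich m hm (queried O (mkSub srch) p ω (m - 1)) x (!b)).1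
  have hfg : p.gam + p.zeta < |f x - f₀ x| + |g x - f₀ x| := by
    have h3 : p.gam + p.zeta < |g x - f x| := by
      rw [lt_abs]
      cases b
      · left
        simp only [side, Bool.not_false, Bool.false_eq_true, if_false, if_true] at *
        linarith
      · right
        simp only [side, Bool.not_true, Bool.false_eq_true, if_false, if_true] at *
        linarith
    have h4 := abs_sub_le (g x) (f₀ x) (f x)
    rw [abs_sub_comm (f₀ x)] at h4
    linarith
  by_cases hc : p.gam / 2 + p.zeta / 2 < |f x - f₀ x|
  · exact ⟨f, hf, hc⟩
  · exact ⟨g, hg, by linarith⟩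

/-- Squared distances on the current query region, for functions in an active set. -/
theorem regionDist_epochQuery_le [IsProbabilityMeasure D] (hp : p.Valid) (hF : IsRegressionClass F)
    (hO : IsRegressionOracle F O) (hQm : ∀ m, Measurable (epochQuery O (mkSub srch) p ω m))
    (hS : SearchSpec F O p srch inn out) (h : GoodRun D F O (mkSub srch) p f₀ ω) (hf₀ : f₀ ∈ F)
    {m : ℕ} (hm : m + 1 ≤ p.M) {β : ℝ} {f : X → ℝ}
    (hf : f ∈ activeSet F O (queried O (mkSub srch) p ω m) β) :
    tau m * regionDist D (epochQuery O (mkSub srch) p ω (m + 1)) f f₀ ≤ 8 * (β + 200 * p.L) := by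
  refine le_trans ?_ (h.sum_regionDist_le hO hf₀ (Nat.le_sub_one_of_lt hm) hf)
  rw [← nsmul_eq_mul, ← Finset.card_range (tau m), ← Finset.sum_const, Finset.card_range]
  -- Every past query region contains the current one, so each past time contributes at least the
  -- distance on the current region.
  refine Finset.sum_le_sum fun t ht => ?_
  have hint := fun k => integrable_region D (hQm k) (hF.measurable f hf.1) (hF.measurable f₀ hf₀)
    (hF.range f hf.1) (hF.range f₀ hf₀)
  refine integral_mono (hint _) (hint _) fun x => ?_
  refine mul_le_mul_of_nonneg_right ?_ (sq_nonneg _)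
  have hle : epochOf t ≤ m := by
    by_contra hcon
    have h1 := tau_mono (show m ≤ epochOf t - 1 by omega)
    have h2 := tau_epochOf_le t
    rw [Finset.mem_range] at ht
    omega
  by_cases hx : epochQuery O (mkSub srch) p ω (m + 1) x = true
  · have h1 : timeQuery O (mkSub srch) p ω t x = true :=
      epochQuery_anti hp hO hS h hf₀ (Nat.succ_pos _) (hle.trans (Nat.le_succ m)) hm hx
    rw [hx, h1]
  · rw [Bool.not_eq_true] at hx
    rw [hx]
    exact (ind_mem_Icc _).1

/-- The probability of the query region. -/
theorem prob_epochQuery_le [IsProbabilityMeasure D] (hp : p.Valid) (hF : IsRegressionClass F)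
    (hO : IsRegressionOracle F O) (hQm : ∀ m, Measurable (epochQuery O (mkSub srch) p ω m))
    (hS : SearchSpec F O p srch inn out) (h : GoodRun D F O (mkSub srch) p f₀ ω) (hf₀ : f₀ ∈ F)
    (hθ : disCoeffSup F f₀ (p.gam / 2) ≠ ⊤) {m : ℕ} (hm1 : 1 ≤ m) (hm : m + 1 ≤ p.M) :
    tau m * ∫ x, ind (epochQuery O (mkSub srch) p ω (m + 1) x) ∂D ≤
      (disCoeffSup F f₀ (p.gam / 2)).toReal * (57728 * ((p.M : ℝ) - m) * p.L / p.gam ^ 2) := by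
  have hτ : (0 : ℝ) < tau m := by
    unfold tau; rw [if_neg (by omega)]; positivity
  have hmem : m + 1 ∈ Finset.Icc 1 p.M := Finset.mem_Icc.2 ⟨by omega, hm⟩
  have hout := hS.out_le (m + 1) hmem
  have hL := hp.one_le_L
  have hMm : (1 : ℝ) ≤ (p.M : ℝ) - m := by
    have : (m : ℝ) + 1 ≤ p.M := by exact_mod_cast hm
    linarith
  -- `1804 = 1604 + 200`; dividing by `(γ / 2)²` then gives `57728 = 8 · 1804 · 4`.
  have hr : 0 < 8 * (1804 * ((p.M : ℝ) - m) * p.L) / tau m := by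
    have : 0 < (p.M : ℝ) - m := by linarith
    have : 0 < p.L := by linarith
    positivity
  have hγ := hp.gam_pos
  have hζ := hp.zeta_pos
  have h1 := region_prob_le (F := F) (f₀ := f₀) (D := D) (hQm (m + 1))
    (show 0 < p.gam / 2 by positivity) (show p.gam / 2 < p.gam / 2 + p.zeta / 2 by linarith) hr
    (fun x hx => by
      obtain ⟨f, hf, hfx⟩ := exists_far_of_epochQuery (f₀ := f₀) hp hS hmem hx
      refine ⟨f, hf.1, hfx, ?_⟩
      have h2 := regionDist_epochQuery_le hp hF hO hQm hS h hf₀ hm hf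
      rw [le_div_iff₀ hτ, mul_comm]
      refine h2.trans ?_
      push_cast at hout
      nlinarith [mul_le_mul_of_nonneg_right hMm (by linarith : (0 : ℝ) ≤ p.L)]) hθ
  have h2 := mul_le_mul_of_nonneg_left h1 hτ.le
  refine h2.trans (le_of_eq ?_)
  field_simp
  ring

/-- The expected number of queries. -/
theorem sum_prob_timeQuery_le [IsProbabilityMeasure D] (hp : p.Valid) (hF : IsRegressionClass F)
    (hO : IsRegressionOracle F O) (hQm : ∀ m, Measurable (epochQuery O (mkSub srch) p ω m))
    (hS : SearchSpec F O p srch inn out) (h : GoodRun D F O (mkSub srch) p f₀ ω) (hf₀ : f₀ ∈ F)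
    (hθ : disCoeffSup F f₀ (p.gam / 2) ≠ ⊤) {m : ℕ} (hm : m + 2 ≤ p.M) :
    ∑ t ∈ Finset.range (tau (m + 1)), ∫ x, ind (timeQuery O (mkSub srch) p ω t x) ∂D ≤
      2 + m * ((disCoeffSup F f₀ (p.gam / 2)).toReal * (57728 * p.M * p.L / p.gam ^ 2)) := by
  induction m with
  -- Epoch 1 has two examples, both counted with probability `1`.
  | zero =>
    have : ∀ t, ∫ x, ind (timeQuery O (mkSub srch) p ω t x) ∂D ≤ 1 := fun t => by
      unfold timeQuery
      rw [integral_ind D (hQm _)]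
      exact measureReal_le_one
    refine (Finset.sum_le_card_nsmul _ _ 1 fun t _ => this t).trans ?_
    simp [tau]
  | succ m ih =>
    rw [← Finset.sum_range_add_sum_Ico _ (tau_mono (Nat.le_succ (m + 1)))]
    have h1 := ih (by omega)
    have h2 := prob_epochQuery_le hp hF hO hQm hS h hf₀ hθ (m := m + 1) (by omega) (by omega)
    have h3 : ∑ t ∈ Finset.Ico (tau (m + 1)) (tau (m + 1 + 1)),
        ∫ x, ind (timeQuery O (mkSub srch) p ω t x) ∂D =
        tau (m + 1) * ∫ x, ind (epochQuery O (mkSub srch) p ω (m + 1 + 1) x) ∂D := by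
      -- From epoch 2 on, an epoch is exactly as long as everything before it.
      have hcard : (Finset.Ico (tau (m + 1)) (tau (m + 1 + 1))).card = tau (m + 1) := by
        rw [Nat.card_Ico]; simp only [tau, Nat.succ_ne_zero, if_false]; rw [pow_succ 2 (m + 1)]; omega
      rw [← nsmul_eq_mul, ← hcard, ← Finset.sum_const, hcard]
      refine Finset.sum_congr rfl fun t ht => ?_
      rw [Finset.mem_Ico] at ht
      unfold timeQuery
      rw [epochOf_eq ht.1 ht.2]
    have h4 : (disCoeffSup F f₀ (p.gam / 2)).toReal *
        (57728 * ((p.M : ℝ) - (m + 1 : ℕ)) * p.L / p.gam ^ 2) ≤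
        (disCoeffSup F f₀ (p.gam / 2)).toReal * (57728 * p.M * p.L / p.gam ^ 2) := by
      have hL := hp.one_le_L
      have hm0 : (0 : ℝ) ≤ (m + 1 : ℕ) := Nat.cast_nonneg _
      refine mul_le_mul_of_nonneg_left ?_ ENNReal.toReal_nonneg
      gcongr
      linarith
    rw [h3]
    push_cast at *
    linarith

end Runs

/-! ### Chow's error -/

/-- Conditional cost of a prediction when `e` is the probability of a positive label. -/
def condCost (γ e : ℝ) : Option Bool → ℝ
  | none => 1 / 2 - γ
  | some true => 1 - e
  | some false => e

section Cost

variable {X : Type u} [MeasurableSpace X]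

theorem measurable_condCost {γ : ℝ} {η : X → ℝ} (hη : Measurable η) {h : X → Option Bool}
    (hh : ∀ o, MeasurableSet {x | h x = o}) : Measurable fun x => condCost γ (η x) (h x) := by
  have : (fun x => condCost γ (η x) (h x)) = fun x =>
      {x | h x = none}.indicator (fun _ => 1 / 2 - γ) x +
        ({x | h x = some true}.indicator (fun x => 1 - η x) x +
          {x | h x = some false}.indicator η x) := by
    ext1 x
    rcases hx : h x with _ | _ | _ <;> simp [condCost, Set.indicator, hx]
  rw [this]
  exact (measurable_const.indicator (hh _)).add
    (((hη.const_sub 1).indicator (hh _)).add (hη.indicator (hh _)))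

theorem integrable_condCost {D : Measure X} [IsProbabilityMeasure D] {γ : ℝ} {η : X → ℝ}
    (hη : Measurable η) (hr : ∀ x, η x ∈ Set.Icc (0 : ℝ) 1) {h : X → Option Bool}
    (hh : ∀ o, MeasurableSet {x | h x = o}) :
    Integrable (fun x => condCost γ (η x) (h x)) D := by
  refine integrable_of_mem_Icc (c := 1 + |1 / 2 - γ|) D (measurable_condCost hη hh) fun x => ?_
  have h0 := abs_nonneg (1 / 2 - γ)
  have h1 := hr x
  rcases h x with _ | _ | _
  · simp only [condCost]; linarith
  · simp only [condCost]; rw [abs_of_nonneg h1.1]; linarith [h1.2]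
  · simp only [condCost]; rw [abs_of_nonneg (by linarith [h1.2])]; linarith [h1.1]

/-- The pointwise cost is affine in the encoded label, so integration replaces the label by `η`. -/
theorem chowErr_eq {P : Measure (X × Bool)} [IsProbabilityMeasure P] {η : X → ℝ}
    (hη : IsCondProb P η) (γ : ℝ) {h : X → Option Bool} (hh : ∀ o, MeasurableSet {x | h x = o}) :
    chowErr P γ h = ∫ x, condCost γ (η x) (h x) ∂P.fst := by
  have hN : MeasurableSet {z : X × Bool | h z.1 = none} := measurable_fst (hh none)
  have hy : ∀ y : Bool, MeasurableSet {z : X × Bool | z.2 = y} := fun y =>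
    measurable_snd (measurableSet_singleton y)
  have hf : ∀ o, MeasurableSet {z : X × Bool | h z.1 = o} := fun o => measurable_fst (hh o)
  have hE : MeasurableSet {z : X × Bool | h z.1 ≠ some z.2 ∧ h z.1 ≠ none} := by
    have : {z : X × Bool | h z.1 ≠ some z.2 ∧ h z.1 ≠ none} =
        ({z : X × Bool | h z.1 = some true} ∩ {z | z.2 = false}) ∪
          ({z : X × Bool | h z.1 = some false} ∩ {z | z.2 = true}) := by
      ext ⟨x, y⟩
      rcases hx : h x with _ | _ | _ <;> cases y <;> simp [hx]
    rw [this]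
    exact ((hf _).inter (hy _)).union ((hf _).inter (hy _))
  set g₁ : X → ℝ := fun x => condCost γ 0 (h x) with hg₁
  set g₂ : X → ℝ := fun x => condCost γ 1 (h x) - condCost γ 0 (h x) with hg₂
  have hm₁ : Measurable g₁ := measurable_condCost measurable_const hh
  have hm₂ : Measurable g₂ := (measurable_condCost measurable_const hh).sub hm₁
  have hb₁ : Integrable g₁ P.fst :=
    integrable_condCost measurable_const (fun _ => by simp) hh
  have hb₂ : ∀ x, |g₂ x| ≤ 1 := fun x => by
    simp only [hg₂]; rcases h x with _ | _ | _ <;> simp [condCost]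
  have e1 : chowErr P γ h = ∫ z, g₁ z.1 + g₂ z.1 * labelVal z.2 ∂P := by
    unfold chowErr
    rw [← integral_indicator_one hE, ← integral_indicator_one hN, ← integral_const_mul,
      ← integral_add ((integrable_const 1).indicator hE)
        (((integrable_const 1).indicator hN).const_mul _)]
    refine integral_congr_ae (ae_of_all _ ?_)
    rintro ⟨x, y⟩
    rcases hx : h x with _ | _ | _ <;> cases y <;>
      simp [hg₁, hg₂, Set.indicator, hx, condCost, labelVal]
  have hi₁ : Integrable (fun z : X × Bool => g₁ z.1) P :=
    (integrable_map_measure hm₁.aestronglyMeasurable measurable_fst.aemeasurable).1 hb₁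
  have hi₂ : Integrable (fun z : X × Bool => g₂ z.1 * labelVal z.2) P := by
    refine integrable_of_mem_Icc (c := 1) P
      ((hm₂.comp measurable_fst).mul (measurable_labelVal.comp measurable_snd)) fun z => ?_
    rw [abs_mul]
    rcases labelVal_mem z.2 with h' | h' <;> rw [h'] <;> simp [hb₂ z.1]
  have hi₃ : Integrable (fun x => g₂ x * η x) P.fst := by
    refine integrable_of_mem_Icc (c := 1) _ (hm₂.mul hη.measurable) fun x => ?_
    rw [abs_mul, abs_of_nonneg (hη.range x).1]
    nlinarith [hb₂ x, (hη.range x).2, (hη.range x).1, abs_nonneg (g₂ x)]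
  rw [e1, integral_add hi₁ hi₂, integral_mul_labelVal hη hm₂, integral_comp_fst hm₁,
    ← integral_add hb₁ hi₃]
  refine integral_congr_ae (ae_of_all _ fun x => ?_)
  simp only [hg₁, hg₂]
  rcases h x with _ | _ | _ <;> (simp [condCost]; try ring)

theorem err_eq {P : Measure (X × Bool)} [IsProbabilityMeasure P] {η : X → ℝ}
    (hη : IsCondProb P η) (γ : ℝ) {h : X → Bool} (hh : ∀ y, MeasurableSet {x | h x = y}) :
    err P h = ∫ x, condCost γ (η x) (some (h x)) ∂P.fst := by
  have hs : ∀ o, MeasurableSet {x | some (h x) = o} := by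
    rintro (_ | y)
    · simp
    · simpa using hh y
  rw [← chowErr_eq hη γ hs]
  simp [chowErr, err]

theorem measurableSet_signClassifier {f : X → ℝ} (hf : Measurable f) (y : Bool) :
    MeasurableSet {x | signClassifier f x = y} := by
  have : Measurable (signClassifier f) := by
    unfold signClassifier
    exact measurable_decide (measurableSet_le measurable_const (by fun_prop))
  exact this (measurableSet_singleton y)

end Cost

/-! ### Excess error on the good event -/

theorem signClassifier_eq_true {X : Type u} {f : X → ℝ} {x : X} : signClassifier f x = true ↔ 1 / 2 ≤ f x := by
  unfold signClassifier
  rw [decide_eq_true_eq]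
  constructor <;> intro h <;> linarith

theorem signClassifier_eq_false {X : Type u} {f : X → ℝ} {x : X} : signClassifier f x = false ↔ f x < 1 / 2 := by
  rw [← Bool.not_eq_true, signClassifier_eq_true, not_le]

theorem signClassifier_ne {X : Type u} {f g : X → ℝ} {x : X} (h : signClassifier f x ≠ signClassifier g x) :
    (f x < 1 / 2 ∧ 1 / 2 ≤ g x) ∨ (1 / 2 ≤ f x ∧ g x < 1 / 2) := by
  cases h1 : signClassifier f x
  · rw [h1, ne_eq, eq_comm, Bool.not_eq_false, signClassifier_eq_true] at h
    exact Or.inl ⟨signClassifier_eq_false.1 h1, h⟩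
  · rw [h1, ne_eq, eq_comm, Bool.not_eq_true, signClassifier_eq_false] at h
    exact Or.inr ⟨signClassifier_eq_true.1 h1, h⟩

section Excess

variable {X : Type u} [MeasurableSpace X] {D : Measure X} {F : Set (X → ℝ)}
  {O : List (WExample X) → X → ℝ} {p : Params} {f₀ : X → ℝ} {ω : ℕ → X × Bool}
  {srch : Params → ℕ → List (X × Bool) → X → Bool → OracleProg X ℝ} {inn out : ℕ → ℝ}

/-- A prediction with a confidence interval that is not queried is correct up to `ε`. -/
theorem condCost_sub_le (hp : p.Valid) (hO : IsRegressionOracle F O)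
    (hS : SearchSpec F O p srch inn out) (h : GoodRun D F O (mkSub srch) p f₀ ω) (hf₀ : f₀ ∈ F)
    {η : X → ℝ} (hε : ∀ x, |f₀ x - η x| ≤ p.eps) (x : X) :
    condCost p.gam (η x) (output O (mkSub srch) p ω x) -
        condCost p.gam (η x) (some (signClassifier η x)) ≤
      2 * p.eps + (ind (epochQuery O (mkSub srch) p ω p.M x) *
        (fhat O (queried O (mkSub srch) p ω (p.M - 1)) x - f₀ x) ^ 2 / p.gam +
          ind (epochQuery O (mkSub srch) p ω p.M x) * p.gam) := by
  have hM : p.M ∈ Finset.Icc 1 p.M :=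
    Finset.mem_Icc.2 ⟨by have := hp.three_le_M; omega, le_rfl⟩
  set B := queried O (mkSub srch) p ω (p.M - 1) with hB
  set fh := fhat O B with hfh
  have hL := hp.one_le_L
  have hγ := hp.gam_pos
  have hε0 := hp.eps_pos
  have hinn := hS.le_inn p.M hM
  have hc : f₀ ∈ activeSet F O B (inn p.M) := h.center_mem hO hf₀ le_rfl hinn
  have hfhm : fh ∈ activeSet F O B (inn p.M) := fhat_mem_activeSet hO B (by linarith)
  have hsand := fun b => (hS.sandwich p.M hM B x b).2
  have hx := abs_le.1 (hε x)
  set q := epochQuery O (mkSub srch) p ω p.M x with hq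
  have hnn : 0 ≤ ind q * (fh x - f₀ x) ^ 2 / p.gam + ind q * p.gam := by
    have := (ind_mem_Icc q).1
    positivity
  have hbayes : condCost p.gam (η x) (some (signClassifier η x)) = min (η x) (1 - η x) := by
    cases hs : signClassifier η x
    · rw [signClassifier_eq_false] at hs
      simp only [condCost]; rw [min_eq_left]; linarith
    · rw [signClassifier_eq_true] at hs
      simp only [condCost]; rw [min_eq_right]; linarith
  unfold output
  rw [← hB, ← hfh]
  by_cases hnone : classifier p.gam (bounds O (mkSub srch) p p.M B) fh x = none
  · rw [hnone, hbayes]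
    rw [classifier_eq_none_iff, mkSub_bounds] at hnone
    change _ ∨ (_ ≤ p.shift p.M (searchValue srch O p p.M B x false) ∧ _) at hnone
    have h1 := hsand false _ hc
    have h2 := hsand true _ hc
    simp only [side, Bool.false_eq_true, if_false, if_true] at h1 h2
    rcases hnone with hn | ⟨hn1, hn2⟩
    · exact absurd (shift_add_le_one hp le_rfl h1 h2) (not_le.2 hn)
    -- Abstention forces `f₀` to within `γ + ε` of `1 / 2`, hence the Bayes cost is at least `1 / 2
    -- - γ - 2 ε`.
    · have h3 := value_ge_of_shift_ge hp le_rfl h1 hn1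
      have h4 := value_ge_of_shift_ge hp le_rfl h2
        (show 1 / 2 - p.gam ≤ p.shift p.M (searchValue srch O p p.M B x true) by
          unfold searchValue; linarith)
      have h5 : 1 / 2 - p.gam - 2 * p.eps ≤ min (η x) (1 - η x) :=
        le_min (by linarith) (by linarith)
      simp only [condCost]
      linarith
  · have hsome : classifier p.gam (bounds O (mkSub srch) p p.M B) fh x =
        some (signClassifier fh x) := by
      unfold classifier at hnone ⊢
      split_ifs at hnone ⊢
      · simp at hnone
      · rfl
    rw [hsome]
    have hcross : signClassifier fh x ≠ signClassifier η x →
        2 * |η x - 1 / 2| ≤ 2 * p.eps + (ind q * (fh x - f₀ x) ^ 2 / p.gam + ind q * p.gam) := by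
      intro hne
      by_cases hqt : q = true
      · have h6 : 2 * |fh x - f₀ x| ≤ (fh x - f₀ x) ^ 2 / p.gam + p.gam := by
          rw [← sub_nonneg, ← sq_abs]
          have : |fh x - f₀ x| ^ 2 / p.gam + p.gam - 2 * |fh x - f₀ x| =
              (|fh x - f₀ x| - p.gam) ^ 2 / p.gam := by field_simp; ring
          rw [this]; positivity
        have h7 : |η x - 1 / 2| ≤ p.eps + |fh x - f₀ x| := by
          have h8 := abs_le.1 (le_refl |fh x - f₀ x|)
          rcases signClassifier_ne hne with ⟨h1, h2⟩ | ⟨h1, h2⟩ <;>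
            rw [abs_le] <;> constructor <;> linarith [h8.1, h8.2]
        rw [hqt]
        simp only [ind, if_true, one_mul]
        linarith
      -- Neither queried nor abstained: one bound is beyond `1 / 2`, so `f₀` and the empirical
      -- minimizer lie on the same side, and a wrong sign needs `|η - 1/2| ≤ ε`.
      · have h5 : ∃ b, 1 / 2 ≤ p.shift p.M (searchValue srch O p p.M B x b) := by
          by_contra! hcon
          refine hqt ?_
          rw [hq, epochQuery_iff]
          refine ⟨hcon, ?_⟩
          by_contra! hcon2
          refine hnone ?_
          rw [classifier_eq_none_iff, mkSub_bounds]
          have h3 := hcon2 false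
          have h4 := hcon2 true
          unfold searchValue at h3 h4
          exact Or.inr ⟨h3, by simp only; linarith⟩
        obtain ⟨b, hb⟩ := h5
        have h6 : 1 / 2 + p.zeta < searchValue srch O p p.M B x b := by
          by_contra! hcon
          exact absurd (shift_lt_half hp le_rfl hcon) (not_lt.2 hb)
        have h7 := hsand b _ hc
        have h8 := hsand b _ hfhm
        have h9 : |η x - 1 / 2| ≤ p.eps := by
          cases b <;> simp only [side, Bool.false_eq_true, if_false, if_true] at h7 h8 <;>
            rcases signClassifier_ne hne with ⟨h1, h2⟩ | ⟨h1, h2⟩ <;>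
            rw [abs_le] <;> constructor <;> linarith
        linarith
    by_cases heq : signClassifier fh x = signClassifier η x
    · rw [heq]; linarith
    · have h3 := hcross heq
      refine le_trans ?_ h3
      have h4 := abs_le.1 (le_refl |η x - 1 / 2|)
      cases h1 : signClassifier fh x <;> cases h2 : signClassifier η x <;>
        simp only [condCost] <;> linarith [h4.1, h4.2, abs_nonneg (η x - 1 / 2)]

theorem chowErr_sub_err_le {P : Measure (X × Bool)} [IsProbabilityMeasure P] {η : X → ℝ}
    (hη : IsCondProb P η) (hp : p.Valid) (hF : IsRegressionClass F) (hO : IsRegressionOracle F O)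
    (hOm : MeasurableOracle O) (hA : MeasurableBounds O (mkSub srch) p)
    (hS : SearchSpec F O p srch inn out) (h : GoodRun P.fst F O (mkSub srch) p f₀ ω) (hf₀ : f₀ ∈ F)
    (hε : ∀ x, |f₀ x - η x| ≤ p.eps) (hθ : disCoeffSup F f₀ (p.gam / 2) ≠ ⊤) :
    chowErr P p.gam (output O (mkSub srch) p ω) - err P (signClassifier η) ≤
      200000 * p.eps * Real.log (p.T / p.del) * (disCoeffSup F f₀ (p.gam / 2)).toReal := by
  have hM3 := hp.three_le_M
  set fh := fhat O (queried O (mkSub srch) p ω (p.M - 1)) with hfh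
  have hfhF : fh ∈ F := (hO _).1
  have hQm : ∀ m, Measurable (epochQuery O (mkSub srch) p ω m) := fun m =>
    (measurable_epochQuery hOm hA m).comp measurable_prodMk_left
  have hbm : Measurable (bounds O (mkSub srch) p p.M (queried O (mkSub srch) p ω (p.M - 1))) :=
    (hA p.M).comp measurable_prodMk_left
  have ho : ∀ o, MeasurableSet {x | output O (mkSub srch) p ω x = o} := fun o =>
    measurableSet_classifier p.gam hbm (hF.measurable fh hfhF) o
  have hs := measurableSet_signClassifier hη.measurable
  have hs' : ∀ o, MeasurableSet {x | some (signClassifier η x) = o} := by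
    rintro (_ | y)
    · simp
    · simpa using hs y
  have hi1 := integrable_condCost (D := P.fst) (γ := p.gam) hη.measurable hη.range ho
  have hi2 := integrable_condCost (D := P.fst) (γ := p.gam) hη.measurable hη.range hs'
  have hi3 := integrable_region P.fst (hQm p.M) (hF.measurable fh hfhF) (hF.measurable f₀ hf₀)
    (hF.range fh hfhF) (hF.range f₀ hf₀)
  have hi4 : Integrable (fun x => ind (epochQuery O (mkSub srch) p ω p.M x)) P.fst :=
    integrable_of_mem_Icc (c := 1) _ (measurable_ind.comp (hQm _)) fun x => by
      rw [abs_of_nonneg (ind_mem_Icc _).1]; exact (ind_mem_Icc _).2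
  have h1 : chowErr P p.gam (output O (mkSub srch) p ω) - err P (signClassifier η) ≤
      2 * p.eps + (regionDist P.fst (epochQuery O (mkSub srch) p ω p.M) fh f₀ / p.gam +
        (∫ x, ind (epochQuery O (mkSub srch) p ω p.M x) ∂P.fst) * p.gam) := by
    rw [chowErr_eq hη p.gam ho, err_eq hη p.gam hs, ← integral_sub hi1 hi2]
    have hi5 : Integrable (fun x => ind (epochQuery O (mkSub srch) p ω p.M x) *
        (fh x - f₀ x) ^ 2 / p.gam + ind (epochQuery O (mkSub srch) p ω p.M x) * p.gam) P.fst :=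
      (hi3.div_const p.gam).add (hi4.mul_const p.gam)
    refine (integral_mono (hi1.sub hi2) ((integrable_const (2 * p.eps)).add hi5)
      fun x => condCost_sub_le hp hO hS h hf₀ hε x).trans_eq ?_
    simp only [Pi.add_apply]
    rw [integral_add (integrable_const _) hi5,
      integral_add (hi3.div_const p.gam) (hi4.mul_const p.gam), integral_div,
      integral_const, probReal_univ, one_smul, integral_mul_const]
    rfl
  have hMe : p.M - 1 + 1 = p.M := by omega
  -- The empirical minimizer has excess loss `0`, so its distance bound is `1600 L / τ`.
  have h2 := regionDist_epochQuery_le hp hF hO hQm hS h hf₀ (m := p.M - 1) (by omega) (β := 0)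
    (fhat_mem_activeSet hO _ le_rfl)
  have h3 := prob_epochQuery_le hp hF hO hQm hS h hf₀ hθ (m := p.M - 1) (by omega) (by omega)
  rw [hMe] at h2 h3
  rw [Nat.cast_sub (by omega), Nat.cast_one, sub_sub_cancel, mul_one] at h3
  rw [← hfh] at h2
  set R := regionDist P.fst (epochQuery O (mkSub srch) p ω p.M) fh f₀
  set p' := ∫ x, ind (epochQuery O (mkSub srch) p ω p.M x) ∂P.fst
  set θ := (disCoeffSup F f₀ (p.gam / 2)).toReal
  set ℓ := Real.log (p.T / p.del) with hℓ
  have hθ1 : 1 ≤ θ := by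
    have := ENNReal.toReal_mono hθ (one_le_disCoeffSup F f₀ (p.gam / 2))
    simpa using this
  have hℓ1 : 1 < ℓ := hp.one_lt_log
  have hε0 := hp.eps_pos
  have hγ := hp.gam_pos
  have hτ := hp.le_tau
  have hT := hp.four_lt_T
  have hL : p.L = p.eps * p.gam * p.T * ℓ := by rw [hp.mul_T]; rfl
  have hL1 := hp.one_le_L
  set τ : ℝ := ((tau (p.M - 1) : ℕ) : ℝ)
  have hτ0 : 0 < τ := by linarith
  -- This is where `T = d / (ε γ)` is chosen: `L / τ` is of order `ε γ log (T / δ)`.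
  have hLτ : p.L ≤ 2 * τ * (p.eps * p.gam * ℓ) := by
    rw [hL]
    have : 0 < p.eps * p.gam * ℓ := by positivity
    nlinarith
  have h4 : R / p.gam ≤ 3200 * p.eps * ℓ := by
    rw [div_le_iff₀ hγ]
    refine le_of_mul_le_mul_left ?_ hτ0
    nlinarith
  have h5 : p' * p.gam ≤ θ * (115456 * p.eps * ℓ) := by
    refine le_of_mul_le_mul_left ?_ hτ0
    calc τ * (p' * p.gam) = τ * p' * p.gam := by ring
      _ ≤ θ * (57728 * p.L / p.gam ^ 2) * p.gam := by gcongr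
      _ = θ * 57728 * (p.L / p.gam) := by field_simp
      _ ≤ θ * 57728 * (2 * τ * (p.eps * ℓ)) := by
        gcongr
        rw [div_le_iff₀ hγ]; linarith
      _ = _ := by ring
  have h6 : p.eps ≤ p.eps * ℓ * θ := by
    rw [mul_assoc]
    exact le_mul_of_one_le_right hε0.le (one_le_mul_of_one_le_of_one_le hℓ1.le hθ1)
  have h7 : p.eps * ℓ ≤ p.eps * ℓ * θ := le_mul_of_one_le_right (by positivity) hθ1
  linarith

omit [MeasurableSpace X] in
theorem labelCount_eq (A : CISub X) :
    (labelCount O A p ω : ℝ) =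
      ∑ t ∈ Finset.range (tau (p.M - 1)), ind (timeQuery O A p ω t (ω t).1) := by
  have h := sum_queried (O := O) (A := A) (p := p) (fun _ => 1) ω (p.M - 1)
  simpa [labelCount, ind] using h

theorem labelCount_le [IsProbabilityMeasure D] (hp : p.Valid) (hF : IsRegressionClass F)
    (hO : IsRegressionOracle F O) (hQm : ∀ m, Measurable (epochQuery O (mkSub srch) p ω m))
    (hS : SearchSpec F O p srch inn out) (h : GoodRun D F O (mkSub srch) p f₀ ω) (hf₀ : f₀ ∈ F)
    (hθ : disCoeffSup F f₀ (p.gam / 2) ≠ ⊤)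
    (hQ : ∑ t ∈ Finset.range (tau (p.M - 1)), ind (timeQuery O (mkSub srch) p ω t (ω t).1) ≤
      2 * (∑ t ∈ Finset.range (tau (p.M - 1)),
        ∫ x, ind (timeQuery O (mkSub srch) p ω t x) ∂D) + 3 * p.L) :
    (labelCount O (mkSub srch) p ω : ℝ) ≤
      2000000 * (p.d / p.gam ^ 2) * Real.log p.T ^ 2 * Real.log (p.T / p.del) *
        (disCoeffSup F f₀ (p.gam / 2)).toReal := by
  have hM3 := hp.three_le_M
  rw [labelCount_eq]
  refine hQ.trans ?_
  have h1 := sum_prob_timeQuery_le hp hF hO hQm hS h hf₀ hθ (m := p.M - 2) (by omega)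
  rw [show p.M - 2 + 1 = p.M - 1 by omega, Nat.cast_sub (by omega)] at h1
  set θ := (disCoeffSup F f₀ (p.gam / 2)).toReal
  have hθ1 : 1 ≤ θ := by
    have := ENNReal.toReal_mono hθ (one_le_disCoeffSup F f₀ (p.gam / 2))
    simpa using this
  have hM3' : (3 : ℝ) ≤ p.M := by exact_mod_cast hM3
  have hL1 := hp.one_le_L
  have hγ := hp.gam_pos
  have hγ1 := hp.gam_lt
  have hMl := hp.M_le_log
  have hV : 4 * p.L ≤ θ * (57728 * p.M * p.L / p.gam ^ 2) := by
    have h3 : 4 * p.L ≤ 57728 * p.M * p.L / p.gam ^ 2 := by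
      rw [le_div_iff₀ (by positivity)]
      have : p.gam ^ 2 ≤ 1 := by nlinarith
      nlinarith
    exact h3.trans (le_mul_of_one_le_left (by positivity) hθ1)
  set V := θ * (57728 * p.M * p.L / p.gam ^ 2) with hVdef
  have h4 : 2 * p.M * V ≤ 2000000 * (p.d / p.gam ^ 2) * Real.log p.T ^ 2 *
      Real.log (p.T / p.del) * θ := by
    have h5 : (p.M : ℝ) ^ 2 ≤ (3 * Real.log p.T) ^ 2 := by gcongr
    calc 2 * p.M * V = 115456 * (p.M : ℝ) ^ 2 * (θ * p.L / p.gam ^ 2) := by rw [hVdef]; ring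
      _ ≤ 115456 * (3 * Real.log p.T) ^ 2 * (θ * p.L / p.gam ^ 2) := by gcongr
      _ = 1039104 * (Real.log p.T ^ 2 * (θ * p.L / p.gam ^ 2)) := by ring
      _ ≤ 2000000 * (Real.log p.T ^ 2 * (θ * p.L / p.gam ^ 2)) := by gcongr; norm_num
      _ = _ := by unfold Params.L; ring
  refine le_trans ?_ h4
  have : (0 : ℝ) ≤ V := by linarith
  push_cast at h1
  nlinarith

end Excess

/-- The statistical guarantee of the algorithm, for a search procedure with accurate values. -/
theorem statGuarantee_of_search {X : Type u} [MeasurableSpace X] {F : Set (X → ℝ)}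
    {O : List (WExample X) → X → ℝ} {p : Params}
    {srch : Params → ℕ → List (X × Bool) → X → Bool → OracleProg X ℝ} {inn out : ℕ → ℝ}
    (hp : p.Valid) (hF : IsRegressionClass F) (hd : pdim F = p.d) (hO : IsRegressionOracle F O)
    (hOm : MeasurableOracle O) (hA : MeasurableBounds O (mkSub srch) p)
    (hS : SearchSpec F O p srch inn out) {C : ℝ} (hC : 2000000 ≤ C) :
    StatGuarantee C F O (mkSub srch) p := by
  intro P _ η hη κ hκ f₀ hf₀ hκη
  have hε : ∀ x, |f₀ x - η x| ≤ p.eps := fun x => (hκη x).trans hκ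
  have hM3 := hp.three_le_M
  have hn : 0 < tau (p.M - 1) := by unfold tau; rw [if_neg (by omega)]; positivity
  have hQm : ∀ m ω, Measurable (epochQuery O (mkSub srch) p ω m) := fun m ω =>
    (measurable_epochQuery hOm hA m).comp measurable_prodMk_left
  obtain ⟨S, hS1, hS2⟩ := exists_good_event hη hF hd.le hf₀ hε
    (Q := fun t ω => timeQuery O (mkSub srch) p ω t) (fun t => measurable_epochQuery hOm hA _)
    (fun t ω ω' h => timeQuery_congr h) hn hp.del_pos hp.one_le_L hp.d_log_le hp.log_inv_del_le
    hp.log_window_le hp.tau_mul_sq_le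
  refine (measure_mono fun ω hω => ?_).trans hS1
  by_contra hωS
  obtain ⟨hgood, hcount⟩ := hS2 ω hωS
  refine hω ?_
  have hε0 := hp.eps_pos
  have hγ := hp.gam_pos
  have hδ := hp.del_pos
  have hTδ : (p.d : ℝ) / (p.eps * p.gam * p.del) = p.T / p.del := by
    unfold Params.T; field_simp
  have hT : (p.d : ℝ) / (p.eps * p.gam) = p.T := rfl
  rw [hTδ, hT]
  have hℓ : 1 < Real.log (p.T / p.del) := hp.one_lt_log
  have hℓT := hp.log_T
  have hd1 := hp.one_le_d
  by_cases hθ : disCoeffSup F f₀ (p.gam / 2) = ⊤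
  -- With an infinite coefficient the bounds are trivial, provided that the prefactors are nonzero,
  -- since `0 * ⊤ = 0`.
  · rw [hθ, ENNReal.mul_top, ENNReal.mul_top]
    · exact ⟨le_top, le_top⟩
    · rw [← pos_iff_ne_zero, ENNReal.ofReal_pos]
      have : 0 < Real.log p.T := by linarith
      positivity
    · rw [← pos_iff_ne_zero, ENNReal.ofReal_pos]
      positivity
  · have h1 := chowErr_sub_err_le hη hp hF hO hOm hA hS hgood hf₀ hε hθ
    have h2 := labelCount_le hp hF hO (fun m => hQm m ω) hS hgood hf₀ hθ hcount
    rw [← ENNReal.ofReal_toReal hθ]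
    have h0 : (0 : ℝ) ≤ (disCoeffSup F f₀ (p.gam / 2)).toReal := ENNReal.toReal_nonneg
    rw [← ENNReal.ofReal_mul' h0, ← ENNReal.ofReal_mul' h0, ← ENNReal.ofReal_natCast]
    refine ⟨ENNReal.ofReal_le_ofReal (h1.trans ?_), ENNReal.ofReal_le_ofReal (h2.trans ?_)⟩
    · gcongr; linarith
    · gcongr

/-! ### Call counts -/

section Counts

variable {X : Type u} {O : List (WExample X) → X → ℝ} {p : Params}

theorem length_epochExamples_le (ω : ℕ → X × Bool) {m : ℕ} (hm : 1 ≤ m) :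
    (epochExamples ω m).length ≤ 2 ^ m := by
  simp only [epochExamples, List.length_map, List.length_range']
  refine (Nat.sub_le _ _).trans ?_
  unfold tau
  rw [if_neg (by omega)]

theorem trainingCalls_le {A : CISub X} {k : ℕ → ℝ}
    (hk : ∀ m ∈ Finset.Icc 1 (p.M - 1), ∀ B x, (((A p m B x).calls O : ℕ) : ℝ) ≤ k m)
    (hk0 : ∀ m ∈ Finset.Icc 1 (p.M - 1), 0 ≤ k m) (ω : ℕ → X × Bool) :
    (trainingCalls O A p ω : ℝ) ≤ p.M + ∑ m ∈ Finset.Icc 1 (p.M - 1), 2 ^ m * k m := by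
  unfold trainingCalls
  rw [Nat.cast_add, Nat.cast_sum]
  gcongr with m hm
  have h1 : ∀ l : List (X × Bool), (((l.map fun z =>
      (A p m (queried O A p ω (m - 1)) z.1).calls O).sum : ℕ) : ℝ) ≤ l.length * k m := by
    intro l
    induction l with
    | nil => simp
    | cons z l ih =>
      rw [List.map_cons, List.sum_cons, List.length_cons, Nat.cast_add, Nat.cast_add_one]
      linarith [hk m hm (queried O A p ω (m - 1)) z.1]
  refine (h1 _).trans ?_
  have h2 := length_epochExamples_le ω (Finset.mem_Icc.1 hm).1
  gcongr
  · exact hk0 m hm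
  · exact_mod_cast h2

/-- Early epochs, with more radii per test, are geometrically shorter, so the factor `M - m + 1`
costs only a constant in total. -/
theorem sum_two_pow_mul_le (K M : ℕ) (h : K ≤ M) :
    ∑ m ∈ Finset.Icc 1 K, (2 : ℝ) ^ m * ((M : ℝ) - m + 1) ≤ 2 ^ (K + 1) * ((M : ℝ) - K + 2) := by
  induction K with
  | zero => simp; positivity
  | succ K ih =>
    rw [Finset.sum_Icc_succ_top (by omega)]
    have h1 := ih (by omega)
    push_cast
    have h2 : (2 : ℝ) ^ (K + 1 + 1) = 2 * 2 ^ (K + 1) := by ring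
    rw [h2]
    nlinarith

theorem sum_two_pow_le (K : ℕ) : ∑ m ∈ Finset.Icc 1 K, (2 : ℝ) ^ m ≤ 2 ^ (K + 1) := by
  induction K with
  | zero => simp
  | succ K ih =>
    rw [Finset.sum_Icc_succ_top (by omega), pow_succ 2 (K + 1)]
    linarith

theorem measurableBounds_mkSub [MeasurableSpace X]
    {srch : Params → ℕ → List (X × Bool) → X → Bool → OracleProg X ℝ}
    (h : ∀ m b, Measurable fun q : List (X × Bool) × X => searchValue srch O p m q.1 q.2 b) :
    MeasurableBounds O (mkSub srch) p := by
  intro m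
  simp only [mkSub_bounds]
  have hs : Measurable (p.shift m) := by unfold Params.shift; fun_prop
  exact (hs.comp (h m false)).prodMk ((hs.comp (h m true)).const_sub 1)

/-- From `exp (σ / 2) ≤ 1 + σ / 2 + σ² / 4 ≤ 1 + σ`. -/
theorem exp_half_mul_le {σ : ℝ} (h0 : 0 ≤ σ) (h1 : σ ≤ 1) (n : ℕ) :
    Real.exp (σ / 2 * n) ≤ (1 + σ) ^ n := by
  rw [mul_comm, Real.exp_nat_mul]
  gcongr
  have h := Real.abs_exp_sub_one_sub_id_le (x := σ / 2) (by rw [abs_of_nonneg] <;> linarith)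
  have := (abs_le.1 h).2
  nlinarith

end Counts

namespace Params.Valid

variable {p : Params} (hp : p.Valid)

include hp

theorem two_div_zeta_le : 2 / p.zeta ≤ 384 * p.T ^ 2 := by
  have h1 := hp.zeta_pos
  have h2 := p.M_mul_zeta
  have h3 : (3 : ℝ) ≤ p.M := by exact_mod_cast hp.three_le_M
  have h4 := hp.M_le_log
  have h5 : Real.log p.T ≤ p.T := (Real.log_le_sub_one_of_pos (by linarith [hp.four_lt_T])).trans
    (by linarith)
  have hT := hp.four_lt_T
  have h6 := hp.mul_T
  have h7 := hp.one_le_d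
  rw [div_le_iff₀ h1]
  have h8 : (p.M : ℝ) + 2 ≤ 6 * p.T := by linarith
  have h9 : 1 ≤ p.T * (32 * (6 * p.T * p.zeta)) := by
    calc (1 : ℝ) ≤ p.T * (32 * ((p.M + 2) * p.zeta)) := by rw [h2]; linarith
      _ ≤ _ := by gcongr
  nlinarith

theorem six_le_log : 6 ≤ Real.log (2 / p.zeta) := by
  have h1 := hp.zeta_pos
  have h2 := hp.zeta_le
  have h3 : p.eps * p.gam ≤ 1 / 2 * (1 / 2) :=
    mul_le_mul (hp.eps_lt_gam.le.trans hp.gam_lt.le) hp.gam_lt.le hp.gam_pos.le (by norm_num)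
  rw [Real.le_log_iff_exp_le (by positivity), le_div_iff₀ h1]
  have h4 : Real.exp 6 ≤ 1280 := by
    rw [show (6 : ℝ) = (6 : ℕ) * 1 by norm_num, Real.exp_nat_mul]
    calc Real.exp 1 ^ 6 ≤ 3 ^ 6 := by
          gcongr; linarith [Real.exp_one_lt_d9]
      _ ≤ 1280 := by norm_num
  nlinarith

theorem log_two_div_zeta_le : Real.log (2 / p.zeta) ≤ 7 * Real.log p.T := by
  have h1 := hp.zeta_pos
  have hT := hp.four_lt_T
  rw [← Real.log_rpow (by linarith)]
  refine Real.log_le_log (by positivity) (hp.two_div_zeta_le.trans ?_)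
  rw [show (7 : ℝ) = ((7 : ℕ) : ℝ) by norm_num, Real.rpow_natCast]
  have h2 : (384 : ℝ) ≤ p.T ^ 5 := by
    calc (384 : ℝ) ≤ 4 ^ 5 := by norm_num
      _ ≤ p.T ^ 5 := by gcongr
  calc 384 * p.T ^ 2 ≤ p.T ^ 5 * p.T ^ 2 := by gcongr
    _ = p.T ^ 7 := by ring

theorem log_two_div_zeta_le' : Real.log (2 / p.zeta) ≤ 13 * Real.log (p.d / p.eps) := by
  have h1 := hp.zeta_pos
  have hε := hp.eps_pos
  have hγ := hp.gam_pos
  have hd := hp.one_le_d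
  have h2 : 2 ≤ p.d / p.eps := by
    rw [le_div_iff₀ hε]; linarith [hp.eps_lt_gam, hp.gam_lt]
  have h3 : p.T ≤ (p.d / p.eps) ^ 2 := by
    unfold Params.T
    rw [div_pow]
    refine div_le_div₀ (by positivity) ?_ (by positivity) ?_
    · nlinarith
    · nlinarith [hp.eps_lt_gam]
  rw [← Real.log_rpow (by positivity)]
  refine Real.log_le_log (by positivity) (hp.two_div_zeta_le.trans ?_)
  rw [show (13 : ℝ) = ((13 : ℕ) : ℝ) by norm_num, Real.rpow_natCast]
  have h4 : (384 : ℝ) ≤ (p.d / p.eps) ^ 9 := by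
    calc (384 : ℝ) ≤ 2 ^ 9 := by norm_num
      _ ≤ _ := by gcongr
  have hT := hp.four_lt_T
  calc 384 * p.T ^ 2 ≤ (p.d / p.eps) ^ 9 * ((p.d / p.eps) ^ 2) ^ 2 := by gcongr
    _ = _ := by ring

theorem one_le_log_log : 1 ≤ Real.log (Real.log p.T / p.gam) := by
  have hγ := hp.gam_pos
  have hT := hp.log_T
  rw [Real.le_log_iff_exp_le (by have : 0 < Real.log p.T := by linarith
                                 positivity), le_div_iff₀ hγ]
  nlinarith [Real.exp_one_lt_d9, hp.gam_lt, Real.exp_pos 1]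

theorem M_le_T : (p.M : ℝ) ≤ 3 * p.T := by
  have hT := hp.four_lt_T
  linarith [hp.M_le_log, Real.log_le_sub_one_of_pos (show 0 < p.T by linarith)]

end Params.Valid

theorem Params.remaining_bounds {p : Params} {m : ℕ} (hm : m ∈ Finset.Icc 1 p.M) :
    1 ≤ (p.M : ℝ) - m + 1 ∧ (p.M : ℝ) - m + 1 ≤ p.M := by
  rw [Finset.mem_Icc] at hm
  have h1 : (m : ℝ) ≤ p.M := by exact_mod_cast hm.2
  have h2 : (1 : ℝ) ≤ m := by exact_mod_cast hm.1
  constructor <;> linarith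

/-! ### The subroutine for general classes -/

/-- Growth rate of the radii in epoch `m`. -/
def Params.rate (p : Params) (m : ℕ) : ℝ := 1 / (4 * ((p.M : ℝ) - m + 1))

/-- Number of radii in epoch `m`. -/
def Params.radii (p : Params) (m : ℕ) : ℕ := ⌊2 * Real.log (2 / p.zeta) / p.rate m⌋₊ + 1

/-- Number of bisection steps. -/
def Params.steps (p : Params) : ℕ := ⌈Real.logb 2 (2 / p.zeta)⌉₊

/-- The search for general classes. -/
def generalEpochSearch {X : Type u} (p : Params) (m : ℕ) (B : List (X × Bool)) (x : X) (b : Bool) :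
    OracleProg X ℝ :=
  generalSearch (p.beta 400 m + 400 * p.L) (p.zeta / 2) (p.rate m) (p.radii m) p.steps B x b

section General

variable {X : Type u} {F : Set (X → ℝ)} {O : List (WExample X) → X → ℝ} {p : Params}

theorem general_sandwich (hp : p.Valid) (hO : IsRegressionOracle F O)
    (hF : ∀ f ∈ F, ∀ x, f x ∈ Set.Icc (0 : ℝ) 1) {m : ℕ} (hm : m ∈ Finset.Icc 1 p.M)
    (B : List (X × Bool)) (x : X) (b : Bool) :
    Sandwich F O B x b (p.beta 400 m) (p.beta 400 m + 400 * p.L) p.zeta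
      (searchValue generalEpochSearch O p m B x b) := by
  obtain ⟨hK1, hKM⟩ := Params.remaining_bounds hm
  have hβ := hp.beta_bounds (Finset.mem_Icc.1 hm).2
  have hL := hp.one_le_L
  have hζ := hp.zeta_pos
  have hΛ := hp.six_le_log
  set K := (p.M : ℝ) - m + 1 with hK
  have hσ : 0 < p.rate m := by unfold Params.rate; rw [← hK]; positivity
  have hσ1 : p.rate m ≤ 1 := by
    unfold Params.rate; rw [← hK, div_le_one (by positivity)]; linarith
  have hβ0 : 0 ≤ p.beta 400 m := le_trans (by positivity) hβ.1
  -- The radius is at most `1202 K L` and the gap is `400 L`; the rate `1 / (4 K)` is small enough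
  -- for `K ≥ 1`.
  have hin : p.rate m ^ 2 * (p.beta 400 m + 400 * p.L) ≤
      p.beta 400 m + 400 * p.L - p.beta 400 m := by
    unfold Params.rate
    rw [← hK, div_pow, one_pow, one_div, inv_mul_le_iff₀ (by positivity)]
    nlinarith [mul_le_mul_of_nonneg_right hK1 (by linarith : (0 : ℝ) ≤ p.L),
      mul_le_mul_of_nonneg_right (mul_le_mul hK1 hK1 zero_le_one (by linarith))
      (by linarith : (0 : ℝ) ≤ p.L), mul_nonneg (mul_nonneg (by linarith : (0:ℝ) ≤ K)
      (by linarith : (0:ℝ) ≤ K - 1)) (by linarith : (0 : ℝ) ≤ p.L)]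
  have hJ : 1 < p.zeta / 2 * (1 + p.rate m) ^ p.radii m := by
    have h1 : 2 * Real.log (2 / p.zeta) / p.rate m < p.radii m := by
      unfold Params.radii; push_cast; exact Nat.lt_floor_add_one _
    rw [div_lt_iff₀ hσ] at h1
    have h2 : 2 / p.zeta < (1 + p.rate m) ^ p.radii m := by
      refine lt_of_lt_of_le ?_ (exp_half_mul_le hσ.le hσ1 _)
      rw [← Real.log_lt_iff_lt_exp (by positivity)]
      linarith
    rw [div_lt_iff₀ hζ] at h2
    linarith
  obtain ⟨h1, h2⟩ := generalSearch_sandwich (N := p.steps) hO hF (show 0 < p.beta 400 m + 400 * p.L by linarith)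
    (show 0 < p.zeta / 2 by linarith) hσ hin hJ B x b
  refine ⟨h1, fun f hf => (h2 f hf).trans ?_⟩
  have hN : 1 / (2 : ℝ) ^ p.steps ≤ p.zeta / 2 := by
    have h3 : Real.logb 2 (2 / p.zeta) ≤ p.steps := Nat.le_ceil _
    rw [Real.logb_le_iff_le_rpow (by norm_num) (by positivity), Real.rpow_natCast,
      div_le_iff₀ hζ] at h3
    rw [div_le_iff₀ (by positivity)]
    linarith
  linarith

theorem general_spec (hp : p.Valid) (hO : IsRegressionOracle F O)
    (hF : ∀ f ∈ F, ∀ x, f x ∈ Set.Icc (0 : ℝ) 1) :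
    SearchSpec F O p generalEpochSearch (p.beta 400) fun m => p.beta 400 m + 400 * p.L where
  sandwich m hm B x b := general_sandwich hp hO hF hm B x b
  le_inn m hm := by
    have h1 := Params.remaining_bounds hm
    have h2 := hp.beta_bounds (Finset.mem_Icc.1 hm).2
    nlinarith [hp.one_le_L]
  -- Search slack `400 L` plus nesting loss `400 L` equals the guaranteed drop `800 L`.
  step k m _ hkm _ := by linarith [hp.beta_step hkm]
  out_le m hm := by
    have h1 := Params.remaining_bounds hm
    have h2 := hp.beta_bounds (Finset.mem_Icc.1 hm).2
    nlinarith [hp.one_le_L]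

theorem general_approximatesBounds (hp : p.Valid) (hO : IsRegressionOracle F O)
    (hF : ∀ f ∈ F, ∀ x, f x ∈ Set.Icc (0 : ℝ) 1) (ω : ℕ → X × Bool) :
    ApproximatesBounds 400 2 F O (mkSub generalEpochSearch) p ω := by
  refine approximatesBounds_of_search hp hO hF (fun m hm B x b => ?_) ω
  obtain ⟨⟨f, hf, hfe⟩, h2⟩ := general_sandwich hp hO hF hm B x b
  have h3 := Params.remaining_bounds hm
  have h4 := hp.beta_bounds (Finset.mem_Icc.1 hm).2
  have h5 : 400 * p.L ≤ p.beta 400 m := by nlinarith [hp.one_le_L]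
  have h6 := hp.zeta_le
  have h7 := hp.eps_lt_gam
  have h8 := hp.gam_lt
  refine ⟨⟨f, ⟨hf.1, hf.2.trans (by linarith)⟩, hfe⟩, fun g hg => (h2 g hg).trans ?_⟩
  nlinarith [hp.eps_pos]

theorem general_calls (hp : p.Valid) {m : ℕ} (hm : m ∈ Finset.Icc 1 p.M) (B : List (X × Bool))
    (x : X) : (((mkSub generalEpochSearch p m B x).calls O : ℕ) : ℝ) ≤
      40 * ((p.M : ℝ) - m + 1) * Real.log (2 / p.zeta) ^ 2 := by
  have h1 := mkSub_calls generalEpochSearch O p m B x (fun b => generalSearch_calls O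
    (p.beta 400 m + 400 * p.L) (p.zeta / 2) (p.rate m) (p.radii m) p.steps B x b)
  have h2 : (((mkSub generalEpochSearch p m B x).calls O : ℕ) : ℝ) ≤
      2 * (p.steps * p.radii m + 1) := by exact_mod_cast h1
  refine h2.trans ?_
  obtain ⟨hK1, hKM⟩ := Params.remaining_bounds hm
  have hΛ := hp.six_le_log
  have hζ := hp.zeta_pos
  have hN : (p.steps : ℝ) ≤ 2 * Real.log (2 / p.zeta) := by
    have hlog2 := Real.log_two_gt_d9
    have h3 : (p.steps : ℝ) < Real.logb 2 (2 / p.zeta) + 1 := by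
      refine Nat.ceil_lt_add_one ?_
      unfold Real.logb
      exact div_nonneg (by linarith) (by linarith)
    have h4 : Real.logb 2 (2 / p.zeta) ≤ 3 / 2 * Real.log (2 / p.zeta) := by
      unfold Real.logb
      rw [div_le_iff₀ (by linarith)]
      nlinarith
    linarith
  set K := (p.M : ℝ) - m + 1 with hK
  set Λ := Real.log (2 / p.zeta) with hΛdef
  have hJ : (p.radii m : ℝ) ≤ 9 * (K * Λ) := by
    unfold Params.radii
    push_cast
    have h3 : (⌊2 * Λ / p.rate m⌋₊ : ℝ) ≤ 2 * Λ / p.rate m :=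
      Nat.floor_le (by unfold Params.rate; rw [← hK]; positivity)
    have h4 : 2 * Λ / p.rate m = 8 * (K * Λ) := by
      unfold Params.rate; rw [← hK]; field_simp; ring
    nlinarith
  have h5 : (p.steps : ℝ) * p.radii m ≤ 2 * Λ * (9 * (K * Λ)) := by gcongr
  have h6 : 1 ≤ K * Λ ^ 2 := by nlinarith
  nlinarith

end General

/-! ### The subroutine for convex classes -/

/-- Growth rate of the weights. -/
def Params.weightRate (p : Params) : ℝ := p.gam / (8 * p.M)

/-- Number of bisection steps over the weights. -/
def Params.weightSteps (p : Params) : ℕ :=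
  ⌈Real.logb 2 (4 * Real.log (2 / p.zeta) / p.weightRate)⌉₊

/-- The search for convex classes. -/
def convexEpochSearch {X : Type u} (p : Params) (m : ℕ) (B : List (X × Bool)) (x : X) (b : Bool) :
    OracleProg X ℝ :=
  convexSearch (p.beta 400 m) p.weightRate p.weightSteps B x b

section ConvexClass

variable {X : Type u} {F : Set (X → ℝ)} {O : List (WExample X) → X → ℝ} {p : Params}

theorem weightRate_bounds (hp : p.Valid) : 0 < p.weightRate ∧ p.weightRate ≤ p.gam / 24 := by
  have h1 : (3 : ℝ) ≤ p.M := by exact_mod_cast hp.three_le_M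
  have hγ := hp.gam_pos
  unfold Params.weightRate
  refine ⟨by positivity, ?_⟩
  gcongr
  linarith

theorem convex_sandwich (hp : p.Valid) (hO : IsRegressionOracle F O)
    (hF : ∀ f ∈ F, ∀ x, f x ∈ Set.Icc (0 : ℝ) 1) (hc : Convex ℝ F) {m : ℕ}
    (hm : m ∈ Finset.Icc 1 p.M) (B : List (X × Bool)) (x : X) (b : Bool) :
    Sandwich F O B x b (p.beta 400 m / (1 + p.weightRate)) (p.beta 400 m) p.zeta
      (searchValue convexEpochSearch O p m B x b) := by
  obtain ⟨hK1, hKM⟩ := Params.remaining_bounds hm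
  have hβ := hp.beta_bounds (Finset.mem_Icc.1 hm).2
  have hL := hp.one_le_L
  have hζ := hp.zeta_pos
  have hΛ := hp.six_le_log
  obtain ⟨hρ, hρ1⟩ := weightRate_bounds hp
  have hγ := hp.gam_lt
  have hβ0 : 0 < p.beta 400 m := lt_of_lt_of_le (by positivity) hβ.1
  refine convexSearch_sandwich hO hF hc hβ0 hζ hρ ?_ ?_ ?_ B x b
  · rw [div_mul_cancel₀ _ (by positivity)]
  · exact div_le_self hβ0.le (by linarith)
  · have h1 : Real.logb 2 (4 * Real.log (2 / p.zeta) / p.weightRate) ≤ p.weightSteps :=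
      Nat.le_ceil _
    rw [Real.logb_le_iff_le_rpow (by norm_num) (by positivity), Real.rpow_natCast,
      div_le_iff₀ hρ] at h1
    have h2 := exp_half_mul_le hρ.le (show p.weightRate ≤ 1 by linarith) (2 ^ p.weightSteps)
    have h3 : (2 / p.zeta) ^ 2 ≤ (1 + p.weightRate) ^ (2 ^ p.weightSteps) := by
      refine le_trans ?_ h2
      rw [← Real.log_le_iff_le_exp (by positivity), Real.log_pow]
      push_cast
      linarith
    calc (1 : ℝ) ≤ p.zeta ^ 2 * (2 / p.zeta) ^ 2 := by field_simp; norm_num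
      _ ≤ _ := by gcongr

theorem convex_spec (hp : p.Valid) (hO : IsRegressionOracle F O)
    (hF : ∀ f ∈ F, ∀ x, f x ∈ Set.Icc (0 : ℝ) 1) (hc : Convex ℝ F) :
    SearchSpec F O p convexEpochSearch (fun m => p.beta 400 m / (1 + p.weightRate))
      (p.beta 400) where
  sandwich m hm B x b := convex_sandwich hp hO hF hc hm B x b
  le_inn m hm := by
    have h1 := Params.remaining_bounds hm
    have h2 := hp.beta_bounds (Finset.mem_Icc.1 hm).2
    obtain ⟨hρ, hρ1⟩ := weightRate_bounds hp
    rw [le_div_iff₀ (by positivity)]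
    nlinarith [hp.one_le_L, hp.gam_lt]
  step k m hk hkm hm := by
    have hmem : m ∈ Finset.Icc 1 p.M := Finset.mem_Icc.2 ⟨by omega, hm⟩
    have h1 := Params.remaining_bounds hmem
    have h2 := hp.beta_bounds hm
    obtain ⟨hρ, hρ1⟩ := weightRate_bounds hp
    have h3 := hp.beta_step hkm
    have hL := hp.one_le_L
    -- The radius can be of order `M L`, so the weight rate carries a factor `1 / M`.
    have h4 : p.weightRate * (p.beta 400 m + 400 * p.L) ≤ 400 * p.L := by
      have h5 : p.beta 400 m + 400 * p.L ≤ 1202 * (p.M * p.L) := by nlinarith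
      have h6 : p.weightRate * (p.M * p.L) = p.gam / 8 * p.L := by
        have : (p.M : ℝ) ≠ 0 := by linarith
        unfold Params.weightRate; field_simp
      nlinarith [mul_le_mul_of_nonneg_left h5 hρ.le, hp.gam_lt]
    rw [le_div_iff₀ (by positivity)]
    linarith
  out_le m hm := by
    have h1 := Params.remaining_bounds hm
    have h2 := hp.beta_bounds (Finset.mem_Icc.1 hm).2
    nlinarith [hp.one_le_L]

/-- Mixing `f` slightly with the empirical minimizer brings it from radius `β` to `β / (1 + ρ)` and
moves its value by at most `ρ ≤ γ / 24`; so the same radius serves inside and outside. -/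
theorem convex_approximatesBounds (hp : p.Valid) (hO : IsRegressionOracle F O)
    (hF : ∀ f ∈ F, ∀ x, f x ∈ Set.Icc (0 : ℝ) 1) (hc : Convex ℝ F) (ω : ℕ → X × Bool) :
    ApproximatesBounds 400 1 F O (mkSub convexEpochSearch) p ω := by
  refine approximatesBounds_of_search hp hO hF (fun m hm B x b => ?_) ω
  obtain ⟨h1, h2⟩ := convex_sandwich hp hO hF hc hm B x b
  rw [one_mul]
  refine ⟨h1, fun f hf => ?_⟩
  obtain ⟨hρ, hρ1⟩ := weightRate_bounds hp
  set ρ := p.weightRate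
  set β := p.beta 400 m
  set s := ρ / (1 + ρ) with hs
  have hs0 : 0 ≤ s := by positivity
  have hs1 : s ≤ ρ := div_le_self hρ.le (by linarith)
  have hs2 : 1 - s = 1 / (1 + ρ) := by rw [hs]; field_simp; ring
  have hs3 : 0 ≤ 1 - s := by rw [hs2]; positivity
  have hfh : fhat O B ∈ F := (hO _).1
  have hg : (1 - s) • f + s • fhat O B ∈ activeSet F O B (β / (1 + ρ)) := by
    refine ⟨hc hf.1 hfh hs3 hs0 (by ring), ?_⟩
    refine (wLoss_convex _ _ _ hs0 (by linarith)).trans ?_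
    have h3 := mul_le_mul_of_nonneg_left hf.2 hs3
    have h4 : (1 - s) * β = β / (1 + ρ) := by rw [hs2]; ring
    linarith
  have h5 := h2 _ hg
  have h6 : side b (((1 - s) • f + s • fhat O B) x) =
      side b (f x) + s * (side b (fhat O B x) - side b (f x)) := side_combo b s _ _
  have h7 := side_mem_Icc (b := b) (hF f hf.1 x)
  have h8 := side_mem_Icc (b := b) (hF _ hfh x)
  have h9 := hp.zeta_le
  have h10 := hp.gam_lt
  have h11 := hp.eps_lt_gam
  rw [h6] at h5
  have h12 : s * (side b (fhat O B x) - side b (f x)) ≤ s * 1 := by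
    gcongr; linarith [h7.1, h8.2]
  nlinarith [hp.eps_pos]

/-- Bisection runs over exponents of the weight, whose number is of order `M log (2 / ζ) / γ` with
both `M` and `log (2 / ζ)` of order `log T`; only the logarithm of this number enters. -/
theorem convex_calls (hp : p.Valid) (m : ℕ) (B : List (X × Bool)) (x : X) :
    (((mkSub convexEpochSearch p m B x).calls O : ℕ) : ℝ) ≤
      40 * Real.log (Real.log p.T / p.gam) := by
  have h1 := mkSub_calls convexEpochSearch O p m B x (fun b => convexSearch_calls O
    (p.beta 400 m) p.weightRate p.weightSteps B x b)
  have h2 : (((mkSub convexEpochSearch p m B x).calls O : ℕ) : ℝ) ≤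
      2 * (p.weightSteps + 3) := by exact_mod_cast h1
  refine h2.trans ?_
  have hℓ := hp.one_le_log_log
  have hΛ := hp.six_le_log
  have hΛ7 := hp.log_two_div_zeta_le
  have hM := hp.M_le_log
  have hM3 : (3 : ℝ) ≤ p.M := by exact_mod_cast hp.three_le_M
  have hγ := hp.gam_pos
  have hγ1 := hp.gam_lt
  have hT := hp.log_T
  have hT0 : 0 < Real.log p.T := by linarith
  obtain ⟨hρ, hρ1⟩ := weightRate_bounds hp
  set Λ := Real.log (2 / p.zeta)
  have hlog2 := Real.log_two_gt_d9
  have hY1 : 1 ≤ 4 * Λ / p.weightRate := by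
    rw [le_div_iff₀ hρ]; linarith
  have h3 : (p.weightSteps : ℝ) < Real.logb 2 (4 * Λ / p.weightRate) + 1 :=
    Nat.ceil_lt_add_one (Real.logb_nonneg (by norm_num) hY1)
  have h4 : 4 * Λ / p.weightRate ≤ 729 * (Real.log p.T / p.gam) ^ 2 := by
    have h5 : 4 * Λ / p.weightRate = 32 * (p.M * Λ) / p.gam := by
      unfold Params.weightRate; field_simp; ring
    rw [h5, div_pow, ← mul_div_assoc]
    refine div_le_div₀ (by positivity) ?_ (by positivity) (by nlinarith)
    have : (p.M : ℝ) * Λ ≤ 3 * Real.log p.T * (7 * Real.log p.T) := by gcongr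
    nlinarith
  have h5 : Real.log (4 * Λ / p.weightRate) ≤ 9 * Real.log (Real.log p.T / p.gam) := by
    refine (Real.log_le_log (by linarith) h4).trans ?_
    rw [Real.log_mul (by norm_num) (by positivity), Real.log_pow]
    have h6 : Real.log 729 ≤ 7 := by
      rw [Real.log_le_iff_le_exp (by norm_num), show (7 : ℝ) = (7 : ℕ) * 1 by norm_num,
        Real.exp_nat_mul]
      calc (729 : ℝ) ≤ 2.7 ^ 7 := by norm_num
        _ ≤ _ := by gcongr; linarith [Real.exp_one_gt_d9]
    push_cast
    linarith
  have h6 : Real.logb 2 (4 * Λ / p.weightRate) ≤ 14 * Real.log (Real.log p.T / p.gam) := by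
    unfold Real.logb
    rw [div_le_iff₀ (by linarith)]
    nlinarith
  linarith

end ConvexClass

/-! ### Totals -/

section Totals

variable {X : Type u} {F : Set (X → ℝ)} {O : List (WExample X) → X → ℝ} {p : Params}

theorem general_trainingCalls_le (hp : p.Valid) (ω : ℕ → X × Bool) :
    (trainingCalls O (mkSub generalEpochSearch) p ω : ℝ) ≤
      12000 * (p.d / (p.eps * p.gam ^ 3)) * Real.log p.T ^ 2 *
        Real.log (Real.log p.T / p.gam) := by
  have hM3 := hp.three_le_M
  have hmem : ∀ m ∈ Finset.Icc 1 (p.M - 1), m ∈ Finset.Icc 1 p.M := fun m hm =>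
    Finset.Icc_subset_Icc_right (Nat.sub_le _ _) hm
  have h1 := trainingCalls_le (O := O) (A := mkSub generalEpochSearch) (p := p)
    (fun m hm B x => general_calls hp (hmem m hm) B x)
    (fun m hm => mul_nonneg (mul_nonneg (by norm_num)
      (by linarith [(Params.remaining_bounds (hmem m hm)).1])) (sq_nonneg _)) ω
  refine h1.trans ?_
  have h2 := sum_two_pow_mul_le (p.M - 1) p.M (Nat.sub_le _ _)
  rw [Nat.sub_add_cancel (by omega), Nat.cast_sub (by omega), Nat.cast_one] at h2
  have h3 : ∑ m ∈ Finset.Icc 1 (p.M - 1), (2 : ℝ) ^ m *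
      (40 * ((p.M : ℝ) - m + 1) * Real.log (2 / p.zeta) ^ 2) =
      40 * Real.log (2 / p.zeta) ^ 2 *
        ∑ m ∈ Finset.Icc 1 (p.M - 1), (2 : ℝ) ^ m * ((p.M : ℝ) - m + 1) := by
    rw [Finset.mul_sum]
    exact Finset.sum_congr rfl fun m _ => by ring
  rw [h3]
  have hΛ := hp.six_le_log
  have h4 : Real.log (2 / p.zeta) ^ 2 ≤ (7 * Real.log p.T) ^ 2 := by
    gcongr
    exact hp.log_two_div_zeta_le
  have h5 := hp.two_pow_lt
  have h6 := hp.M_le_T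
  have hT := hp.four_lt_T
  have hℓ := hp.one_le_log_log
  have hl := hp.log_T
  have hγ := hp.gam_pos
  have hε := hp.eps_pos
  have hγ1 := hp.gam_lt
  have h7 : 40 * Real.log (2 / p.zeta) ^ 2 *
      ∑ m ∈ Finset.Icc 1 (p.M - 1), (2 : ℝ) ^ m * ((p.M : ℝ) - m + 1) ≤
      40 * (7 * Real.log p.T) ^ 2 * (2 * p.T * 3) := by
    refine mul_le_mul (by linarith) (h2.trans (by nlinarith)) (Finset.sum_nonneg fun m hm => ?_)
      (by positivity)
    exact mul_nonneg (by positivity)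
      (by linarith [(Params.remaining_bounds (hmem m hm)).1])
  have h8 : p.T ≤ p.d / (p.eps * p.gam ^ 3) := by
    unfold Params.T
    gcongr
    exact pow_le_of_le_one hγ.le (by linarith) (by norm_num)
  have hl2 : 1 ≤ Real.log p.T ^ 2 := by nlinarith
  calc _ ≤ 3 * p.T + 40 * (7 * Real.log p.T) ^ 2 * (2 * p.T * 3) := add_le_add h6 h7
    _ ≤ 12000 * p.T * Real.log p.T ^ 2 * 1 := by nlinarith
    _ ≤ _ := by gcongr

theorem general_inferenceCalls_le (hp : p.Valid) (ω : ℕ → X × Bool) (x : X) :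
    (inferenceCalls O (mkSub generalEpochSearch) p ω x : ℝ) ≤
      12000 * (1 / p.gam ^ 2) * Real.log (p.d / p.eps) ^ 2 *
        Real.log (Real.log p.T / p.gam) := by
  have hM3 := hp.three_le_M
  have h1 := general_calls (O := O) hp (m := p.M) (Finset.mem_Icc.2 ⟨by omega, le_rfl⟩)
    (queried O (mkSub generalEpochSearch) p ω (p.M - 1)) x
  rw [sub_self, zero_add, mul_one] at h1
  refine h1.trans ?_
  have hΛ := hp.six_le_log
  have hℓ := hp.one_le_log_log
  have hγ := hp.gam_pos
  have hγ1 := hp.gam_lt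
  have h2 : 1 ≤ 1 / p.gam ^ 2 := by
    rw [le_div_iff₀ (by positivity)]; nlinarith
  calc 40 * Real.log (2 / p.zeta) ^ 2 ≤ 40 * (13 * Real.log (p.d / p.eps)) ^ 2 := by
        gcongr
        exact hp.log_two_div_zeta_le'
    _ ≤ 12000 * 1 * Real.log (p.d / p.eps) ^ 2 * 1 := by
        nlinarith [sq_nonneg (Real.log (p.d / p.eps))]
    _ ≤ _ := by gcongr

theorem convex_trainingCalls_le (hp : p.Valid) (ω : ℕ → X × Bool) :
    (trainingCalls O (mkSub convexEpochSearch) p ω : ℝ) ≤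
      12000 * p.T * Real.log (Real.log p.T / p.gam) := by
  have hM3 := hp.three_le_M
  have hℓ := hp.one_le_log_log
  have h1 := trainingCalls_le (O := O) (A := mkSub convexEpochSearch) (p := p)
    (fun m _ B x => convex_calls hp m B x) (fun m _ => by linarith) ω
  refine h1.trans ?_
  rw [← Finset.sum_mul]
  have h2 := sum_two_pow_le (p.M - 1)
  rw [Nat.sub_add_cancel (by omega)] at h2
  have h5 := hp.two_pow_lt
  have h6 := hp.M_le_T
  have hT := hp.four_lt_T
  have h7 : (∑ m ∈ Finset.Icc 1 (p.M - 1), (2 : ℝ) ^ m) *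
      (40 * Real.log (Real.log p.T / p.gam)) ≤
      2 * p.T * (40 * Real.log (Real.log p.T / p.gam)) := by
    gcongr
    exact h2.trans h5.le
  nlinarith

theorem convex_inferenceCalls_le (hp : p.Valid) (ω : ℕ → X × Bool) (x : X) :
    (inferenceCalls O (mkSub convexEpochSearch) p ω x : ℝ) ≤
      12000 * Real.log (Real.log p.T / p.gam) := by
  refine (convex_calls hp p.M (queried O (mkSub convexEpochSearch) p ω (p.M - 1)) x).trans ?_
  linarith [hp.one_le_log_log]

end Totals

end

end Abstention

/-! ### Assembly of the two implementations -/

theorem mainTheorem11 :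
    ∃ c C : ℝ, 0 < c ∧ 0 < C ∧ ∀ (X : Type u) [MeasurableSpace X],
      -- general classes
      (∃ A : Abstention.CISub X, ∀ p : Abstention.Params, p.Valid →
        ∀ F : Set (X → ℝ), Abstention.IsRegressionClass F → Abstention.pdim F = (p.d : ℕ∞) →
        ∀ O : List (Abstention.WExample X) → X → ℝ,
          Abstention.IsRegressionOracle F O → Abstention.MeasurableOracle O →
          Abstention.StatGuarantee C F O A p ∧
          ∀ ω : ℕ → X × Bool,
            Abstention.ApproximatesBounds c 2 F O A p ω ∧
            (Abstention.trainingCalls O A p ω : ℝ) ≤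
              C * (p.d / (p.eps * p.gam ^ 3)) * Real.log (p.d / (p.eps * p.gam)) ^ 2 *
                Real.log (Real.log (p.d / (p.eps * p.gam)) / p.gam) ∧
            ∀ x : X, (Abstention.inferenceCalls O A p ω x : ℝ) ≤
              C * (1 / p.gam ^ 2) * Real.log (p.d / p.eps) ^ 2 *
                Real.log (Real.log (p.d / (p.eps * p.gam)) / p.gam)) ∧
      -- convex classes that are closed under pointwise convergence
      (∃ A : Abstention.CISub X, ∀ p : Abstention.Params, p.Valid →
        ∀ F : Set (X → ℝ), Abstention.IsRegressionClass F → Abstention.pdim F = (p.d : ℕ∞) →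
        Convex ℝ F → IsSeqClosed F →
        ∀ O : List (Abstention.WExample X) → X → ℝ,
          Abstention.IsRegressionOracle F O → Abstention.MeasurableOracle O →
          Abstention.StatGuarantee C F O A p ∧
          ∀ ω : ℕ → X × Bool,
            Abstention.ApproximatesBounds c 1 F O A p ω ∧
            (Abstention.trainingCalls O A p ω : ℝ) ≤
              C * (p.d / (p.eps * p.gam)) *
                Real.log (Real.log (p.d / (p.eps * p.gam)) / p.gam) ∧
            ∀ x : X, (Abstention.inferenceCalls O A p ω x : ℝ) ≤
              C * Real.log (Real.log (p.d / (p.eps * p.gam)) / p.gam)) := by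
  -- `c = 400` makes the radius drop by at least `2 c L = 800 L` per epoch. `C` is set by the label
  -- bound; the other constants are smaller.
  refine ⟨400, 2000000, by norm_num, by norm_num, fun X _ => ⟨?_, ?_⟩⟩
  · refine ⟨Abstention.mkSub Abstention.generalEpochSearch, fun p hp F hF hd O hO hOm => ?_⟩
    have hℓ := hp.one_le_log_log
    have hγ := hp.gam_pos
    have hε := hp.eps_pos
    refine ⟨Abstention.statGuarantee_of_search hp hF hd hO hOm
      (Abstention.measurableBounds_mkSub (srch := Abstention.generalEpochSearch) fun m b =>
        Abstention.measurable_generalSearch hOm measurable_fst measurable_snd _ _ _ _ _ b)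
      (Abstention.general_spec hp hO hF.range) le_rfl, fun ω =>
      ⟨Abstention.general_approximatesBounds hp hO hF.range ω,
        (Abstention.general_trainingCalls_le hp ω).trans ?_, fun x =>
        (Abstention.general_inferenceCalls_le hp ω x).trans ?_⟩⟩
    · change _ ≤ 2000000 * _ * Real.log p.T ^ 2 * Real.log (Real.log p.T / p.gam)
      gcongr
      norm_num
    · change _ ≤ 2000000 * _ * _ * Real.log (Real.log p.T / p.gam)
      gcongr
      norm_num
  · refine ⟨Abstention.mkSub Abstention.convexEpochSearch, fun p hp F hF hd hc _ O hO hOm => ?_⟩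
    have hℓ := hp.one_le_log_log
    have hT := hp.four_lt_T
    refine ⟨Abstention.statGuarantee_of_search hp hF hd hO hOm
      (Abstention.measurableBounds_mkSub (srch := Abstention.convexEpochSearch) fun m b =>
        Abstention.measurable_convexSearch hOm measurable_fst measurable_snd _ _ _ b)
      (Abstention.convex_spec hp hO hF.range hc) le_rfl, fun ω =>
      ⟨Abstention.convex_approximatesBounds hp hO hF.range hc ω,
        (Abstention.convex_trainingCalls_le hp ω).trans ?_, fun x =>
        (Abstention.convex_inferenceCalls_le hp ω x).trans ?_⟩⟩
    · change _ ≤ 2000000 * p.T * Real.log (Real.log p.T / p.gam)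
      gcongr
      norm_num
    · change _ ≤ 2000000 * Real.log (Real.log p.T / p.gam)
      gcongr
      norm_num
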